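/- **Theorem (unconditional second-order convergence of the implicit midpoint WSGD scheme).** Let $1<\alpha\le 2$, $\upsilon>0$, $\kappa>0$, $\eta,\zeta,\gamma\in\mathbb R$, $a<b$, $T>0$, $\Omega=(a,b)$, $u_0:\mathbb R\to\mathbb C$. For a function $w$ on $\mathbb R$ write $$(-\Delta)^{\alpha/2}w=\frac{1}{2\cos(\alpha\pi/2)}\big[{}_{-\infty}D_x^{\alpha}w+{}_xD_{+\infty}^{\alpha}w\big],$$ where, for $1<\alpha<2$, $${}_{-\infty}D_x^{\alpha}w(x)=\frac1{\Gamma(2-\alpha)}\frac{d^2}{dx^2}\int_{-\infty}^x\frac{w(\xi)}{(x-\xi)^{\alpha-1}}\,d\xi,\qquad {}_xD_{+\infty}^{\alpha}w(x)=\frac1{\Gamma(2-\alpha)}\frac{d^2}{dx^2}\int_x^{+\infty}\frac{w(\xi)}{(\xi-x)^{\alpha-1}}\,d\xi,$$ and both derivatives are $w''$ for $\alpha=2$. Suppose that the problem $$u_t+(\upsilon+i\eta)(-\Delta)^{\alpha/2}u+(\kappa+i\zeta)|u|^2u-\gamma u=0,\quad x\in\Omega,\ t\in(0,T],$$ $$u(x,0)=u_0(x)\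 (x\in\mathbb R),\qquad u(x,t)=0\ (x\in\mathbb R\setminus\Omega,\ t\in[0,T])$$ has a smooth solution $u$, that is, one which is $C^\infty$ on $[a,b]\times[0,T]$. For positive integers $M,N$ let $h=(b-a)/M$, $\tau=T/N$, $x_j=a+jh$, $t_n=n\tau$. Let $g_l=(-1)^l\binom{\alpha}{l}$, $\lambda_1=\frac{\alpha^2+3\alpha+2}{12}$, $\lambda_0=\frac{4-\alpha^2}{6}$, $\lambda_{-1}=\frac{\alpha^2-3\alpha+2}{12}$, $w_0=\lambda_1g_0$, $w_1=\lambda_1g_1+\lambda_0g_0$, $w_l=\lambda_1g_l+\lambda_0g_{l-1}+\lambda_{-1}g_{l-2}$ for $l\ge2$, and $$\Delta_h^{\alpha}v_j=\frac{1}{h^\alpha}\frac{1}{2\cos(\alpha\pi/2)}\Big(\sum_{l=0}^{j+1}w_lv_{j-l+1}+\sum_{l=0}^{M-j+1}w_lv_{j+l-1}\Big),\quad 1\le j\le M-1.$$ A solution of the difference scheme is a family $u^n_j\in\mathbb C$ ($0\le n\le N$, $j\in\mathbb Z$) with $u^0_j=u_0(x_j)$ for all $j\in\mathbb Z$, with $u^n_j=0$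 for $0\le n\le N$ and $j\notin\{1,\dots,M-1\}$, and with $$\frac{u_j^{n+1}-u_j^n}{\tau}+(\upsilon+i\eta)\Delta_h^\alpha u_j^{n+\frac12}+(\kappa+i\zeta)|u_j^{n+\frac12}|^2u_j^{n+\frac12}-\gamma u_j^{n+\frac12}=0,\quad u_j^{n+\frac12}=\tfrac12(u_j^{n+1}+u_j^n),$$ for $1\le j\le M-1$, $0\le n\le N-1$. Put $e^n_j=u(x_j,t_n)-u^n_j$ and $\|e^n\|_h=\big(h\sum_{j=1}^{M-1}|e^n_j|^2\big)^{1/2}$. Then there are $\tau_0>0$ and $C>0$, independent of $\tau$ and $h$, such that for all $M,N$ with $0<\tau\le\tau_0$ (and with no restriction relating $\tau$ and $h$), every solution of the difference scheme satisfies $$\|e^n\|_h\le C(\tau^2+h^2),\qquad 0\le n\le N.$$ -/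

import Mathlib

open scoped ContDiff

noncomputable section

namespace FGLE

/-! ### The continuous operator -/

/-- Left Riemann–Liouville derivative of order `α ∈ (1, 2]` on the whole line. For `α < 2` it is
`(1 / Γ(2 - α)) (d²/dx²) ∫_{-∞}^x u(ξ) (x - ξ)^{1-α} dξ`; for the integer order `α = 2` it is, as
usual, the ordinary second derivative. -/
def leftRL (α : ℝ) (u : ℝ → ℂ) (x : ℝ) : ℂ :=
  if α = 2 then iteratedDeriv 2 u x
  else ((1 / Real.Gamma (2 - α) : ℝ) : ℂ) *
    iteratedDeriv 2 (fun y : ℝ => ∫ ξ in Set.Iio y, u ξ / (((y - ξ) ^ (α - 1) : ℝ) : ℂ)) x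

/-- Right Riemann–Liouville derivative of order `α ∈ (1, 2]` on the whole line. -/
def rightRL (α : ℝ) (u : ℝ → ℂ) (x : ℝ) : ℂ :=
  if α = 2 then iteratedDeriv 2 u x
  else ((1 / Real.Gamma (2 - α) : ℝ) : ℂ) *
    iteratedDeriv 2 (fun y : ℝ => ∫ ξ in Set.Ioi y, u ξ / (((ξ - y) ^ (α - 1) : ℝ) : ℂ)) x

/-- The fractional Laplacian `(-Δ)^{α/2}`, written as a Riesz derivative. For `α = 2` this is
`-u''`. -/
def fracLaplacian (α : ℝ) (u : ℝ → ℂ) (x : ℝ) : ℂ :=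
  ((1 / (2 * Real.cos (α * Real.pi / 2)) : ℝ) : ℂ) * (leftRL α u x + rightRL α u x)

/-- `u` is a smooth solution of the truncated fractional Ginzburg–Landau problem on `(a, b)`, with
initial value `u₀` and the condition `u = 0` off `(a, b)`. Smoothness is up to the boundary of the
space-time cylinder; values `u x t` with `t ∉ [0, T]` are irrelevant. -/
structure IsSmoothSolution (α ν η κ ζ γ a b T : ℝ) (u₀ : ℝ → ℂ) (u : ℝ → ℝ → ℂ) : Prop where
  smooth : ContDiffOn ℝ ∞ (fun p : ℝ × ℝ => u p.1 p.2) (Set.Icc a b ×ˢ Set.Icc 0 T)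
  equation : ∀ x ∈ Set.Ioo a b, ∀ t ∈ Set.Ioc 0 T,
    derivWithin (fun s => u x s) (Set.Icc 0 T) t
      + (ν + η * Complex.I) * fracLaplacian α (fun y => u y t) x
      + (κ + ζ * Complex.I) * (‖u x t‖ ^ 2 : ℝ) * u x t - γ * u x t = 0
  initial : ∀ x, u x 0 = u₀ x
  exterior : ∀ x, x ∉ Set.Ioo a b → ∀ t ∈ Set.Icc 0 T, u x t = 0

/-! ### The weighted and shifted Grünwald difference operator -/

/-- Grünwald coefficients: `(1 - z)^α = ∑ g_l z^l`. -/
def grunwald (α : ℝ) (l : ℕ) : ℝ := (-1) ^ l * Ring.choose α l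

/-- The weights `λ₁, λ₀, λ₋₁` of the shifted Grünwald formulae. -/
def lamOne (α : ℝ) : ℝ := (α ^ 2 + 3 * α + 2) / 12
def lamZero (α : ℝ) : ℝ := (4 - α ^ 2) / 6
def lamNegOne (α : ℝ) : ℝ := (α ^ 2 - 3 * α + 2) / 12

/-- The coefficients `w_l` of the weighted and shifted Grünwald difference operator. -/
def weight (α : ℝ) : ℕ → ℝ
  | 0 => lamOne α * grunwald α 0
  | 1 => lamOne α * grunwald α 1 + lamZero α * grunwald α 0
  | l + 2 => lamOne α * grunwald α (l + 2) + lamZero α * grunwald α (l + 1)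
      + lamNegOne α * grunwald α l

/-- The difference approximation of `(-Δ)^{α/2}` at the interior node `j`, `1 ≤ j ≤ M - 1`, of a
grid with `M` subintervals of length `h`. -/
def discreteLaplacian (α h : ℝ) (M : ℕ) (v : ℤ → ℂ) (j : ℕ) : ℂ :=
  ((1 / h ^ α * (1 / (2 * Real.cos (α * Real.pi / 2))) : ℝ) : ℂ) *
    (∑ l ∈ Finset.range (j + 2), (weight α l : ℂ) * v ((j : ℤ) - l + 1)
      + ∑ l ∈ Finset.range (M - j + 2), (weight α l : ℂ) * v ((j : ℤ) + l - 1))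

/-- The discrete norm `‖v‖_h = (h ∑_{j=1}^{M-1} |v_j|²)^{1/2}`. -/
def gridNorm (h : ℝ) (M : ℕ) (v : ℤ → ℂ) : ℝ :=
  Real.sqrt (h * ∑ j ∈ Finset.Ico 1 M, ‖v (j : ℤ)‖ ^ 2)

/-! ### The implicit midpoint scheme -/

/-- `v n j` (time level `n ≤ N`, node `j ∈ ℤ`) solves the implicit midpoint difference scheme with
`h = (b - a) / M`, `τ = T / N`. -/
structure IsSchemeSolution (α ν η κ ζ γ a b T : ℝ) (u₀ : ℝ → ℂ) (M N : ℕ) (v : ℕ → ℤ → ℂ) :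
    Prop where
  scheme : ∀ n < N, ∀ j ∈ Finset.Ico 1 M,
    (v (n + 1) j - v n j) / ((T / N : ℝ) : ℂ)
      + (ν + η * Complex.I) *
          discreteLaplacian α ((b - a) / M) M (fun i => (v (n + 1) i + v n i) / 2) j
      + (κ + ζ * Complex.I) * (‖(v (n + 1) j + v n j) / 2‖ ^ 2 : ℝ) * ((v (n + 1) j + v n j) / 2)
      - γ * ((v (n + 1) j + v n j) / 2) = 0
  initial : ∀ j : ℤ, v 0 j = u₀ (a + j * ((b - a) / M))
  boundary : ∀ n ≤ N, ∀ j : ℤ, ¬ (1 ≤ j ∧ j ≤ (M : ℤ) - 1) → v n j = 0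

end FGLE

end

namespace FGLE

/-! ### Grünwald coefficients -/

/-! The proof is an energy estimate. Insert the exact solution into the scheme, subtract the scheme,
multiply by the conjugate of the time-averaged error, sum over the grid and take real parts. The
time difference telescopes exactly (`re_sub_mul_conj_average`). The discrete Laplacian has a real
nonnegative quadratic form (`discreteLaplacian_nonneg`): its symmetrised Toeplitz matrix has
nonnegative off-diagonal entries and nonpositive interior row sums, and the prefactor 1/cos(απ/2) is
negative. Hence υ > 0 gives this term the good sign and η drops out. Since κ > 0, the cubic term
obeys a one-sided Lipschitz bound that involves the exact solution only
(`re_cubic_sub_mul_conj_ge`). No bound on the numerical solution is needed, which is why τ and h are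
unrelated. `discrete_gronwall` concludes once the residual is O(τ² + h²).

The delicate point is that residual (`exists_residual_bound`). The Fourier proof of second order in
space works with functions smooth on all of ℝ, whereas u(·,t) is only assumed smooth on [a,b] and is
extended by zero. For α < 2 the equation supplies the missing regularity
(`contDiff_of_fracLaplacian`): it makes the fractional Laplacian of u(·,t) agree on (a,b) with a
function smooth up to the end points, but a nonzero one-sided slope at a would create an unbounded
term (x-a)^(1-α). So the slopes at both ends vanish, the derivative is again a function of the same
kind, and induction applies. For α = 2 the operator is local and smoothness on [a,b] is enough.

For smooth compactly supported functions, the Riemann–Liouville derivative and the Grünwald series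
are Fourier multipliers (`leftRL_fourier`, `hasSum_grunwald_fourier`). The weights λ make the ratio
of the two symbols 1 + O(θ²), where θ is frequency times h (`symbol_ratio_isBigO`). The error is
therefore at most C h²|ξ|^(α+2) at frequency ξ, and six bounded derivatives make this integrable
against the transform. -/

theorem grunwald_zero (α : ℝ) : grunwald α 0 = 1 := by simp [grunwald]

theorem choose_succ_mul (α : ℝ) (n : ℕ) :
    ((n : ℝ) + 1) * Ring.choose α (n + 1) = (α - n) * Ring.choose α n := by
  rw [Ring.choose_eq_smul, Ring.choose_eq_smul, descPochhammer_succ_right, Polynomial.smeval_mul,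
    Nat.factorial_succ]
  simp only [Polynomial.smeval_sub, Polynomial.smeval_X, Polynomial.smeval_natCast, smul_eq_mul,
    pow_one, pow_zero, nsmul_eq_mul, mul_one, Nat.cast_mul, Nat.cast_succ]
  have : (n.factorial : ℝ) ≠ 0 := by positivity
  have : (n : ℝ) + 1 ≠ 0 := by positivity
  field_simp

theorem grunwald_succ (α : ℝ) (n : ℕ) :
    grunwald α (n + 1) = grunwald α n * ((n - α) / (n + 1)) := by
  have h := choose_succ_mul α n
  have : (n : ℝ) + 1 ≠ 0 := by positivity
  have h' : Ring.choose α (n + 1) = (α - n) * Ring.choose α n / (n + 1) := by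
    field_simp; linarith
  rw [grunwald, grunwald, h', pow_succ]
  field_simp
  ring

/-- Dividing the generating function (1-z)^α by 1-z gives (1-z)^(α-1). Row sums of the difference
matrix thus become coefficients of order α-1, whose signs are known. -/
theorem sum_grunwald (α : ℝ) (n : ℕ) :
    ∑ l ∈ Finset.range (n + 1), grunwald α l = grunwald (α - 1) n := by
  induction n with
  | zero => simp [grunwald_zero]
  | succ n ih =>
    rw [Finset.sum_range_succ, ih]
    have := Ring.choose_succ_succ (α - 1) n
    rw [sub_add_cancel] at this
    simp only [grunwald, this, pow_succ]
    ring

theorem grunwald_one (α : ℝ) : grunwald α 1 = -α := by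
  have := grunwald_succ α 0
  simpa [grunwald_zero] using this

theorem grunwald_two (α : ℝ) : grunwald α 2 = α * (α - 1) / 2 := by
  rw [grunwald_succ, grunwald_one]; push_cast; ring

theorem grunwald_three (α : ℝ) : grunwald α 3 = α * (α - 1) * (2 - α) / 6 := by
  rw [grunwald_succ, grunwald_two]; push_cast; ring

theorem grunwald_nonneg {α : ℝ} (h₁ : 1 ≤ α) (h₂ : α ≤ 2) (n : ℕ) : 0 ≤ grunwald α (n + 2) := by
  induction n with
  | zero => rw [zero_add, grunwald_two]; nlinarith
  | succ n ih =>
    rw [grunwald_succ]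
    refine mul_nonneg ih (div_nonneg ?_ (by positivity))
    push_cast
    have : (0 : ℝ) ≤ n := by positivity
    linarith

theorem grunwald_nonpos {β : ℝ} (h₁ : 0 ≤ β) (h₂ : β ≤ 1) (n : ℕ) : grunwald β (n + 1) ≤ 0 := by
  induction n with
  | zero => rw [zero_add, grunwald_one]; linarith
  | succ n ih =>
    rw [grunwald_succ]
    refine mul_nonpos_of_nonpos_of_nonneg ih (div_nonneg ?_ (by positivity))
    push_cast
    have : (0 : ℝ) ≤ n := by positivity
    linarith

/-- From index 2 on the terms are nonnegative, so bounded partial sums suffice. They equal a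
nonpositive coefficient of order α-1 minus g₀ + g₁ = 1-α. -/
theorem summable_grunwald {α : ℝ} (h₁ : 1 ≤ α) (h₂ : α ≤ 2) :
    Summable (fun l => ‖grunwald α l‖) := by
  rw [← summable_nat_add_iff 2]
  refine summable_of_sum_range_le (c := α - 1) (fun n => norm_nonneg _) fun n => ?_
  have h : ∀ l, ‖grunwald α (l + 2)‖ = grunwald α (l + 2) := fun l => by
    rw [Real.norm_eq_abs, abs_of_nonneg (grunwald_nonneg h₁ h₂ l)]
  simp only [h]
  have h3 := sum_grunwald α (n + 1)
  rw [Finset.sum_range_succ', Finset.sum_range_succ'] at h3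
  have h4 := grunwald_nonpos (β := α - 1) (by linarith) (by linarith) n
  simp only [grunwald_zero, zero_add, grunwald_one] at h3
  linarith [h3]

/-! ### Weights of the shifted operator -/

theorem weight_add_two (α : ℝ) (l : ℕ) : weight α (l + 2) =
    lamOne α * grunwald α (l + 2) + lamZero α * grunwald α (l + 1) + lamNegOne α * grunwald α l :=
  rfl

theorem summable_weight {α : ℝ} (h₁ : 1 ≤ α) (h₂ : α ≤ 2) : Summable (fun l => ‖weight α l‖) := by
  rw [← summable_nat_add_iff 2]
  have h := summable_grunwald h₁ h₂
  have ha := ((summable_nat_add_iff 2).2 h).mul_left ‖lamOne α‖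
  have hb := ((summable_nat_add_iff 1).2 h).mul_left ‖lamZero α‖
  have hc := h.mul_left ‖lamNegOne α‖
  refine Summable.of_nonneg_of_le (fun _ => norm_nonneg _) (fun l => ?_) ((ha.add hb).add hc)
  rw [weight_add_two]
  refine (norm_add₃_le).trans ?_
  simp only [norm_mul, le_refl]

theorem sum_weight (α : ℝ) (n : ℕ) :
    ∑ l ∈ Finset.range (n + 3), weight α l = lamOne α * grunwald (α - 1) (n + 2)
      + lamZero α * grunwald (α - 1) (n + 1) + lamNegOne α * grunwald (α - 1) n := by
  rw [← sum_grunwald, ← sum_grunwald, ← sum_grunwald]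
  induction n with
  | zero => simp [Finset.sum_range_succ, weight]; ring
  | succ n ih =>
    rw [Finset.sum_range_succ, ih, weight_add_two, Finset.sum_range_succ _ (n + 1 + 2),
      Finset.sum_range_succ _ (n + 1 + 1), Finset.sum_range_succ _ (n + 1)]
    ring

theorem lamNegOne_nonpos {α : ℝ} (h₁ : 1 ≤ α) (h₂ : α ≤ 2) : lamNegOne α ≤ 0 := by
  unfold lamNegOne; nlinarith

/-- Taking out the common factor `grunwald α (n + 2)` leaves a quadratic in n with nonnegative
coefficients for 1 ≤ α ≤ 2. The first weight is treated apart because it contains the negative g₁,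
there multiplied by λ₋₁ ≤ 0. -/
theorem weight_nonneg {α : ℝ} (h₁ : 1 ≤ α) (h₂ : α ≤ 2) (n : ℕ) : 0 ≤ weight α (n + 3) := by
  rcases n with _ | n
  · have h3 : grunwald α (1 + 2) = _ := grunwald_three α
    rw [show 0 + 3 = 1 + 2 from rfl, weight_add_two, h3, grunwald_two, grunwald_one]
    have e1 : 0 ≤ lamOne α := by unfold lamOne; nlinarith
    have e2 : 0 ≤ lamZero α := by unfold lamZero; nlinarith
    have e3 := lamNegOne_nonpos h₁ h₂
    have : 0 ≤ α * (α - 1) := by nlinarith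
    have : 0 ≤ α * (α - 1) * (2 - α) := mul_nonneg this (by linarith)
    have : 0 ≤ lamNegOne α * -α := mul_nonneg_of_nonpos_of_nonpos e3 (by linarith)
    positivity
  · rw [show n + 1 + 3 = (n + 2) + 2 from rfl, weight_add_two, grunwald_succ α (n + 2 + 1),
      grunwald_succ α (n + 2)]
    have hg := grunwald_nonneg h₁ h₂ n
    have hn : (0 : ℝ) ≤ n := by positivity
    have key : 0 ≤ lamOne α * (((n : ℝ) + 2 - α) * (n + 3 - α))
        + lamZero α * ((n + 2 - α) * (n + 4)) + lamNegOne α * ((n + 3) * (n + 4)) := by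
      have e : lamOne α * (((n : ℝ) + 2 - α) * (n + 3 - α))
        + lamZero α * ((n + 2 - α) * (n + 4)) + lamNegOne α * ((n + 3) * (n + 4))
          = (12 * n ^ 2 + 6 * (12 - 3 * α - α ^ 2) * n + ((2 - α) * (α + 5)) ^ 2) / 12 := by
        unfold lamOne lamZero lamNegOne; ring
      rw [e]
      have : 0 ≤ 12 - 3 * α - α ^ 2 := by nlinarith
      positivity
    push_cast
    have e : lamOne α * (grunwald α (n + 2) * (((n : ℝ) + 2 - α) / (n + 2 + 1))
        * ((n + 2 + 1 - α) / (n + 2 + 1 + 1)))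
        + lamZero α * (grunwald α (n + 2) * ((n + 2 - α) / (n + 2 + 1)))
        + lamNegOne α * grunwald α (n + 2) = grunwald α (n + 2) / ((n + 3) * (n + 4)) *
        (lamOne α * (((n : ℝ) + 2 - α) * (n + 3 - α))
        + lamZero α * ((n + 2 - α) * (n + 4)) + lamNegOne α * ((n + 3) * (n + 4))) := by
      field_simp
      ring
    rw [e]
    positivity

/-- Same device as for `weight_nonneg`, now with a nonpositive coefficient of order α-1 as common
factor. The shortest sum is separate because it involves the positive coefficient of index 0. Three
terms are needed: w₀ + w₁ is positive for α near 1. -/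
theorem sum_weight_nonpos {α : ℝ} (h₁ : 1 ≤ α) (h₂ : α ≤ 2) (n : ℕ) :
    ∑ l ∈ Finset.range (n + 3), weight α l ≤ 0 := by
  rw [sum_weight]
  rcases n with _ | n
  · simp only [zero_add, grunwald_zero, grunwald_one, grunwald_two]
    have h : 0 ≤ (α - 1) * (2 - α) := by nlinarith
    have h' : 0 ≤ (α - 1) * (2 - α) * ((α ^ 2 + 3 * α + 2) / 2 + 2 * (2 + α) + 1) := by positivity
    unfold lamOne lamZero lamNegOne
    linarith
  · have hg := grunwald_nonpos (β := α - 1) (by linarith) (by linarith) n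
    rw [grunwald_succ (α - 1) (n + 1 + 1), grunwald_succ (α - 1) (n + 1)]
    have hn : (0 : ℝ) ≤ n := by positivity
    have key : 0 ≤ lamOne α * (((n : ℝ) + 2 - α) * (n + 3 - α))
        + lamZero α * ((n + 2 - α) * (n + 3)) + lamNegOne α * ((n + 2) * (n + 3)) := by
      have e : lamOne α * (((n : ℝ) + 2 - α) * (n + 3 - α))
        + lamZero α * ((n + 2 - α) * (n + 3)) + lamNegOne α * ((n + 2) * (n + 3))
          = (12 * n ^ 2 + 6 * (10 - 2 * α - α ^ 2) * n
            + (2 - α) * ((2 - α) * (α ^ 2 + 8 * α + 15) + 6)) / 12 := by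
        unfold lamOne lamZero lamNegOne; ring
      rw [e]
      have : 0 ≤ 10 - 2 * α - α ^ 2 := by nlinarith
      have : 0 ≤ 2 - α := by linarith
      positivity
    push_cast
    have e : lamOne α * (grunwald (α - 1) (n + 1) * (((n : ℝ) + 1 - (α - 1)) / (n + 1 + 1))
        * ((n + 1 + 1 - (α - 1)) / (n + 1 + 1 + 1)))
        + lamZero α * (grunwald (α - 1) (n + 1) * ((n + 1 - (α - 1)) / (n + 1 + 1)))
        + lamNegOne α * grunwald (α - 1) (n + 1) = grunwald (α - 1) (n + 1) / ((n + 2) * (n + 3)) *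
        (lamOne α * (((n : ℝ) + 2 - α) * (n + 3 - α))
        + lamZero α * ((n + 2 - α) * (n + 3)) + lamNegOne α * ((n + 2) * (n + 3))) := by
      field_simp
      ring
    rw [e]
    exact mul_nonpos_of_nonpos_of_nonneg (div_nonpos_of_nonpos_of_nonneg hg (by positivity)) key

/-- This is the entry next to the diagonal of the symmetrised matrix. The weight w₂ alone can be
negative; only adding the left and right operators gives the right sign. -/
theorem weight_zero_add_two_nonneg {α : ℝ} (h₁ : 1 ≤ α) :
    0 ≤ weight α 0 + weight α 2 := by
  have : weight α 2 = _ := weight_add_two α 0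
  rw [this]
  simp only [weight, grunwald_zero, zero_add, grunwald_one, grunwald_two]
  have h : 0 ≤ (α - 1) * (α ^ 3 + 7 * α ^ 2 + 10 * α - 8) := by
    have : 0 ≤ α ^ 3 + 7 * α ^ 2 := by positivity
    exact mul_nonneg (by linarith) (by linarith)
  unfold lamOne lamZero lamNegOne
  linarith

theorem cos_half_neg {α : ℝ} (h₁ : 1 < α) (h₂ : α ≤ 2) : Real.cos (α * Real.pi / 2) < 0 := by
  have := Real.pi_pos
  apply Real.cos_neg_of_pi_div_two_lt_of_lt <;> nlinarith

end FGLE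

namespace FGLE

/-! ### Positivity of the difference operator -/

/-- A real symmetric matrix with nonnegative off-diagonal entries and nonpositive row sums (over
the rows in the support of `z`) is negative semidefinite. -/
theorem sum_mul_re_nonpos {ι : Type*} [DecidableEq ι] (s : Finset ι) (A : ι → ι → ℝ) (z : ι → ℂ)
    (hsymm : ∀ j k, A j k = A k j) (hoff : ∀ j k, j ≠ k → 0 ≤ A j k)
    (hrow : ∀ j ∈ s, z j ≠ 0 → ∑ k ∈ s, A j k ≤ 0) :
    ∑ j ∈ s, ∑ k ∈ s, A j k * (z k * (starRingEnd ℂ) (z j)).re ≤ 0 := by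
  have h1 : ∀ j k, A j k * (z k * (starRingEnd ℂ) (z j)).re
      ≤ A j k * (‖z j‖ ^ 2 / 2) + A j k * (‖z k‖ ^ 2 / 2) := by
    intro j k
    have e : (z k * (starRingEnd ℂ) (z j)).re = (z k).re * (z j).re + (z k).im * (z j).im := by
      simp [Complex.mul_re]
    have n : ∀ w : ℂ, ‖w‖ ^ 2 = w.re ^ 2 + w.im ^ 2 := fun w => by
      rw [Complex.sq_norm, Complex.normSq_apply]; ring
    rw [e, n, n, ← mul_add]
    -- On the diagonal both sides agree, so the sign of `A j j` plays no role.
    by_cases hjk : j = k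
    · subst hjk; apply le_of_eq; ring
    · apply mul_le_mul_of_nonneg_left _ (hoff j k hjk)
      nlinarith [sq_nonneg ((z k).re - (z j).re), sq_nonneg ((z k).im - (z j).im)]
  have h2 : ∑ j ∈ s, ∑ k ∈ s, A j k * (‖z k‖ ^ 2 / 2) = ∑ j ∈ s, ∑ k ∈ s, A j k * (‖z j‖ ^ 2 / 2) := by
    rw [Finset.sum_comm]
    exact Finset.sum_congr rfl fun j _ => Finset.sum_congr rfl fun k _ => by rw [hsymm]
  have h3 : ∑ j ∈ s, ∑ k ∈ s, A j k * (‖z j‖ ^ 2 / 2) ≤ 0 := by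
    refine Finset.sum_nonpos fun j hj => ?_
    rw [← Finset.sum_mul]
    by_cases hz : z j = 0
    · simp [hz]
    · exact mul_nonpos_of_nonpos_of_nonneg (hrow j hj hz) (by positivity)
  calc _ ≤ ∑ j ∈ s, ∑ k ∈ s, (A j k * (‖z j‖ ^ 2 / 2) + A j k * (‖z k‖ ^ 2 / 2)) :=
        Finset.sum_le_sum fun j _ => Finset.sum_le_sum fun k _ => h1 j k
    _ ≤ 0 := by
      simp only [Finset.sum_add_distrib]
      rw [h2]; linarith

/-- The lower Hessenberg Toeplitz matrix of the left shifted Grünwald operator. -/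
noncomputable def toeplitz (α : ℝ) (j k : ℕ) : ℝ := if k ≤ j + 1 then weight α (j + 1 - k) else 0

/-- The sums run over all nodes 0, …, M, boundary included, so that the left and right operators
become transposes of one square matrix. Values lie in a general module because the identity serves
both for grid functions and, with the constant 1, for row sums. -/
theorem sum_toeplitz_left {V : Type*} [AddCommGroup V] [Module ℝ V] (α : ℝ) (v : ℤ → V)
    {j M : ℕ} (hj : j < M) :
    ∑ k ∈ Finset.range (M + 1), toeplitz α j k • v k
      = ∑ l ∈ Finset.range (j + 2), weight α l • v ((j : ℤ) - l + 1) := by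
  rw [← Finset.sum_subset (Finset.range_mono (by omega : j + 2 ≤ M + 1)), ← Finset.sum_range_reflect]
  · refine Finset.sum_congr rfl fun k hk => ?_
    have hk := Finset.mem_range.1 hk
    rw [toeplitz, if_pos (by omega), show j + 2 - 1 - k = j + 1 - k by omega,
      show j + 1 - (j + 1 - k) = k by omega]
    congr 2
    push_cast [show k ≤ j + 1 by omega]
    ring
  · intro k _ hk
    rw [Finset.mem_range] at hk
    rw [toeplitz, if_neg (by omega), zero_smul]

theorem sum_toeplitz_right {V : Type*} [AddCommGroup V] [Module ℝ V] (α : ℝ) (v : ℤ → V)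
    {j M : ℕ} (hj : 1 ≤ j) (hj' : j < M) :
    ∑ k ∈ Finset.range (M + 1), toeplitz α k j • v k
      = ∑ l ∈ Finset.range (M - j + 2), weight α l • v ((j : ℤ) + l - 1) := by
  rw [Finset.range_eq_Ico, ← Finset.sum_Ico_consecutive _ (Nat.zero_le (j - 1)) (by omega),
    Finset.sum_eq_zero, zero_add, Finset.sum_Ico_eq_sum_range, show M + 1 - (j - 1) = M - j + 2 by omega]
  · refine Finset.sum_congr (by simp) fun l _ => ?_
    rw [toeplitz, if_pos (by omega), show j - 1 + l + 1 - j = l by omega]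
    congr 2
    push_cast [hj]
    ring
  · intro k hk
    rw [Finset.mem_Ico] at hk
    rw [toeplitz, if_neg (by omega), zero_smul]

theorem toeplitz_symm_nonneg {α : ℝ} (h₁ : 1 ≤ α) (h₂ : α ≤ 2) {j k : ℕ} (hjk : j ≠ k) :
    0 ≤ toeplitz α j k + toeplitz α k j := by
  have key : ∀ j k : ℕ, j < k → 0 ≤ toeplitz α j k + toeplitz α k j := by
    intro j k hjk
    obtain ⟨m, rfl⟩ := Nat.exists_eq_add_of_lt hjk
    rcases m with _ | m
    · rw [toeplitz, toeplitz, if_pos (by omega), if_pos (by omega),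
        show j + 1 - (j + 0 + 1) = 0 by omega, show j + 0 + 1 + 1 - j = 2 by omega]
      exact weight_zero_add_two_nonneg h₁
    · rw [toeplitz, toeplitz, if_neg (by omega), if_pos (by omega),
        show j + (m + 1) + 1 + 1 - j = m + 3 by omega, zero_add]
      exact weight_nonneg h₁ h₂ m
  rcases lt_or_gt_of_ne hjk with h | h
  · exact key _ _ h
  · rw [add_comm]; exact key _ _ h

theorem sum_range_weight_nonpos {α : ℝ} (h₁ : 1 ≤ α) (h₂ : α ≤ 2) {n : ℕ} (hn : 3 ≤ n) :
    ∑ l ∈ Finset.range n, weight α l ≤ 0 := by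
  obtain ⟨m, rfl⟩ := Nat.exists_eq_add_of_le' hn
  exact sum_weight_nonpos h₁ h₂ m

theorem discreteLaplacian_eq_toeplitz (α h : ℝ) {j M : ℕ} (v : ℤ → ℂ) (hj : 1 ≤ j) (hj' : j < M) :
    discreteLaplacian α h M v j =
      ((1 / h ^ α * (1 / (2 * Real.cos (α * Real.pi / 2))) : ℝ) : ℂ) *
        ∑ k ∈ Finset.range (M + 1), ((toeplitz α j k + toeplitz α k j : ℝ) : ℂ) * v k := by
  have h1 := sum_toeplitz_left α v hj'
  have h2 := sum_toeplitz_right α v hj hj'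
  simp only [Complex.real_smul] at h1 h2
  rw [discreteLaplacian, ← h1, ← h2, ← Finset.sum_add_distrib]
  congr 1
  exact Finset.sum_congr rfl fun k _ => by push_cast; ring

/-- The quadratic form of the discrete fractional Laplacian is real and nonnegative. -/
theorem discreteLaplacian_nonneg {α h : ℝ} (h₁ : 1 < α) (h₂ : α ≤ 2) (hh : 0 < h) (M : ℕ)
    (z : ℤ → ℂ) (hz : ∀ j : ℤ, ¬ (1 ≤ j ∧ j ≤ (M : ℤ) - 1) → z j = 0) :
    ∃ q : ℝ, 0 ≤ q ∧
      ∑ j ∈ Finset.Ico 1 M, discreteLaplacian α h M z j * (starRingEnd ℂ) (z j) = q := by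
  set c : ℝ := 1 / h ^ α * (1 / (2 * Real.cos (α * Real.pi / 2))) with hc
  have hc0 : c ≤ 0 := by
    have := cos_half_neg h₁ h₂
    have h3 : 1 / (2 * Real.cos (α * Real.pi / 2)) ≤ 0 :=
      div_nonpos_of_nonneg_of_nonpos zero_le_one (by linarith)
    exact mul_nonpos_of_nonneg_of_nonpos (by positivity) h3
  set A : ℕ → ℕ → ℝ := fun j k => toeplitz α j k + toeplitz α k j with hA
  set Q := ∑ j ∈ Finset.range (M + 1), ∑ k ∈ Finset.range (M + 1),
    A j k * (z k * (starRingEnd ℂ) (z j)).re with hQ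
  have hQ0 : Q ≤ 0 := by
    refine sum_mul_re_nonpos _ A (fun j : ℕ => z j) (fun j k => add_comm _ _)
      (fun j k hjk => toeplitz_symm_nonneg h₁.le h₂ hjk) fun j hj hzj => ?_
    have hj1 : 1 ≤ (j : ℤ) ∧ (j : ℤ) ≤ (M : ℤ) - 1 := by
      by_contra hcon
      exact hzj (hz _ hcon)
    have e1 := sum_toeplitz_left α (fun _ => (1 : ℝ)) (j := j) (M := M) (by omega)
    have e2 := sum_toeplitz_right α (fun _ => (1 : ℝ)) (j := j) (M := M) (by omega) (by omega)
    simp only [smul_eq_mul, mul_one] at e1 e2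
    simp only [hA, Finset.sum_add_distrib]
    rw [e1, e2]
    -- Interior rows carry at least three weights on each side. Boundary rows may fail the sign
    -- condition, but `z` vanishes there.
    have := sum_range_weight_nonpos h₁.le h₂ (n := j + 2) (by omega)
    have := sum_range_weight_nonpos h₁.le h₂ (n := M - j + 2) (by omega)
    linarith
  refine ⟨c * Q, mul_nonneg_of_nonpos_of_nonpos hc0 hQ0, ?_⟩
  have e1 : ∑ j ∈ Finset.Ico 1 M, discreteLaplacian α h M z j * (starRingEnd ℂ) (z j)
      = ∑ j ∈ Finset.Ico 1 M, (c : ℂ) * ∑ k ∈ Finset.range (M + 1),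
        (A j k : ℂ) * (z k * (starRingEnd ℂ) (z j)) := by
    refine Finset.sum_congr rfl fun j hj => ?_
    rw [Finset.mem_Ico] at hj
    rw [discreteLaplacian_eq_toeplitz α h z hj.1 hj.2, mul_assoc, Finset.sum_mul]
    simp only [mul_assoc, hA, hc]
  have e2 : ∑ j ∈ Finset.Ico 1 M, (c : ℂ) * ∑ k ∈ Finset.range (M + 1),
        (A j k : ℂ) * (z k * (starRingEnd ℂ) (z j)) = (c : ℂ) * ∑ j ∈ Finset.range (M + 1),
          ∑ k ∈ Finset.range (M + 1), (A j k : ℂ) * (z k * (starRingEnd ℂ) (z j)) := by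
    rw [Finset.mul_sum]
    -- The operator acts on interior nodes only; the rows 0 and M are added at no cost since `z` is
    -- zero there, which restores symmetry.
    refine Finset.sum_subset (fun j hj => ?_) fun j _ hj => ?_
    · rw [Finset.mem_Ico] at hj
      rw [Finset.mem_range]; omega
    · rw [Finset.mem_Ico] at hj
      rw [hz j (by omega)]
      simp
  set S := ∑ j ∈ Finset.range (M + 1),
          ∑ k ∈ Finset.range (M + 1), (A j k : ℂ) * (z k * (starRingEnd ℂ) (z j)) with hS
  have e3 : S = Q := by
    apply Complex.ext
    · simp only [hS, hQ, Complex.re_sum, Complex.re_ofReal_mul, Complex.ofReal_re]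
    · have : (starRingEnd ℂ) S = S := by
        simp only [hS, map_sum, map_mul, Complex.conj_ofReal, Complex.conj_conj]
        rw [Finset.sum_comm]
        refine Finset.sum_congr rfl fun j _ => Finset.sum_congr rfl fun k _ => ?_
        rw [show A k j = A j k from add_comm _ _, mul_comm ((starRingEnd ℂ) (z j))]
      rw [Complex.ofReal_im]
      exact Complex.conj_eq_iff_im.1 this
  rw [e1, e2, e3]
  push_cast
  rfl

end FGLE

namespace FGLE

/-! ### The Fourier symbol of the difference operator -/

theorem continuousOn_tsum_mul_pow {c : ℕ → ℝ} (hc : Summable fun l => ‖c l‖) :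
    ContinuousOn (fun z : ℂ => ∑' l, (c l : ℂ) * z ^ l) (Metric.closedBall 0 1) := by
  refine continuousOn_tsum (u := fun l => ‖c l‖) (fun l => by fun_prop) hc fun l z hz => ?_
  rw [norm_mul, norm_pow, Complex.norm_real]
  exact mul_le_of_le_one_right (norm_nonneg _) (pow_le_one₀ (norm_nonneg _) (by simpa using hz))

theorem summable_mul_pow {c : ℕ → ℝ} (hc : Summable fun l => ‖c l‖) {z : ℂ} (hz : ‖z‖ ≤ 1) :
    Summable fun l => (c l : ℂ) * z ^ l := by
  refine Summable.of_norm_bounded hc fun l => ?_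
  rw [norm_mul, norm_pow, Complex.norm_real]
  exact mul_le_of_le_one_right (norm_nonneg _) (pow_le_one₀ (norm_nonneg _) hz)

/-- The binomial series gives the identity in the open disc only, while the Fourier symbol lives on
the unit circle. Absolute summability makes the series continuous on the closed disc, and so is the
power, since 1-z stays in the closed right half-plane and α > 0. -/
theorem hasSum_grunwald {α : ℝ} (h₁ : 1 ≤ α) (h₂ : α ≤ 2) {z : ℂ} (hz : ‖z‖ ≤ 1) :
    HasSum (fun l => (grunwald α l : ℂ) * z ^ l) ((1 - z) ^ (α : ℂ)) := by
  have hs := summable_grunwald h₁ h₂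
  have key : Set.EqOn (fun z : ℂ => ∑' l, (grunwald α l : ℂ) * z ^ l)
      (fun z => (1 - z) ^ (α : ℂ)) (Metric.closedBall 0 1) := by
    refine Set.EqOn.of_subset_closure (s := Metric.ball 0 1) (fun w hw => ?_)
      (continuousOn_tsum_mul_pow hs) (fun w hw => ContinuousAt.continuousWithinAt ?_)
      Metric.ball_subset_closedBall (by rw [closure_ball _ one_ne_zero])
    · have hw' : ‖w‖ < 1 := by simpa using hw
      have := (Complex.one_add_cpow_hasFPowerSeriesOnBall_zero (a := (α : ℂ))).hasSum (y := -w)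
        (by rw [← ENNReal.ofReal_one, Metric.eball_ofReal]; simpa using hw')
      have h3 := this.tsum_eq
      rw [zero_add, ← sub_eq_add_neg] at h3
      show ∑' l, (grunwald α l : ℂ) * w ^ l = _
      rw [← h3]
      refine tsum_congr fun l => ?_
      rw [binomialSeries_apply]
      simp only [List.ofFn_const, List.prod_replicate, smul_eq_mul, grunwald]
      rw [← Complex.ofReal_choose, neg_pow w]
      push_cast
      ring
    · have hw' : ‖w‖ ≤ 1 := by simpa using hw
      have : 0 ≤ (1 - w).re := by
        have := (Complex.re_le_norm w).trans hw'
        simpa using this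
      exact (Complex.continuousAt_cpow_const_of_re_pos (w := (α : ℂ)) (Or.inl this)
        (by simpa using by linarith)).comp (f := fun w : ℂ => 1 - w) (by fun_prop)
  have h := (summable_mul_pow hs hz).hasSum
  have e := key (show z ∈ Metric.closedBall 0 1 by simpa using hz)
  simp only at e
  rwa [e] at h

theorem hasSum_weight {α : ℝ} (h₁ : 1 ≤ α) (h₂ : α ≤ 2) {z : ℂ} (hz : ‖z‖ ≤ 1) :
    HasSum (fun l => (weight α l : ℂ) * z ^ l)
      ((1 - z) ^ (α : ℂ) * (lamOne α + lamZero α * z + lamNegOne α * z ^ 2)) := by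
  have hg := hasSum_grunwald h₁ h₂ hz
  set S := (1 - z) ^ (α : ℂ)
  have a2 : HasSum (fun l => (grunwald α (l + 2) : ℂ) * z ^ (l + 2)) (S - (1 - α * z)) := by
    have := (hasSum_nat_add_iff' (f := fun l => (grunwald α l : ℂ) * z ^ l) 2).2 hg
    simpa [Finset.sum_range_succ, grunwald_zero, grunwald_one, ← sub_eq_add_neg] using this
  have a1 : HasSum (fun l => (grunwald α (l + 1) : ℂ) * z ^ (l + 1)) (S - 1) := by
    have := (hasSum_nat_add_iff' (f := fun l => (grunwald α l : ℂ) * z ^ l) 1).2 hg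
    simpa [Finset.sum_range_succ, grunwald_zero] using this
  rw [← hasSum_nat_add_iff' 2]
  have h := ((a2.mul_left (lamOne α : ℂ)).add (a1.mul_left (lamZero α * z : ℂ))).add
    (hg.mul_left (lamNegOne α * z ^ 2 : ℂ))
  have e : S * (lamOne α + lamZero α * z + lamNegOne α * z ^ 2)
      - ∑ i ∈ Finset.range 2, (weight α i : ℂ) * z ^ i = lamOne α * (S - (1 - α * z))
        + lamZero α * z * (S - 1) + lamNegOne α * z ^ 2 * S := by
    simp only [Finset.sum_range_succ, Finset.sum_range_zero, weight, grunwald_zero, grunwald_one]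
    push_cast
    ring
  rw [e]
  refine h.congr_fun fun l => ?_
  rw [weight_add_two]
  push_cast
  ring

open Asymptotics Filter Topology

theorem one_add_cpow_isBigO (a : ℂ) :
    (fun w : ℂ => (1 + w) ^ a - 1 - a * w) =O[𝓝 0] fun w => w ^ 2 := by
  have h := (Complex.one_add_cpow_hasFPowerSeriesAt_zero (a := a)).isBigO_sub_partialSum_pow 2
  refine (h.congr_left fun w => ?_).trans (isBigO_of_le _ fun w => by simp)
  simp only [FormalMultilinearSeries.partialSum, Finset.sum_range_succ, binomialSeries_apply]
  simp [sub_sub]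

theorem exp_isBigO_two : (fun z : ℂ => Complex.exp z - 1 - z) =O[𝓝 0] fun z => z ^ 2 := by
  refine (Complex.exp_sub_sum_range_isBigO_pow 2).congr_left fun z => ?_
  simp [Finset.sum_range_succ, sub_sub]

theorem exp_isBigO_three :
    (fun z : ℂ => Complex.exp z - 1 - z - z ^ 2 / 2) =O[𝓝 0] fun z => z ^ 3 := by
  refine (Complex.exp_sub_sum_range_isBigO_pow 3).congr_left fun z => ?_
  simp [Finset.sum_range_succ, sub_sub, Nat.factorial, add_assoc]

/-- The factor multiplying `z` in `1 - e^{-z}`. -/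
noncomputable def expQuot (z : ℂ) : ℂ := (1 - Complex.exp (-z)) / z

theorem expQuot_isBigO :
    (fun z : ℂ => expQuot z - 1 + z / 2) =O[𝓝[≠] 0] fun z => z ^ 2 := by
  have h : (fun z : ℂ => Complex.exp (-z) - 1 - (-z) - (-z) ^ 2 / 2) =O[𝓝 0] fun z => (-z) ^ 3 :=
    exp_isBigO_three.comp_tendsto (k := fun z : ℂ => -z)
      (by simpa using (continuous_neg (G := ℂ)).tendsto 0)
  have h' := (h.mono nhdsWithin_le_nhds).mul (isBigO_refl (fun z : ℂ => z⁻¹) (𝓝[≠] 0))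
  refine (h'.neg_left.congr' ?_ ?_).neg_right.congr_right fun z => neg_neg _
  · filter_upwards [self_mem_nhdsWithin] with z hz
    have hz : z ≠ 0 := hz
    rw [expQuot]
    field_simp
    ring
  · filter_upwards [self_mem_nhdsWithin] with z hz
    have hz : z ≠ 0 := hz
    field_simp

theorem tendsto_expQuot : Tendsto expQuot (𝓝[≠] 0) (𝓝 1) := by
  have h1 : Tendsto (fun z : ℂ => z ^ 2) (𝓝[≠] 0) (𝓝 0) :=
    ((by fun_prop : Continuous fun z : ℂ => z ^ 2).tendsto' 0 0 (by simp)).mono_left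
      nhdsWithin_le_nhds
  have h2 : Tendsto (fun z : ℂ => 1 - z / 2) (𝓝[≠] 0) (𝓝 1) :=
    ((by fun_prop : Continuous fun z : ℂ => 1 - z / 2).tendsto' 0 1 (by simp)).mono_left
      nhdsWithin_le_nhds
  have := (expQuot_isBigO.trans_tendsto h1).add h2
  simpa using this

theorem expQuot_cpow_isBigO (a : ℂ) :
    (fun z : ℂ => expQuot z ^ a - 1 + a * z / 2) =O[𝓝[≠] 0] fun z => z ^ 2 := by
  have h0 : Tendsto (fun z => expQuot z - 1) (𝓝[≠] 0) (𝓝 0) := by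
    simpa using tendsto_expQuot.sub_const 1
  have hz : (fun z : ℂ => z ^ 2) =O[𝓝[≠] 0] fun z => z := by
    have : (fun z : ℂ => z) =O[𝓝[≠] 0] fun _ => (1 : ℂ) :=
      ((continuous_id (X := ℂ)).tendsto 0).mono_left nhdsWithin_le_nhds |>.isBigO_one ℂ
    simpa [sq] using this.mul (isBigO_refl (fun z : ℂ => z) _)
  have h1 : (fun z => expQuot z - 1) =O[𝓝[≠] 0] fun z => z := by
    have := (expQuot_isBigO.trans hz).sub (isBigO_refl (fun z : ℂ => z) _ |>.const_mul_left (1 / 2))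
    refine this.congr_left fun z => by ring
  have h2 := ((one_add_cpow_isBigO a).comp_tendsto h0).trans (h1.pow 2)
  have h3 := h2.add (expQuot_isBigO.const_mul_left a)
  refine h3.congr_left fun z => ?_
  simp only [Function.comp, add_sub_cancel]
  ring

/-- This relation and `lam_diff` encode the order of the method: sum 1 is consistency, and
difference α/2 cancels the first-order error of the Grünwald formula. -/
theorem lam_sum (α : ℝ) : lamOne α + lamZero α + lamNegOne α = 1 := by
  unfold lamOne lamZero lamNegOne; ring

theorem lam_diff (α : ℝ) : lamOne α - lamNegOne α = α / 2 := by
  unfold lamOne lamNegOne; ring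

/-- The trigonometric factor of the symbol that comes from weighting the shifts. -/
noncomputable def shiftFactor (α : ℝ) (z : ℂ) : ℂ :=
  lamOne α * Complex.exp z + lamZero α + lamNegOne α * Complex.exp (-z)

theorem shiftFactor_isBigO (α : ℝ) :
    (fun z : ℂ => shiftFactor α z - 1 - α * z / 2) =O[𝓝 0] fun z => z ^ 2 := by
  have h : (fun z : ℂ => Complex.exp (-z) - 1 - (-z)) =O[𝓝 0] fun z => (-z) ^ 2 :=
    exp_isBigO_two.comp_tendsto (k := fun z : ℂ => -z)
      (by simpa using (continuous_neg (G := ℂ)).tendsto 0)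
  have h' := (exp_isBigO_two.const_mul_left (lamOne α : ℂ)).add
    ((h.congr_right fun z => neg_sq z).const_mul_left (lamNegOne α : ℂ))
  refine h'.congr_left fun z => ?_
  have e1 : (lamOne α : ℂ) + lamZero α + lamNegOne α = 1 := by exact_mod_cast lam_sum α
  have e2 : (lamOne α : ℂ) - lamNegOne α = α / 2 := by exact_mod_cast lam_diff α
  rw [shiftFactor]
  linear_combination -e1 - z * e2

/-- The two factors are 1 - αz/2 + O(z²) and 1 + αz/2 + O(z²), so the linear terms cancel in the
product. -/
theorem symbol_ratio_isBigO (α : ℝ) :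
    (fun z : ℂ => expQuot z ^ (α : ℂ) * shiftFactor α z - 1) =O[𝓝[≠] 0] fun z => z ^ 2 := by
  have h1 := expQuot_cpow_isBigO (α : ℂ)
  have h2 := (shiftFactor_isBigO α).mono (nhdsWithin_le_nhds (s := {0}ᶜ))
  have b1 : shiftFactor α =O[𝓝[≠] 0] fun _ => (1 : ℂ) :=
    (((by unfold shiftFactor; fun_prop : Continuous (shiftFactor α)).tendsto 0).mono_left
      nhdsWithin_le_nhds).isBigO_one ℂ
  have b2 : (fun z : ℂ => 1 - α * z / 2) =O[𝓝[≠] 0] fun _ => (1 : ℂ) :=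
    (((by fun_prop : Continuous fun z : ℂ => 1 - α * z / 2).tendsto 0).mono_left
      nhdsWithin_le_nhds).isBigO_one ℂ
  have h3 := ((h1.mul b1).congr_right fun z => mul_one _).add
    ((b2.mul h2).congr_right fun z => one_mul _)
  have h4 := h3.sub ((isBigO_refl (fun z : ℂ => z ^ 2) (𝓝[≠] 0)).const_mul_left ((α : ℂ) ^ 2 / 4))
  refine h4.congr_left fun z => ?_
  ring

/-- The arguments are at most π/2 and strictly below π/2 in modulus, so their sum stays inside (-π,
π) and no branch is crossed. -/
theorem mul_cpow_of_re_nonneg {z w : ℂ} (hz : 0 ≤ z.re) (hw : 0 < w.re) (a : ℂ) :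
    (z * w) ^ a = z ^ a * w ^ a := by
  rcases eq_or_ne z 0 with rfl | hz0
  · rcases eq_or_ne a 0 with rfl | ha
    · simp
    · simp [Complex.zero_cpow ha]
  have hw0 : w ≠ 0 := by rintro rfl; simp at hw
  have h1 := abs_le.1 (Complex.abs_arg_le_pi_div_two_iff.2 hz)
  have h2 := abs_lt.1 (Complex.abs_arg_lt_pi_div_two_iff.2 (Or.inl hw))
  rw [Complex.cpow_def_of_ne_zero (mul_ne_zero hz0 hw0), Complex.cpow_def_of_ne_zero hz0,
    Complex.cpow_def_of_ne_zero hw0, Complex.log_mul hz0 hw0 ⟨by linarith, by linarith⟩, add_mul,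
    Complex.exp_add]

theorem norm_exp_mul_I_neg (θ : ℝ) : ‖Complex.exp (-(θ * Complex.I))‖ = 1 := by
  rw [← neg_mul, ← Complex.ofReal_neg]; exact Complex.norm_exp_ofReal_mul_I _

/-- Second-order consistency of the symbol of the difference operator. -/
theorem exists_symbol_bound {α : ℝ} (h₁ : 1 ≤ α) : ∃ C : ℝ, 0 ≤ C ∧ ∀ θ : ℝ,
    ‖(1 - Complex.exp (-(θ * Complex.I))) ^ (α : ℂ) * shiftFactor α (θ * Complex.I)
      - (θ * Complex.I) ^ (α : ℂ)‖ ≤ C * |θ| ^ (α + 2) := by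
  have hα : (α : ℂ) ≠ 0 := by exact_mod_cast (by linarith : α ≠ 0)
  obtain ⟨C, hC⟩ := (symbol_ratio_isBigO α).bound
  have hre : ∀ᶠ z in 𝓝[≠] (0 : ℂ), 0 < (expQuot z).re :=
    (Complex.continuous_re.tendsto 1 |>.comp tendsto_expQuot).eventually
      (lt_mem_nhds (by simp))
  have hT : Tendsto (fun θ : ℝ => (θ : ℂ) * Complex.I) (𝓝[≠] 0) (𝓝[≠] 0) := by
    refine tendsto_nhdsWithin_iff.2 ⟨?_, ?_⟩
    · exact ((by fun_prop : Continuous fun θ : ℝ => (θ : ℂ) * Complex.I).tendsto' 0 0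
        (by simp)).mono_left nhdsWithin_le_nhds
    · filter_upwards [self_mem_nhdsWithin] with θ hθ
      simpa using hθ
  have hev := (hT.eventually hC).and (hT.eventually hre)
  rw [eventually_nhdsWithin_iff, Metric.eventually_nhds_iff] at hev
  obtain ⟨δ, hδ, hev⟩ := hev
  set A : ℝ := 2 ^ α * (|lamOne α| + |lamZero α| + |lamNegOne α|) with hA
  have hA0 : 0 ≤ A := by positivity
  -- `|C|` covers |θ| < δ, by the expansion at 0. For |θ| ≥ δ the two symbols are bounded
  -- separately, by `A` and |θ|^α, and the powers of δ convert these bounds into multiples of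
  -- |θ|^(α+2).
  refine ⟨|C| + A / δ ^ (α + 2) + 1 / δ ^ 2, by positivity, fun θ => ?_⟩
  have hnz : ‖(θ * Complex.I : ℂ)‖ = |θ| := by simp
  rcases eq_or_ne θ 0 with rfl | hθ
  · simp only [Complex.ofReal_zero, zero_mul, neg_zero, Complex.exp_zero, sub_self,
      Complex.zero_cpow hα, norm_zero]
    positivity
  have hθ' : 0 < |θ| := abs_pos.2 hθ
  have hpow : |θ| ^ (α + 2) = |θ| ^ α * |θ| ^ 2 := by
    rw [Real.rpow_add hθ']; norm_cast
  have hz0 : (θ * Complex.I : ℂ) ≠ 0 := by simpa using hθ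
  rcases lt_or_ge |θ| δ with hlt | hge
  · obtain ⟨b1, b2⟩ := hev (y := θ) (by simpa using hlt) hθ
    have e : (1 - Complex.exp (-(θ * Complex.I))) = (θ * Complex.I) * expQuot (θ * Complex.I) := by
      rw [expQuot, mul_div_cancel₀ _ hz0]
    rw [e, mul_cpow_of_re_nonneg (by simp) b2, mul_assoc, ← mul_sub_one, norm_mul,
      Complex.norm_cpow_real, hnz, hpow]
    rw [norm_pow, hnz] at b1
    have : C * |θ| ^ 2 ≤ (|C| + A / δ ^ (α + 2) + 1 / δ ^ 2) * |θ| ^ 2 := by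
      apply mul_le_mul_of_nonneg_right _ (by positivity)
      have := le_abs_self C
      have : 0 ≤ A / δ ^ (α + 2) := by positivity
      have : 0 ≤ 1 / δ ^ 2 := by positivity
      linarith
    calc |θ| ^ α * _ ≤ |θ| ^ α * ((|C| + A / δ ^ (α + 2) + 1 / δ ^ 2) * |θ| ^ 2) :=
          mul_le_mul_of_nonneg_left (b1.trans this) (by positivity)
      _ = _ := by ring
  · have n1 : ‖(1 - Complex.exp (-(θ * Complex.I))) ^ (α : ℂ)‖ ≤ 2 ^ α := by
      rw [Complex.norm_cpow_real]
      refine Real.rpow_le_rpow (norm_nonneg _) ?_ (by linarith)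
      refine (norm_sub_le _ _).trans ?_
      rw [norm_exp_mul_I_neg]; norm_num
    have n2 : ‖shiftFactor α (θ * Complex.I)‖ ≤ |lamOne α| + |lamZero α| + |lamNegOne α| := by
      refine (norm_add₃_le).trans ?_
      rw [norm_mul, norm_mul, norm_exp_mul_I_neg, Complex.norm_exp_ofReal_mul_I]
      simp
    have n3 : ‖(1 - Complex.exp (-(θ * Complex.I))) ^ (α : ℂ) * shiftFactor α (θ * Complex.I)‖ ≤ A := by
      rw [norm_mul]
      exact mul_le_mul n1 n2 (norm_nonneg _) (by positivity)
    have n4 : A ≤ A / δ ^ (α + 2) * |θ| ^ (α + 2) := by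
      rw [div_mul_eq_mul_div, le_div_iff₀ (by positivity)]
      exact mul_le_mul_of_nonneg_left (Real.rpow_le_rpow hδ.le hge (by linarith)) hA0
    have n5 : |θ| ^ α ≤ 1 / δ ^ 2 * |θ| ^ (α + 2) := by
      rw [hpow, div_mul_eq_mul_div, le_div_iff₀ (by positivity), one_mul]
      exact mul_le_mul_of_nonneg_left (pow_le_pow_left₀ hδ.le hge 2) (by positivity)
    refine (norm_sub_le _ _).trans ?_
    rw [Complex.norm_cpow_real, hnz]
    have : 0 ≤ |C| * |θ| ^ (α + 2) := by positivity
    linarith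

end FGLE

namespace FGLE

open MeasureTheory Set Filter Topology

/-! ### Fractional integrals of order `2 - α` -/

/-- The unnormalised left Riemann–Liouville integral of order `2 - α`. -/
noncomputable def rlIntegral (α : ℝ) (f : ℝ → ℂ) (y : ℝ) : ℂ :=
  ∫ s in Ioi (0 : ℝ), f (y - s) / ((s ^ (α - 1) : ℝ) : ℂ)

theorem integral_Iio_eq_rlIntegral (α : ℝ) (f : ℝ → ℂ) (y : ℝ) :
    ∫ ξ in Iio y, f ξ / (((y - ξ) ^ (α - 1) : ℝ) : ℂ) = rlIntegral α f y := by
  rw [rlIntegral, ← integral_indicator measurableSet_Iio, ← integral_indicator measurableSet_Ioi,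
    ← integral_sub_left_eq_self _ _ y]
  congr 1
  ext s
  simp only [indicator, mem_Iio, mem_Ioi, sub_lt_self_iff, sub_sub_cancel]

theorem integral_Ioi_eq_rlIntegral (α : ℝ) (f : ℝ → ℂ) (y : ℝ) :
    ∫ ξ in Ioi y, f ξ / (((ξ - y) ^ (α - 1) : ℝ) : ℂ) = rlIntegral α (fun ξ => f (-ξ)) (-y) := by
  rw [rlIntegral, ← integral_indicator measurableSet_Ioi, ← integral_indicator measurableSet_Ioi,
    ← integral_add_right_eq_self _ y]
  congr 1
  ext s
  simp [indicator, mem_Ioi, add_comm]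

theorem leftRL_eq {α : ℝ} (hα : α ≠ 2) (f : ℝ → ℂ) (x : ℝ) :
    leftRL α f x = ((1 / Real.Gamma (2 - α) : ℝ) : ℂ) * deriv (deriv (rlIntegral α f)) x := by
  rw [leftRL, if_neg hα, iteratedDeriv_succ, iteratedDeriv_one]
  simp only [integral_Iio_eq_rlIntegral]

/-- Reflection lets the analysis be done for the left derivative alone. -/
theorem rightRL_eq_leftRL (α : ℝ) (f : ℝ → ℂ) (x : ℝ) :
    rightRL α f x = leftRL α (fun ξ => f (-ξ)) (-x) := by
  rw [leftRL, rightRL]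
  split_ifs with h
  · rw [iteratedDeriv_comp_neg]
    simp
  · simp only [integral_Iio_eq_rlIntegral, integral_Ioi_eq_rlIntegral]
    rw [iteratedDeriv_comp_neg]
    simp

theorem integrableOn_kernel {α : ℝ} (hα : α < 2) (R : ℝ) :
    IntegrableOn (fun s : ℝ => (s ^ (α - 1))⁻¹) (Ioc 0 R) := by
  have h : IntegrableOn (fun s : ℝ => s ^ (1 - α)) (Ioc 0 R) := by
    rcases le_or_gt R 0 with hR | hR
    · rw [Ioc_eq_empty (by simpa using hR)]; exact integrableOn_empty
    · rw [← intervalIntegrable_iff_integrableOn_Ioc_of_le hR.le]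
      exact intervalIntegral.intervalIntegrable_rpow' (by linarith)
  refine h.congr_fun (fun s hs => ?_) measurableSet_Ioc
  show s ^ (1 - α) = (s ^ (α - 1))⁻¹
  rw [← Real.rpow_neg hs.1.le]; ring_nf

/-- The function that bounds the integrands of `rlIntegral`. -/
noncomputable def kernelBound (α R C : ℝ) : ℝ → ℝ :=
  (Ioc 0 R).indicator fun s => C * (s ^ (α - 1))⁻¹

theorem integrable_kernelBound {α : ℝ} (hα : α < 2) (R C : ℝ) :
    Integrable (kernelBound α R C) (volume.restrict (Ioi 0)) := by
  refine (integrable_indicator_iff measurableSet_Ioc).2 ?_ |>.restrict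
  exact (integrableOn_kernel hα R).const_mul C

theorem norm_div_kernel_le {α R C s : ℝ} {z : ℂ} (hs : 0 < s) (hz : ‖z‖ ≤ C) (hR : R < s → z = 0) :
    ‖z / ((s ^ (α - 1) : ℝ) : ℂ)‖ ≤ kernelBound α R C s := by
  rw [norm_div, Complex.norm_real, Real.norm_of_nonneg (Real.rpow_nonneg hs.le _), kernelBound]
  by_cases h : s ≤ R
  · rw [indicator_of_mem (mem_Ioc.2 ⟨hs, h⟩), div_eq_mul_inv]
    have : 0 ≤ (s ^ (α - 1))⁻¹ := inv_nonneg.2 (Real.rpow_nonneg hs.le _)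
    gcongr
  · rw [hR (not_le.1 h), indicator_of_notMem (fun h' => h h'.2)]
    simp

theorem measurable_kernel (α : ℝ) : Measurable fun s : ℝ => ((s ^ (α - 1) : ℝ) : ℂ) := by fun_prop

/-- A bounded measurable function vanishing on the left of `a` has a convergent fractional
integral. -/
theorem integrable_div_kernel {α : ℝ} (hα : α < 2) {f : ℝ → ℂ} {a x C : ℝ}
    (hf : AEStronglyMeasurable f volume) (hb : ∀ y, y < x → ‖f y‖ ≤ C) (h0 : ∀ y, y < a → f y = 0) :
    Integrable (fun s => f (x - s) / ((s ^ (α - 1) : ℝ) : ℂ)) (volume.restrict (Ioi 0)) := by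
  refine (integrable_kernelBound hα (x - a) C).mono' ?_ ?_
  · have h1 : AEStronglyMeasurable (fun s => f (x - s)) volume :=
      hf.comp_quasiMeasurePreserving (quasiMeasurePreserving_sub_left volume x)
    simp only [div_eq_mul_inv]
    exact h1.restrict.mul (measurable_kernel α).inv.aestronglyMeasurable
  · filter_upwards [ae_restrict_mem measurableSet_Ioi] with s hs
    have hs : 0 < s := hs
    exact norm_div_kernel_le hs (hb _ (by linarith)) fun h => h0 _ (by linarith)

theorem norm_rlIntegral_le {α : ℝ} (hα : α < 2) {f : ℝ → ℂ} {a x C : ℝ}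
    (hb : ∀ y, y < x → ‖f y‖ ≤ C) (h0 : ∀ y, y < a → f y = 0) :
    ‖rlIntegral α f x‖ ≤ ∫ s in Ioi (0 : ℝ), kernelBound α (x - a) C s := by
  refine norm_integral_le_of_norm_le (integrable_kernelBound hα _ _) ?_
  filter_upwards [ae_restrict_mem measurableSet_Ioi] with s hs
  have hs : 0 < s := hs
  exact norm_div_kernel_le hs (hb _ (by linarith)) fun h => h0 _ (by linarith)

/-- Differentiation of the fractional integral of a Lipschitz function. -/
theorem hasDerivAt_rlIntegral {α : ℝ} (hα : α < 2) {f f' : ℝ → ℂ} {K : NNReal} {a : ℝ}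
    (hf : LipschitzWith K f) (h0 : ∀ y, y ≤ a → f y = 0) {S : Set ℝ} (hS : S.Countable)
    (hd : ∀ y, y ∉ S → HasDerivAt f (f' y) y) (x : ℝ) :
    HasDerivAt (rlIntegral α f) (rlIntegral α f' x) x := by
  have hnull : ∀ᵐ s ∂(volume.restrict (Ioi (0 : ℝ))), x - s ∉ S := by
    refine ae_restrict_of_ae ?_
    have : volume ((fun s => x - s) ⁻¹' S) = 0 := by
      rw [(Measure.measurePreserving_sub_left volume x).measure_preimage
        hS.measurableSet.nullMeasurableSet]
      exact hS.measure_zero _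
    exact measure_eq_zero_iff_ae_notMem.1 this
  have hae : f' =ᵐ[volume] deriv f := by
    filter_upwards [hS.ae_notMem volume] with y hy
    exact (hd y hy).deriv.symm
  have hmeas' : AEStronglyMeasurable f' volume :=
    (aestronglyMeasurable_deriv f volume).congr hae.symm
  -- For y within distance 1 of x, the point y-s lies left of a as soon as s > x + 1 - a; this fixes
  -- the support of the dominating function.
  refine (hasDerivAt_integral_of_dominated_loc_of_lip (s := Metric.ball x 1)
    (bound := kernelBound α (x + 1 - a) K) (Metric.ball_mem_nhds x one_pos) ?_ ?_ ?_ ?_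
    (integrable_kernelBound hα _ _) ?_).2
  · refine Eventually.of_forall fun y => ?_
    simp only [div_eq_mul_inv]
    have : Continuous fun s => f (y - s) := hf.continuous.comp (by fun_prop)
    exact this.aestronglyMeasurable.mul (measurable_kernel α).inv.aestronglyMeasurable
  · refine integrable_div_kernel (a := a) (C := K * |x - a|) hα hf.continuous.aestronglyMeasurable
      (fun y hy => ?_) fun y hy => h0 y hy.le
    rcases le_or_gt y a with h | h
    · rw [h0 y h]; simp; positivity
    · have := hf.norm_sub_le y a
      rw [h0 a le_rfl, sub_zero] at this
      refine this.trans ?_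
      gcongr
      rw [Real.norm_eq_abs, abs_of_pos (by linarith), abs_of_pos (by linarith)]
      linarith
  · have h1 : AEStronglyMeasurable (fun s => f' (x - s)) volume :=
      hmeas'.comp_quasiMeasurePreserving (quasiMeasurePreserving_sub_left volume x)
    simp only [div_eq_mul_inv]
    exact h1.restrict.mul (measurable_kernel α).inv.aestronglyMeasurable
  · filter_upwards [ae_restrict_mem measurableSet_Ioi] with s hs
    have hs : 0 < s := hs
    refine LipschitzOnWith.of_dist_le_mul fun y hy z hz => ?_
    rw [Metric.mem_ball, Real.dist_eq, abs_lt] at hy hz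
    rw [dist_eq_norm, ← sub_div, Real.coe_nnabs]
    have h1 : ‖f (y - s) - f (z - s)‖ ≤ K * dist y z := by
      have := hf.dist_le_mul (y - s) (z - s)
      rwa [dist_eq_norm, dist_sub_right] at this
    have h2 : x + 1 - a < s → f (y - s) - f (z - s) = 0 := fun h => by
      rw [h0 _ (by linarith), h0 _ (by linarith), sub_zero]
    refine (norm_div_kernel_le (α := α) hs h1 h2).trans ?_
    refine le_trans (le_of_eq ?_) (mul_le_mul_of_nonneg_right (le_abs_self _) dist_nonneg)
    rw [kernelBound, kernelBound]
    by_cases hm : s ∈ Ioc 0 (x + 1 - a)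
    · rw [indicator_of_mem hm, indicator_of_mem hm]; ring
    · rw [indicator_of_notMem hm, indicator_of_notMem hm, zero_mul]
  · filter_upwards [hnull] with s hs
    exact ((hd _ hs).comp_sub_const x s).div_const _

end FGLE

namespace FGLE

open MeasureTheory Set Filter Topology

/-! ### Regularity at the end points -/

theorem rlIntegral_neg (α : ℝ) (f : ℝ → ℂ) : rlIntegral α (fun y => -f y) = fun x => -rlIntegral α f x := by
  ext x
  simp only [rlIntegral, neg_div, integral_neg]

theorem leftRL_neg {α : ℝ} (hα : α ≠ 2) (f : ℝ → ℂ) (x : ℝ) :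
    leftRL α (fun y => -f y) x = -leftRL α f x := by
  have e : deriv (deriv fun x => -rlIntegral α f x) x = -deriv (deriv (rlIntegral α f)) x := by
    have : (deriv fun x => -rlIntegral α f x) = fun x => -deriv (rlIntegral α f) x := by
      ext y; exact deriv.fun_neg
    rw [this, deriv.fun_neg]
  rw [leftRL_eq hα, leftRL_eq hα, rlIntegral_neg, e, mul_neg]

/-- A jump is the only source of singularity: differentiating this power gives the term c
(x-a)^(1-α). -/
theorem rlIntegral_step {α : ℝ} (hα : α < 2) {a x : ℝ} (hx : a < x) (c : ℂ) :
    rlIntegral α ((Ioi a).indicator fun _ => c) x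
      = c * (((x - a) ^ (2 - α) / (2 - α) : ℝ) : ℂ) := by
  have h1 : rlIntegral α ((Ioi a).indicator fun _ => c) x
      = ∫ s in Ioo 0 (x - a), c * ((s ^ (1 - α) : ℝ) : ℂ) := by
    rw [rlIntegral, ← integral_indicator measurableSet_Ioi, ← integral_indicator measurableSet_Ioo]
    congr 1
    ext s
    simp only [indicator, mem_Ioi, mem_Ioo, lt_sub_comm (a := a)]
    by_cases hs : 0 < s <;> by_cases h2 : s < x - a <;> simp only [hs, h2, and_true, and_false,
      if_true, if_false, zero_div]
    rw [div_eq_mul_inv, ← Complex.ofReal_inv, ← Real.rpow_neg hs.le, neg_sub]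
  have h2 : ∫ s in Ioo 0 (x - a), ((s ^ (1 - α) : ℝ) : ℂ)
      = (((x - a) ^ (2 - α) / (2 - α) : ℝ) : ℂ) := by
    rw [integral_complex_ofReal, ← integral_Ioc_eq_integral_Ioo,
      ← intervalIntegral.integral_of_le (by linarith), integral_rpow (Or.inl (by linarith)),
      Real.zero_rpow (by linarith), sub_zero]
    ring_nf
  rw [h1, integral_const_mul, h2]

/-- The derivative of a function on `[a, b]`, extended by zero. -/
noncomputable def innerDeriv (a b : ℝ) (g : ℝ → ℂ) : ℝ → ℂ :=
  (Ioo a b).indicator (derivWithin g (Icc a b))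

theorem contDiffOn_derivWithin {a b : ℝ} (hab : a < b) {g : ℝ → ℂ}
    (hg : ContDiffOn ℝ ∞ g (Icc a b)) : ContDiffOn ℝ ∞ (derivWithin g (Icc a b)) (Icc a b) :=
  hg.derivWithin (uniqueDiffOn_Icc hab) (by simp)

theorem exists_bound_of_contDiffOn {a b : ℝ} {g : ℝ → ℂ}
    (hg : ContDiffOn ℝ ∞ g (Icc a b)) : ∃ C, 0 ≤ C ∧ ∀ x ∈ Icc a b, ‖g x‖ ≤ C := by
  obtain ⟨C, hC⟩ := isCompact_Icc.exists_bound_of_continuousOn hg.continuousOn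
  exact ⟨max C 0, le_max_right _ _, fun x hx => (hC x hx).trans (le_max_left _ _)⟩

/-- Extending by the end-point values, rather than by zero, keeps the function Lipschitz on the
line, and its derivative off the end points is `innerDeriv`. -/
theorem exists_lipschitzWith_extend {a b : ℝ} (hab : a < b) {g : ℝ → ℂ}
    (hg : ContDiffOn ℝ ∞ g (Icc a b)) :
    ∃ K, LipschitzWith K fun y => g (projIcc a b hab.le y) := by
  obtain ⟨C, hC0, hC⟩ := exists_bound_of_contDiffOn (contDiffOn_derivWithin hab hg)
  have h := (convex_Icc a b).lipschitzOnWith_of_nnnorm_derivWithin_le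
    (C := ⟨C, hC0⟩) (hg.differentiableOn (by simp)) hC
  refine ⟨⟨C, hC0⟩ * 1, ?_⟩
  exact (lipschitzOnWith_iff_restrict.1 h).comp (LipschitzWith.projIcc hab.le)

theorem hasDerivAt_of_mem_Ioo {a b : ℝ} {g : ℝ → ℂ}
    (hg : ContDiffOn ℝ ∞ g (Icc a b)) {y : ℝ} (hy : y ∈ Ioo a b) :
    HasDerivAt g (derivWithin g (Icc a b) y) y :=
  ((hg.differentiableOn (by simp) y (Ioo_subset_Icc_self hy)).hasDerivWithinAt).hasDerivAt
    (Icc_mem_nhds hy.1 hy.2)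

theorem hasDerivAt_extend {a b : ℝ} (hab : a < b) {g : ℝ → ℂ}
    (hg : ContDiffOn ℝ ∞ g (Icc a b)) {y : ℝ} (hy : y ∉ ({a, b} : Set ℝ)) :
    HasDerivAt (fun y => g (projIcc a b hab.le y)) (innerDeriv a b g y) y := by
  simp only [mem_insert_iff, mem_singleton_iff, not_or] at hy
  rcases lt_or_gt_of_ne hy.1 with h | h
  · rw [innerDeriv, indicator_of_notMem (fun h' => absurd h'.1 (not_lt.2 h.le))]
    refine (hasDerivAt_const y (g a)).congr_of_eventuallyEq ?_
    filter_upwards [Iio_mem_nhds h] with z hz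
    rw [projIcc_of_le_left hab.le (le_of_lt hz)]
  · rcases lt_or_gt_of_ne hy.2 with h' | h'
    · rw [innerDeriv, indicator_of_mem (mem_Ioo.2 ⟨h, h'⟩)]
      refine (hasDerivAt_of_mem_Ioo hg ⟨h, h'⟩).congr_of_eventuallyEq ?_
      filter_upwards [Ioo_mem_nhds h h'] with z hz
      rw [projIcc_of_mem hab.le (Ioo_subset_Icc_self hz)]
    · rw [innerDeriv, indicator_of_notMem (fun h'' => absurd h''.2 (not_lt.2 h'.le))]
      refine (hasDerivAt_const y (g b)).congr_of_eventuallyEq ?_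
      filter_upwards [Ioi_mem_nhds h'] with z hz
      rw [projIcc_of_right_le hab.le (le_of_lt hz)]

theorem hasDerivAt_rlIntegral_extend {α a b : ℝ} (hα : α < 2) (hab : a < b) {g : ℝ → ℂ}
    (hg : ContDiffOn ℝ ∞ g (Icc a b)) (hga : g a = 0) (x : ℝ) :
    HasDerivAt (rlIntegral α fun y => g (projIcc a b hab.le y))
      (rlIntegral α (innerDeriv a b g) x) x := by
  obtain ⟨K, hK⟩ := exists_lipschitzWith_extend hab hg
  refine hasDerivAt_rlIntegral hα hK (a := a) (fun y hy => ?_) (S := {a, b})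
    ((Set.toFinite _).countable) (fun y hy => hasDerivAt_extend hab hg hy) x
  rw [projIcc_of_le_left hab.le hy, hga]

theorem innerDeriv_sub_const (a b : ℝ) (g : ℝ → ℂ) (c : ℂ) :
    innerDeriv a b (fun y => g y - c) = innerDeriv a b g := by
  unfold innerDeriv
  congr 1
  ext y
  exact derivWithin_sub_const _

/-- The derivative of the fractional integral of a function with a jump at `a`. -/
theorem hasDerivAt_rlIntegral_innerDeriv {α a b : ℝ} (hα : α < 2) (hab : a < b) {g : ℝ → ℂ}
    (hg : ContDiffOn ℝ ∞ g (Icc a b)) {x : ℝ} (hx : x ∈ Ioo a b) :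
    HasDerivAt (rlIntegral α (innerDeriv a b g))
      (rlIntegral α (innerDeriv a b (derivWithin g (Icc a b))) x
        + derivWithin g (Icc a b) a * (((x - a) ^ (1 - α) : ℝ) : ℂ)) x := by
  set g' := derivWithin g (Icc a b) with hg'
  have hs := contDiffOn_derivWithin hab hg
  set c := g' a
  -- Subtracting the value at a removes the jump there, so the Lipschitz lemma applies to `g' - c`;
  -- the jump itself is the step function of `rlIntegral_step`.
  have hr : ContDiffOn ℝ ∞ (fun y => g' y - c) (Icc a b) := hs.sub contDiffOn_const
  have h1 := hasDerivAt_rlIntegral_extend hα hab hr (sub_self _) x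
  rw [innerDeriv_sub_const] at h1
  have h2 : HasDerivAt (fun y : ℝ => c * (((y - a) ^ (2 - α) / (2 - α) : ℝ) : ℂ))
      (c * (((x - a) ^ (1 - α) : ℝ) : ℂ)) x := by
    have h3 : HasDerivAt (fun y : ℝ => (y - a) ^ (2 - α) / (2 - α)) ((x - a) ^ (1 - α)) x := by
      have := (((hasDerivAt_id x).sub_const a).rpow_const (p := 2 - α)
        (Or.inl (by simp; linarith [hx.1]))).div_const (2 - α)
      refine this.congr_deriv ?_
      have : (2 - α) ≠ 0 := by linarith
      rw [show 2 - α - 1 = 1 - α by ring]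
      simp only [id]
      field_simp
    exact h3.ofReal_comp.const_mul c
  refine (h1.add h2).congr_of_eventuallyEq ?_
  obtain ⟨K, hK⟩ := exists_lipschitzWith_extend hab hr
  -- For y < b only values to the left of b enter the integral, so the jump at b and the choice of
  -- extension beyond it are invisible.
  filter_upwards [Ioo_mem_nhds hx.1 hx.2] with y hy
  rw [Pi.add_apply, ← rlIntegral_step hα hy.1 c]
  have hga : ∀ z, z ≤ a → g' (projIcc a b hab.le z) - c = 0 := fun z hz => by
    rw [projIcc_of_le_left hab.le hz]; exact sub_self _
  obtain ⟨C, hC0, hC⟩ := exists_bound_of_contDiffOn hr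
  have i1 := integrable_div_kernel (a := a) (x := y) (C := C) hα
    hK.continuous.aestronglyMeasurable (fun z _ => hC _ (projIcc a b hab.le z).2)
    (fun z hz => hga z hz.le)
  have i2 := integrable_div_kernel (f := (Ioi a).indicator fun _ => c) (a := a) (x := y)
    (C := ‖c‖) hα ((measurable_const.indicator measurableSet_Ioi).aestronglyMeasurable)
    (fun z _ => norm_indicator_le_norm_self _ _)
    (fun z hz => indicator_of_notMem (fun h => absurd h (not_lt.2 hz.le)) _)
  rw [rlIntegral, rlIntegral, rlIntegral, ← integral_add i1 i2]
  refine setIntegral_congr_fun measurableSet_Ioi fun s hs => ?_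
  have hs : 0 < s := hs
  rw [← add_div]
  congr 1
  rcases le_or_gt (y - s) a with h | h
  · rw [hga _ h, innerDeriv, indicator_of_notMem (fun h' => absurd h'.1 (not_lt.2 h)),
      indicator_of_notMem (s := Ioi a) (by simpa using h), zero_add]
  · have hm : y - s ∈ Ioo a b := ⟨h, by linarith [hy.2]⟩
    rw [innerDeriv, indicator_of_mem hm, indicator_of_mem (s := Ioi a) h,
      projIcc_of_mem hab.le (Ioo_subset_Icc_self hm), sub_add_cancel]

/-- Functions that are smooth on `[a, b]` up to the end points and vanish off `(a, b)`. -/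
structure IsSmoothSupported (a b : ℝ) (f : ℝ → ℂ) : Prop where
  smooth : ContDiffOn ℝ ∞ f (Icc a b)
  exterior : ∀ x, x ∉ Ioo a b → f x = 0

namespace IsSmoothSupported

variable {α a b : ℝ} {f : ℝ → ℂ}

theorem eq_extend (hab : a < b) (hf : IsSmoothSupported a b f) :
    (fun y => f (projIcc a b hab.le y)) = f := by
  ext y
  by_cases hy : y ∈ Ioo a b
  · rw [projIcc_of_mem hab.le (Ioo_subset_Icc_self hy)]
  · rw [hf.exterior y hy]
    rcases le_or_gt y a with h | h
    · rw [projIcc_of_le_left hab.le h]; exact hf.exterior _ (by simp)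
    · have h' : b ≤ y := not_lt.1 fun h' => hy ⟨h, h'⟩
      rw [projIcc_of_right_le hab.le h']; exact hf.exterior _ (by simp)

theorem reflect (hf : IsSmoothSupported a b f) :
    IsSmoothSupported (-b) (-a) (fun y => f (-y)) where
  smooth := hf.smooth.comp contDiff_neg.contDiffOn fun y hy => by
    constructor <;> linarith [hy.1, hy.2]
  exterior y hy := hf.exterior _ fun h => hy (by constructor <;> linarith [h.1, h.2])

theorem deriv_rlIntegral (hα : α < 2) (hab : a < b) (hf : IsSmoothSupported a b f) :
    deriv (rlIntegral α f) = rlIntegral α (innerDeriv a b f) := by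
  ext x
  have := hasDerivAt_rlIntegral_extend hα hab hf.smooth (hf.exterior a (by simp)) x
  rw [hf.eq_extend hab] at this
  exact this.deriv

theorem leftRL_eq_innerDeriv (hα : α < 2) (hab : a < b) (hf : IsSmoothSupported a b f) (x : ℝ) :
    leftRL α f x = ((1 / Real.Gamma (2 - α) : ℝ) : ℂ)
      * deriv (rlIntegral α (innerDeriv a b f)) x := by
  rw [leftRL_eq hα.ne, hf.deriv_rlIntegral hα hab]

theorem leftRL_eq_add (hα : α < 2) (hab : a < b) (hf : IsSmoothSupported a b f)
    {x : ℝ} (hx : x ∈ Ioo a b) :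
    leftRL α f x = ((1 / Real.Gamma (2 - α) : ℝ) : ℂ)
      * (rlIntegral α (innerDeriv a b (derivWithin f (Icc a b))) x
        + derivWithin f (Icc a b) a * (((x - a) ^ (1 - α) : ℝ) : ℂ)) := by
  rw [hf.leftRL_eq_innerDeriv hα hab,
    (hasDerivAt_rlIntegral_innerDeriv hα hab hf.smooth hx).deriv]

theorem kernelBound_integral_mono {α : ℝ} (hα : α < 2) {R R' C : ℝ} (h : R ≤ R') (hC : 0 ≤ C) :
    ∫ s in Ioi (0 : ℝ), kernelBound α R C s ≤ ∫ s in Ioi (0 : ℝ), kernelBound α R' C s := by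
  refine setIntegral_mono_on (integrable_kernelBound hα _ _) (integrable_kernelBound hα _ _)
    measurableSet_Ioi fun s hs => ?_
  have hs : 0 < s := hs
  have h0 : 0 ≤ C * (s ^ (α - 1))⁻¹ := mul_nonneg hC (inv_nonneg.2 (Real.rpow_nonneg hs.le _))
  simp only [kernelBound, indicator, mem_Ioc]
  split_ifs with h1 h2 h2
  · exact le_rfl
  · exact absurd ⟨h1.1, h1.2.trans h⟩ h2
  · exact h0
  · exact le_rfl

/-- Up to a bounded function, the left derivative is a power singularity at `a`. -/
theorem exists_leftRL_sub_bound (hα : α < 2) (hab : a < b) (hf : IsSmoothSupported a b f) :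
    ∃ C, ∀ x ∈ Ioo a b, ‖leftRL α f x - ((1 / Real.Gamma (2 - α) : ℝ) : ℂ) *
      (derivWithin f (Icc a b) a * (((x - a) ^ (1 - α) : ℝ) : ℂ))‖ ≤ C := by
  obtain ⟨M, hM0, hM⟩ := exists_bound_of_contDiffOn
    (contDiffOn_derivWithin hab (contDiffOn_derivWithin hab hf.smooth))
  refine ⟨‖((1 / Real.Gamma (2 - α) : ℝ) : ℂ)‖ * ∫ s in Ioi (0 : ℝ), kernelBound α (b - a) M s,
    fun x hx => ?_⟩
  rw [hf.leftRL_eq_add hα hab hx, ← mul_sub, add_sub_cancel_right, norm_mul]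
  refine mul_le_mul_of_nonneg_left ?_ (norm_nonneg _)
  refine (norm_rlIntegral_le hα (a := a) (C := M) (fun y _ => ?_) fun y hy => ?_).trans
    (kernelBound_integral_mono hα (by linarith [hx.2]) hM0)
  · by_cases hy : y ∈ Ioo a b
    · rw [innerDeriv, indicator_of_mem hy]; exact hM y (Ioo_subset_Icc_self hy)
    · rw [innerDeriv, indicator_of_notMem hy, norm_zero]; exact hM0
  · exact indicator_of_notMem (fun h => absurd h.1 (not_lt.2 hy.le)) _

end IsSmoothSupported

/-- Multiply by (x-a)^β and let x tend to a: the bounded part and the singularity at b disappear in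
the limit, leaving `c`. -/
theorem eq_zero_of_bounded_singularity {a b β M : ℝ} (hab : a < b) (hβ : 0 < β) {c d : ℂ}
    (h : ∀ x ∈ Ioo a b, ‖c * (((x - a) ^ (-β) : ℝ) : ℂ) + d * (((b - x) ^ (-β) : ℝ) : ℂ)‖ ≤ M) :
    c = 0 := by
  have h1 : Tendsto (fun x => (x - a) ^ β * (M + ‖d‖ * (b - x) ^ (-β))) (𝓝[>] a) (𝓝 0) := by
    have c1 : ContinuousAt (fun x => (x - a) ^ β) a :=
      (continuousAt_id.sub continuousAt_const).rpow_const (Or.inr hβ.le)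
    have c2 : ContinuousAt (fun x => (b - x) ^ (-β)) a :=
      (continuousAt_const.sub continuousAt_id).rpow_const (Or.inl (by simp; linarith))
    have c3 : ContinuousAt (fun x => (x - a) ^ β * (M + ‖d‖ * (b - x) ^ (-β))) a :=
      c1.mul (continuousAt_const.add (c2.const_mul ‖d‖))
    have := c3.tendsto
    rw [sub_self, Real.zero_rpow hβ.ne', zero_mul] at this
    exact this.mono_left nhdsWithin_le_nhds
  have h2 : ‖c‖ ≤ 0 := by
    refine ge_of_tendsto h1 ?_
    filter_upwards [Ioo_mem_nhdsGT hab] with x hx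
    have p1 : 0 < x - a := by linarith [hx.1]
    have p2 : 0 < b - x := by linarith [hx.2]
    have e : ‖c‖ = (x - a) ^ β * ‖c * (((x - a) ^ (-β) : ℝ) : ℂ)‖ := by
      rw [norm_mul, Complex.norm_real, Real.norm_of_nonneg (by positivity), mul_left_comm,
        ← Real.rpow_add p1]
      simp
    rw [e]
    refine mul_le_mul_of_nonneg_left ?_ (by positivity)
    have h3 := norm_sub_le (c * (((x - a) ^ (-β) : ℝ) : ℂ) + d * (((b - x) ^ (-β) : ℝ) : ℂ))
      (d * (((b - x) ^ (-β) : ℝ) : ℂ))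
    rw [add_sub_cancel_right, norm_mul d, Complex.norm_real,
      Real.norm_of_nonneg (r := (b - x) ^ (-β)) (by positivity)] at h3
    linarith [h x hx]
  simpa using h2

theorem fracLaplacian_reflect (α : ℝ) (f : ℝ → ℂ) (x : ℝ) :
    fracLaplacian α (fun y => f (-y)) (-x) = fracLaplacian α f x := by
  rw [fracLaplacian, fracLaplacian, ← rightRL_eq_leftRL, rightRL_eq_leftRL α (fun y => f (-y)),
    add_comm]
  simp only [neg_neg]

namespace IsSmoothSupported

variable {α a b : ℝ} {f : ℝ → ℂ}

/-- If the fractional Laplacian is bounded, the one-sided derivative at the left end point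
vanishes. -/
theorem derivWithin_left_eq_zero (h₁ : 1 < α) (hα : α < 2) (hab : a < b)
    (hf : IsSmoothSupported a b f) {M : ℝ} (hM : ∀ x ∈ Ioo a b, ‖fracLaplacian α f x‖ ≤ M) :
    derivWithin f (Icc a b) a = 0 := by
  obtain ⟨C, hC⟩ := hf.exists_leftRL_sub_bound hα hab
  obtain ⟨D, hD⟩ := hf.reflect.exists_leftRL_sub_bound hα (neg_lt_neg hab)
  set k : ℂ := ((1 / (2 * Real.cos (α * Real.pi / 2)) : ℝ) : ℂ) with hk
  set G : ℂ := ((1 / Real.Gamma (2 - α) : ℝ) : ℂ) with hG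
  set c := derivWithin f (Icc a b) a
  set d := derivWithin (fun y => f (-y)) (Icc (-b) (-a)) (-b)
  have hk0 : k ≠ 0 := by
    have := cos_half_neg h₁ hα.le
    rw [hk, Complex.ofReal_ne_zero]
    exact one_div_ne_zero (by linarith)
  have hG0 : G ≠ 0 := by
    rw [hG, Complex.ofReal_ne_zero]
    exact one_div_ne_zero (Real.Gamma_pos_of_pos (by linarith)).ne'
  have key : k * (G * c) = 0 := by
    refine eq_zero_of_bounded_singularity hab (sub_pos.2 h₁) (d := k * (G * d))
      (M := M + ‖k‖ * (C + D)) fun x hx => ?_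
    have hC := hC x hx
    have hD := hD (-x) (by constructor <;> linarith [hx.1, hx.2])
    rw [← rightRL_eq_leftRL, sub_neg_eq_add, neg_add_eq_sub] at hD
    have hM := hM x hx
    rw [fracLaplacian, ← hk] at hM
    rw [neg_sub]
    set p : ℂ := (((x - a) ^ (1 - α) : ℝ) : ℂ)
    set q : ℂ := (((b - x) ^ (1 - α) : ℝ) : ℂ)
    have e : k * (G * c) * p + k * (G * d) * q = k * (leftRL α f x + rightRL α f x)
      - k * ((leftRL α f x - G * (c * p)) + (rightRL α f x - G * (d * q))) := by ring
    rw [e]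
    refine (norm_sub_le _ _).trans (add_le_add hM ?_)
    rw [norm_mul]
    exact mul_le_mul_of_nonneg_left ((norm_add_le _ _).trans (add_le_add hC hD)) (norm_nonneg _)
  simpa [hk0, hG0] using key

theorem derivWithin_right_eq_zero (h₁ : 1 < α) (hα : α < 2) (hab : a < b)
    (hf : IsSmoothSupported a b f) {M : ℝ} (hM : ∀ x ∈ Ioo a b, ‖fracLaplacian α f x‖ ≤ M) :
    derivWithin f (Icc a b) b = 0 := by
  have := hf.reflect.derivWithin_left_eq_zero h₁ hα (neg_lt_neg hab) (M := M) fun x hx => by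
    rw [← neg_neg x, fracLaplacian_reflect]
    exact hM _ (by constructor <;> linarith [hx.1, hx.2])
  rw [derivWithin_comp_neg] at this
  simpa using this

/-- Zero slopes at the ends match the zero function outside, so the one-sided derivatives glue
together. -/
theorem hasDerivAt_of_flat (hab : a < b) (hf : IsSmoothSupported a b f)
    (ha : derivWithin f (Icc a b) a = 0) (hb : derivWithin f (Icc a b) b = 0) (y : ℝ) :
    HasDerivAt f (innerDeriv a b f y) y := by
  have hw : ∀ y ∈ Icc a b, HasDerivWithinAt f (derivWithin f (Icc a b) y) (Icc a b) y := fun y hy =>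
    (hf.smooth.differentiableOn (by simp) y hy).hasDerivWithinAt
  by_cases hy : y ∈ ({a, b} : Set ℝ)
  · have e : innerDeriv a b f y = 0 := indicator_of_notMem (by
      rcases hy with rfl | rfl <;> simp) _
    rw [e, ← hasDerivWithinAt_univ, ← Iic_union_Ici (a := y)]
    rcases hy with rfl | rfl
    · refine HasDerivWithinAt.union ?_ ?_
      · exact (hasDerivWithinAt_const y _ (0 : ℂ)).congr
          (fun z hz => hf.exterior z fun h => absurd h.1 (not_lt.2 hz)) (hf.exterior y (by simp))
      · have := hw y (left_mem_Icc.2 hab.le)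
        rw [ha] at this
        exact this.mono_of_mem_nhdsWithin (Icc_mem_nhdsGE hab)
    · refine HasDerivWithinAt.union ?_ ?_
      · have := hw y (right_mem_Icc.2 hab.le)
        rw [hb] at this
        exact this.mono_of_mem_nhdsWithin (Icc_mem_nhdsLE hab)
      · exact (hasDerivWithinAt_const y _ (0 : ℂ)).congr
          (fun z hz => hf.exterior z fun h => absurd h.2 (not_lt.2 hz)) (hf.exterior y (by simp))
  · have := hasDerivAt_extend hab hf.smooth hy
    rwa [hf.eq_extend hab] at this

theorem innerDeriv_of_flat (hab : a < b) (hf : IsSmoothSupported a b f)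
    (ha : derivWithin f (Icc a b) a = 0) (hb : derivWithin f (Icc a b) b = 0) :
    IsSmoothSupported a b (innerDeriv a b f) where
  smooth := (contDiffOn_derivWithin hab hf.smooth).congr fun y hy => by
    by_cases h : y ∈ Ioo a b
    · exact indicator_of_mem h _
    · rw [innerDeriv, indicator_of_notMem h]
      rcases hy.1.eq_or_lt with rfl | h1
      · exact ha.symm
      · rcases hy.2.eq_or_lt with rfl | h2
        · exact hb.symm
        · exact absurd ⟨h1, h2⟩ h
  exterior _ hx := indicator_of_notMem hx _

/-- Once the derivative also vanishes at the ends, no boundary term arises and differentiation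
commutes with the operator. -/
theorem hasDerivAt_leftRL (hα : α < 2) (hab : a < b) (hf : IsSmoothSupported a b f)
    (hf' : IsSmoothSupported a b (innerDeriv a b f)) {x : ℝ} (hx : x ∈ Ioo a b) :
    HasDerivAt (leftRL α f) (leftRL α (innerDeriv a b f) x) x := by
  have e : leftRL α f = fun x => ((1 / Real.Gamma (2 - α) : ℝ) : ℂ)
      * rlIntegral α (innerDeriv a b (innerDeriv a b f)) x := by
    ext y
    rw [hf.leftRL_eq_innerDeriv hα hab, hf'.deriv_rlIntegral hα hab]
  rw [e, hf'.leftRL_eq_innerDeriv hα hab]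
  exact (hasDerivAt_rlIntegral_innerDeriv hα hab hf'.smooth hx).differentiableAt.hasDerivAt.const_mul _

theorem innerDeriv_reflect (a b : ℝ) (f : ℝ → ℂ) :
    innerDeriv (-b) (-a) (fun y => f (-y)) = fun y => -innerDeriv a b f (-y) := by
  ext y
  have e : y ∈ Ioo (-b) (-a) ↔ -y ∈ Ioo a b := by
    rw [mem_Ioo, mem_Ioo, neg_lt, lt_neg (a := y), and_comm]
  simp only [innerDeriv, indicator, e, derivWithin_comp_neg, neg_Icc, neg_neg]
  split_ifs <;> simp

theorem hasDerivAt_fracLaplacian (hα : α < 2) (hab : a < b) (hf : IsSmoothSupported a b f)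
    (hf' : IsSmoothSupported a b (innerDeriv a b f)) {x : ℝ} (hx : x ∈ Ioo a b) :
    HasDerivAt (fracLaplacian α f) (fracLaplacian α (innerDeriv a b f) x) x := by
  have hr : IsSmoothSupported (-b) (-a) (innerDeriv (-b) (-a) fun y => f (-y)) := by
    rw [innerDeriv_reflect]
    exact ⟨hf'.reflect.smooth.neg, fun y hy => by rw [hf'.reflect.exterior y hy, neg_zero]⟩
  have h1 := hf.hasDerivAt_leftRL hα hab hf' hx
  have h2 := hf.reflect.hasDerivAt_leftRL hα (neg_lt_neg hab) hr (x := -x)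
    (by constructor <;> linarith [hx.1, hx.2])
  rw [innerDeriv_reflect, leftRL_neg hα.ne] at h2
  have h3 := h2.scomp x (hasDerivAt_neg x)
  have e : rightRL α f = leftRL α (fun y => f (-y)) ∘ Neg.neg := by
    ext y; exact rightRL_eq_leftRL α f y
  rw [← e, smul_neg, neg_smul, one_smul, neg_neg, ← rightRL_eq_leftRL] at h3
  exact (h1.add h3).const_mul _

/-- A function whose fractional Laplacian is smooth up to the end points is smooth on the whole
line. -/
theorem contDiff_of_fracLaplacian (h₁ : 1 < α) (hα : α < 2) (hab : a < b)
    (hf : IsSmoothSupported a b f) {F : ℝ → ℂ} (hF : ContDiffOn ℝ ∞ F (Icc a b))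
    (h : ∀ x ∈ Ioo a b, fracLaplacian α f x = F x) : ContDiff ℝ ∞ f := by
  rw [contDiff_infty]
  intro n
  induction n generalizing f F with
  | zero =>
    obtain ⟨K, hK⟩ := exists_lipschitzWith_extend hab hf.smooth
    rw [hf.eq_extend hab] at hK
    exact contDiff_zero.2 hK.continuous
  | succ n ih =>
    obtain ⟨M, -, hM⟩ := exists_bound_of_contDiffOn hF
    have hM' : ∀ x ∈ Ioo a b, ‖fracLaplacian α f x‖ ≤ M := fun x hx => by
      rw [h x hx]; exact hM x (Ioo_subset_Icc_self hx)
    have ha := hf.derivWithin_left_eq_zero h₁ hα hab hM'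
    have hb := hf.derivWithin_right_eq_zero h₁ hα hab hM'
    have hf' := hf.innerDeriv_of_flat hab ha hb
    have hd := hf.hasDerivAt_of_flat hab ha hb
    have e : deriv f = innerDeriv a b f := by ext y; exact (hd y).deriv
    push_cast
    refine contDiff_succ_iff_deriv.2 ⟨fun y => (hd y).differentiableAt, by simp, ?_⟩
    rw [e]
    -- The derivative is again smooth on [a,b] and zero outside, and its fractional Laplacian is the
    -- derivative of `F`, so the hypotheses reproduce themselves.
    refine ih hf' (contDiffOn_derivWithin hab hF) fun x hx => ?_
    have h3 := hf.hasDerivAt_fracLaplacian hα hab hf' hx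
    have h4 : HasDerivAt (fracLaplacian α f) (derivWithin F (Icc a b) x) x := by
      refine (hasDerivAt_of_mem_Ioo hF hx).congr_of_eventuallyEq ?_
      filter_upwards [Ioo_mem_nhds hx.1 hx.2] with y hy using h y hy
    exact h3.unique h4

end IsSmoothSupported

end FGLE

namespace FGLE

open MeasureTheory Set Filter Topology

/-! ### The Laplace transform of a power in the right half-plane -/

theorem integrableOn_rpow_mul_exp {β c : ℝ} (hβ : -1 < β) (hc : 0 < c) :
    IntegrableOn (fun s : ℝ => s ^ β * Real.exp (-c * s)) (Ioi 0) := by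
  simpa using integrableOn_rpow_mul_exp_neg_mul_rpow (p := 1) hβ one_pos hc

theorem norm_rpow_mul_cexp {β s : ℝ} (hs : 0 < s) (z : ℂ) :
    ‖((s ^ β : ℝ) : ℂ) * Complex.exp (-z * s)‖ = s ^ β * Real.exp (-z.re * s) := by
  rw [norm_mul, Complex.norm_real, Real.norm_of_nonneg (Real.rpow_nonneg hs.le _), Complex.norm_exp]
  simp

theorem integrable_rpow_mul_cexp {β : ℝ} (hβ : -1 < β) {z : ℂ} (hz : 0 < z.re) :
    Integrable (fun s : ℝ => ((s ^ β : ℝ) : ℂ) * Complex.exp (-z * s))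
      (volume.restrict (Ioi 0)) := by
  refine (integrableOn_rpow_mul_exp hβ hz).mono' (by fun_prop) ?_
  filter_upwards [ae_restrict_mem measurableSet_Ioi] with s hs
  exact (norm_rpow_mul_cexp hs z).le

theorem differentiableAt_laplace {β : ℝ} (hβ : -1 < β) {z : ℂ} (hz : 0 < z.re) :
    DifferentiableAt ℂ
      (fun z : ℂ => ∫ s in Ioi (0 : ℝ), ((s ^ β : ℝ) : ℂ) * Complex.exp (-z * s)) z := by
  have hU : {w : ℂ | z.re / 2 < w.re} ∈ 𝓝 z :=
    (isOpen_lt continuous_const Complex.continuous_re).mem_nhds (by simp; linarith)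
  refine (hasDerivAt_integral_of_dominated_loc_of_deriv_le (𝕜 := ℂ) hU
    (F' := fun w s => ((s ^ β : ℝ) : ℂ) * (Complex.exp (-w * s) * (-(s : ℂ))))
    (bound := fun s => s ^ (β + 1) * Real.exp (-(z.re / 2) * s)) (Eventually.of_forall fun w => by
      fun_prop) (integrable_rpow_mul_cexp hβ hz) (by fun_prop) ?_
    (integrableOn_rpow_mul_exp (by linarith) (by linarith)) ?_).2.differentiableAt
  · filter_upwards [ae_restrict_mem measurableSet_Ioi] with s hs w hw
    have hs : 0 < s := hs
    have hw : z.re / 2 < w.re := hw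
    rw [← mul_assoc, norm_mul, norm_rpow_mul_cexp hs, norm_neg, Complex.norm_real,
      Real.norm_of_nonneg hs.le, Real.rpow_add_one hs.ne', mul_right_comm]
    gcongr
  · refine Eventually.of_forall fun s w _ => ?_
    have h := ((hasDerivAt_id w).neg.mul_const (s : ℂ)).cexp
    simpa using h.const_mul ((s ^ β : ℝ) : ℂ)

/-- The Laplace transform of `s ^ (β - 1)` on the right half-plane. -/
theorem laplace_rpow {β : ℝ} (hβ : 0 < β) {z : ℂ} (hz : 0 < z.re) :
    ∫ s in Ioi (0 : ℝ), ((s ^ (β - 1) : ℝ) : ℂ) * Complex.exp (-z * s)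
      = Real.Gamma β * z ^ (-β : ℂ) := by
  set U : Set ℂ := {w | 0 < w.re} with hU
  have hUo : IsOpen U := isOpen_lt continuous_const Complex.continuous_re
  have hf : AnalyticOnNhd ℂ (fun z : ℂ => ∫ s in Ioi (0 : ℝ),
      ((s ^ (β - 1) : ℝ) : ℂ) * Complex.exp (-z * s)) U :=
    DifferentiableOn.analyticOnNhd (fun w hw =>
      (differentiableAt_laplace (by linarith) hw).differentiableWithinAt) hUo
  have hg : AnalyticOnNhd ℂ (fun z : ℂ => (Real.Gamma β : ℂ) * z ^ (-β : ℂ)) U := by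
    refine DifferentiableOn.analyticOnNhd (fun w hw => ?_) hUo
    exact ((differentiableAt_id.cpow_const (Or.inl hw)).const_mul _).differentiableWithinAt
  have hconn : IsPreconnected U := (convex_halfSpace_re_gt 0).isPreconnected
  -- Identity theorem: both sides are analytic on the connected half-plane, and on the positive real
  -- axis the formula is Euler's integral.
  refine hf.eqOn_of_preconnected_of_frequently_eq hg hconn (z₀ := 1) (by simp [hU]) ?_ hz
  have hT : Tendsto (fun r : ℝ => (r : ℂ)) (𝓝[≠] 1) (𝓝[≠] 1) := by
    refine tendsto_nhdsWithin_iff.2 ⟨?_, ?_⟩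
    · exact (Complex.continuous_ofReal.tendsto' 1 1 (by simp)).mono_left nhdsWithin_le_nhds
    · filter_upwards [self_mem_nhdsWithin] with r hr
      simpa using hr
  refine hT.frequently (Eventually.frequently ?_)
  filter_upwards [mem_nhdsWithin_of_mem_nhds (Ioi_mem_nhds (zero_lt_one (α := ℝ)))] with r hr
  have hr : 0 < r := hr
  have h := Complex.integral_cpow_mul_exp_neg_mul_Ioi (a := (β : ℂ)) (by simpa using hβ) hr
  have e : ∫ s in Ioi (0 : ℝ), ((s ^ (β - 1) : ℝ) : ℂ) * Complex.exp (-(r : ℂ) * s)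
      = ∫ t in Ioi (0 : ℝ), (t : ℂ) ^ ((β : ℂ) - 1) * Complex.exp (-(r * t)) := by
    refine setIntegral_congr_fun measurableSet_Ioi fun s hs => ?_
    have hs : 0 < s := hs
    rw [Complex.ofReal_cpow hs.le, neg_mul]
    push_cast
    rfl
  rw [e, h, Complex.Gamma_ofReal, mul_comm, one_div, Complex.inv_cpow _ _ (by
    rw [Complex.arg_ofReal_of_nonneg hr.le]; exact Real.pi_pos.ne), Complex.cpow_neg]

end FGLE

namespace FGLE

open MeasureTheory Set Filter Topology
open scoped FourierTransform

/-! ### Fourier representation of smooth compactly supported functions -/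

theorem iteratedDeriv_eq_zero_of_notMem {a b : ℝ} {f : ℝ → ℂ} (h0 : ∀ x, x ∉ Ioo a b → f x = 0)
    (n : ℕ) {x : ℝ} (hx : x ∉ Icc a b) : iteratedDeriv n f x = 0 := by
  have h : f =ᶠ[𝓝 x] fun _ => 0 := by
    filter_upwards [isClosed_Icc.isOpen_compl.mem_nhds hx] with y hy
    exact h0 y fun h => hy (Ioo_subset_Icc_self h)
  rw [h.iteratedDeriv_eq n]
  simp

theorem integrable_of_continuous_of_support {a b : ℝ} {g : ℝ → ℂ} (hg : Continuous g)
    (h0 : ∀ x, x ∉ Icc a b → g x = 0) : Integrable g :=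
  hg.integrable_of_hasCompactSupport (HasCompactSupport.intro isCompact_Icc h0)

theorem integral_norm_le_of_support {a b A : ℝ} (hab : a ≤ b) {g : ℝ → ℂ}
    (h0 : ∀ x, x ∉ Icc a b → g x = 0) (hA : ∀ x ∈ Ioo a b, ‖g x‖ ≤ A) :
    ∫ x, ‖g x‖ ≤ (b - a) * A := by
  have e : ∫ x, ‖g x‖ = ∫ x in Ioo a b, ‖g x‖ := by
    rw [← integral_Icc_eq_integral_Ioo, ← integral_indicator measurableSet_Icc]
    congr 1
    ext x
    by_cases hx : x ∈ Icc a b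
    · rw [indicator_of_mem hx]
    · rw [indicator_of_notMem hx, h0 x hx, norm_zero]
  rw [e]
  have := norm_setIntegral_le_of_norm_le_const (μ := volume) (s := Ioo a b) (C := A)
    (f := fun x => ‖g x‖) (by simp) (fun x hx => by simpa using hA x hx)
  rw [Real.norm_of_nonneg (integral_nonneg fun x => norm_nonneg _)] at this
  simpa [hab, mul_comm] using this

theorem norm_fourier_le (g : ℝ → ℂ) (ξ : ℝ) : ‖𝓕 g ξ‖ ≤ ∫ x, ‖g x‖ :=
  VectorFourier.norm_fourierIntegral_le_integral_norm _ _ _ _ _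

theorem continuous_fourier {g : ℝ → ℂ} (hg : Integrable g) : Continuous (𝓕 g) :=
  VectorFourier.fourierIntegral_continuous Real.continuous_fourierChar
    (by simp only [innerₗ_apply_apply]; exact continuous_inner) hg

/-- The character `x ↦ e^{ikx}`. -/
noncomputable def wave (k x : ℝ) : ℂ := Complex.exp ((k * x : ℝ) * Complex.I)

theorem norm_wave (k x : ℝ) : ‖wave k x‖ = 1 := Complex.norm_exp_ofReal_mul_I _

/-- A rapidly decaying frequency-side density with weight `B`. -/
structure HasDecay (B : ℝ) (F : ℝ → ℂ) : Prop where
  cont : Continuous F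
  bound : ∀ ξ, (1 + ξ ^ 2) * (1 + ξ ^ 4) * ‖F ξ‖ ≤ B

namespace HasDecay

variable {B : ℝ} {F : ℝ → ℂ}

/-- In the decay weight, 1 + ξ⁴ absorbs powers up to 4, which covers α + 2 ≤ 4, and 1 + ξ² is left
to make the integral converge. -/
theorem rpow_mul_le (hF : HasDecay B F) {p : ℝ} (hp : 0 ≤ p) (hp4 : p ≤ 4) (ξ : ℝ) :
    |ξ| ^ p * ‖F ξ‖ ≤ B * (1 + ξ ^ 2)⁻¹ := by
  have h1 : |ξ| ^ p ≤ 1 + ξ ^ 4 := by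
    rcases le_or_gt |ξ| 1 with h | h
    · have := Real.rpow_le_one (abs_nonneg ξ) h hp
      have : 0 ≤ ξ ^ 4 := by positivity
      linarith
    · have h2 := Real.rpow_le_rpow_of_exponent_le h.le hp4
      have h3 : |ξ| ^ (4 : ℝ) = ξ ^ 4 := by
        have : |ξ| ^ (4 : ℝ) = |ξ| ^ (4 : ℕ) := by exact_mod_cast Real.rpow_natCast |ξ| 4
        rw [this, Even.pow_abs (by decide)]
      linarith
  rw [← div_eq_mul_inv, le_div_iff₀ (by positivity)]
  calc |ξ| ^ p * ‖F ξ‖ * (1 + ξ ^ 2) ≤ (1 + ξ ^ 4) * ‖F ξ‖ * (1 + ξ ^ 2) := by gcongr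
    _ = (1 + ξ ^ 2) * (1 + ξ ^ 4) * ‖F ξ‖ := by ring
    _ ≤ B := hF.bound ξ

theorem integrable_rpow_mul (hF : HasDecay B F) {p : ℝ} (hp : 0 ≤ p) (hp4 : p ≤ 4) :
    Integrable fun ξ => |ξ| ^ p * ‖F ξ‖ := by
  have hF' := hF.cont
  refine (integrable_inv_one_add_sq.const_mul B).mono' (by fun_prop) ?_
  refine Eventually.of_forall fun ξ => ?_
  rw [Real.norm_of_nonneg (by positivity)]
  exact hF.rpow_mul_le hp hp4 ξ

theorem integral_rpow_mul_le (hF : HasDecay B F) {p : ℝ} (hp : 0 ≤ p) (hp4 : p ≤ 4) :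
    ∫ ξ, |ξ| ^ p * ‖F ξ‖ ≤ B * Real.pi := by
  rw [← integral_univ_inv_one_add_sq, ← integral_const_mul]
  exact integral_mono (hF.integrable_rpow_mul hp hp4) (integrable_inv_one_add_sq.const_mul B)
    fun ξ => hF.rpow_mul_le hp hp4 ξ

theorem integrable (hF : HasDecay B F) : Integrable F := by
  have := hF.integrable_rpow_mul le_rfl (by norm_num)
  simp only [Real.rpow_zero, one_mul] at this
  exact (integrable_norm_iff hF.cont.aestronglyMeasurable).1 this

end HasDecay

theorem abs_le_norm_two_pi (ξ : ℝ) : |ξ| ≤ ‖(2 * Real.pi * Complex.I * ξ : ℂ)‖ := by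
  rw [norm_mul, norm_mul, norm_mul, Complex.norm_I, Complex.norm_real, Complex.norm_real,
    Real.norm_eq_abs, Real.norm_eq_abs, abs_of_pos Real.pi_pos]
  have := Real.pi_gt_three
  simp only [Complex.norm_ofNat, mul_one]
  nlinarith [abs_nonneg ξ]

/-- Smooth functions supported in `[a, b]`, in terms of their Fourier transform. -/
theorem exists_fourier_repr {a b A : ℝ} (hab : a ≤ b) {f : ℝ → ℂ} (hf : ContDiff ℝ ∞ f)
    (h0 : ∀ x, x ∉ Ioo a b → f x = 0)
    (hA : ∀ n ≤ 6, ∀ x ∈ Ioo a b, ‖iteratedDeriv n f x‖ ≤ A) :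
    ∃ F : ℝ → ℂ, HasDecay (4 * ((b - a) * A)) F ∧
      (∀ x, f x = ∫ ξ, F ξ * wave (2 * Real.pi * ξ) x) ∧
      ∀ x, iteratedDeriv 2 f x
        = ∫ ξ, (2 * Real.pi * Complex.I * ξ) ^ 2 * F ξ * wave (2 * Real.pi * ξ) x := by
  have hc : ∀ n, Continuous (iteratedDeriv n f) := fun n => hf.continuous_iteratedDeriv n (by
    exact_mod_cast le_top)
  have hs : ∀ n x, x ∉ Icc a b → iteratedDeriv n f x = 0 := fun n x hx =>
    iteratedDeriv_eq_zero_of_notMem h0 n hx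
  have hi : ∀ n, Integrable (iteratedDeriv n f) := fun n =>
    integrable_of_continuous_of_support (hc n) (hs n)
  have hF : ∀ n, 𝓕 (iteratedDeriv n f) = fun x : ℝ => (2 * Real.pi * Complex.I * x) ^ n • 𝓕 f x :=
    fun n => Real.fourier_iteratedDeriv (N := ⊤) hf (fun n _ => hi n) le_top
  have hi0 : Integrable f := by simpa using hi 0
  have hb : ∀ n ≤ 6, ∀ ξ : ℝ, |ξ| ^ n * ‖𝓕 f ξ‖ ≤ (b - a) * A := by
    intro n hn ξ
    have h1 := (norm_fourier_le (iteratedDeriv n f) ξ).trans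
      (integral_norm_le_of_support hab (hs n) (hA n hn))
    rw [hF n, norm_smul, norm_pow] at h1
    refine le_trans ?_ h1
    gcongr
    exact abs_le_norm_two_pi ξ
  have hdec : HasDecay (4 * ((b - a) * A)) (𝓕 f) := by
    refine ⟨continuous_fourier hi0, fun ξ => ?_⟩
    -- The weight expands to 1 + ξ² + ξ⁴ + ξ⁶: hence six derivatives, and the factor 4 in the bound.
    have e2 := hb 2 (by norm_num) ξ
    have e4 := hb 4 (by norm_num) ξ
    have e6 := hb 6 (by norm_num) ξ
    have e0 := hb 0 (by norm_num) ξ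
    rw [Even.pow_abs (by decide)] at e2 e4 e6
    rw [pow_zero] at e0
    linarith
  have hrepr : ∀ g : ℝ → ℂ, Continuous g → Integrable g → Integrable (𝓕 g) →
      ∀ x, g x = ∫ ξ, 𝓕 g ξ * wave (2 * Real.pi * ξ) x := by
    intro g hg hgi hFi x
    conv_lhs => rw [← hg.fourierInv_fourier_eq hgi hFi]
    rw [Real.fourierInv_eq']
    refine integral_congr_ae (Eventually.of_forall fun ξ => ?_)
    simp only [smul_eq_mul, wave]
    rw [mul_comm]
    congr 4
    simp only [RCLike.inner_apply, conj_trivial]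
    ring
  refine ⟨𝓕 f, hdec, hrepr f hf.continuous hi0 hdec.integrable, fun x => ?_⟩
  have hF2i : Integrable (𝓕 (iteratedDeriv 2 f)) := by
    have h4 := (hdec.integrable_rpow_mul (p := 2) (by norm_num) (by norm_num)).const_mul
      ((2 * Real.pi) ^ 2)
    refine h4.mono' (continuous_fourier (hi 2)).aestronglyMeasurable
      (Eventually.of_forall fun ξ => ?_)
    rw [hF 2, norm_smul, norm_pow]
    have : |ξ| ^ (2 : ℝ) = |ξ| ^ 2 := by exact_mod_cast Real.rpow_natCast |ξ| 2
    rw [this, norm_mul, norm_mul, norm_mul, Complex.norm_I, Complex.norm_real, Complex.norm_real,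
      Real.norm_eq_abs, Real.norm_eq_abs, abs_of_pos Real.pi_pos]
    simp only [Complex.norm_ofNat, mul_one]
    apply le_of_eq
    ring
  rw [hrepr _ (hc 2) (hi 2) hF2i x, hF 2]
  simp only [smul_eq_mul]

end FGLE

namespace FGLE

open MeasureTheory Set Filter Topology

/-! ### Fourier representation of the Riemann–Liouville derivative -/

theorem wave_sub (k x s : ℝ) : wave k (x - s) = wave k x * Complex.exp (-(k * Complex.I) * s) := by
  rw [wave, wave, ← Complex.exp_add]
  congr 1
  push_cast
  ring

theorem continuous_wave_two_pi (x : ℝ) : Continuous fun ξ : ℝ => wave (2 * Real.pi * ξ) x := by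
  unfold wave; fun_prop

theorem rpow_add_cpow {α : ℝ} {w : ℂ} (hα : 0 < α) :
    w ^ 2 * w ^ (-(2 - α : ℝ) : ℂ) = w ^ (α : ℂ) := by
  rcases eq_or_ne w 0 with rfl | hw
  · rw [Complex.zero_cpow (x := (α : ℂ)) (by exact_mod_cast hα.ne')]; simp
  · rw [← Complex.cpow_natCast, ← Complex.cpow_add _ _ hw]
    congr 1
    push_cast
    ring

theorem norm_two_pi_mul (ξ : ℝ) : ‖(2 * Real.pi * Complex.I * ξ : ℂ)‖ = 2 * Real.pi * |ξ| := by
  rw [norm_mul, norm_mul, norm_mul, Complex.norm_I, Complex.norm_real, Complex.norm_real,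
    Real.norm_eq_abs, Real.norm_eq_abs, abs_of_pos Real.pi_pos]
  simp

/-- Fubini for the regularised fractional integral. -/
theorem regularised_rlIntegral {α B x ε : ℝ} (hα : α < 2) (hε : 0 < ε) {F g : ℝ → ℂ}
    (hF : HasDecay B F)
    (hg : ∀ x, g x = ∫ ξ, (2 * Real.pi * Complex.I * ξ) ^ 2 * F ξ * wave (2 * Real.pi * ξ) x) :
    ∫ s in Ioi (0 : ℝ), g (x - s) / ((s ^ (α - 1) : ℝ) : ℂ) * Complex.exp (-(ε : ℂ) * s)
      = ∫ ξ : ℝ, (2 * Real.pi * Complex.I * ξ) ^ 2 * F ξ * wave (2 * Real.pi * ξ) x *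
        (Real.Gamma (2 - α) * (ε + 2 * Real.pi * Complex.I * ξ) ^ (-(2 - α : ℝ) : ℂ)) := by
  have hFc := hF.cont
  set m : ℝ → ℂ := fun ξ => (2 * Real.pi * Complex.I * ξ) ^ 2 * F ξ with hm
  set k : ℝ → ℂ := fun s => ((s ^ (2 - α - 1) : ℝ) : ℂ) * Complex.exp (-(ε : ℂ) * s) with hk
  have hmi : Integrable m := by
    refine ((hF.integrable_rpow_mul (p := 2) (by norm_num) (by norm_num)).const_mul
      ((2 * Real.pi) ^ 2)).mono' (by fun_prop) (Eventually.of_forall fun ξ => ?_)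
    have : |ξ| ^ (2 : ℝ) = |ξ| ^ 2 := by exact_mod_cast Real.rpow_natCast |ξ| 2
    rw [hm, this, norm_mul, norm_pow, norm_two_pi_mul]
    apply le_of_eq
    ring
  have hki : Integrable k (volume.restrict (Ioi 0)) :=
    integrable_rpow_mul_cexp (by linarith) (by simpa using hε)
  -- The damping factor is what permits Fubini: s^(1-α) alone is not integrable at infinity.
  have hprod : Integrable (Function.uncurry fun s ξ : ℝ =>
      k s * m ξ * wave (2 * Real.pi * ξ) (x - s)) ((volume.restrict (Ioi 0)).prod volume) := by
    refine Integrable.mul_bdd (c := 1) (hki.mul_prod hmi) ?_ (Eventually.of_forall fun p => ?_)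
    · have : Continuous fun p : ℝ × ℝ => wave (2 * Real.pi * p.2) (x - p.1) := by
        unfold wave; fun_prop
      exact this.aestronglyMeasurable
    · exact (norm_wave _ _).le
  have h1 : ∫ s in Ioi (0 : ℝ), g (x - s) / ((s ^ (α - 1) : ℝ) : ℂ) * Complex.exp (-(ε : ℂ) * s)
      = ∫ s in Ioi (0 : ℝ), ∫ ξ, k s * m ξ * wave (2 * Real.pi * ξ) (x - s) := by
    refine setIntegral_congr_fun measurableSet_Ioi fun s hs => ?_
    have hs : 0 < s := hs
    simp only [mul_assoc (k s)]
    rw [integral_const_mul, ← hg, hk, div_eq_mul_inv, ← Complex.ofReal_inv, ← Real.rpow_neg hs.le,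
      show -(α - 1) = 2 - α - 1 by ring]
    ring
  rw [h1, integral_integral_swap hprod]
  refine integral_congr_ae (Eventually.of_forall fun ξ => ?_)
  simp only
  have h2 := laplace_rpow (β := 2 - α) (by linarith) (z := ε + 2 * Real.pi * Complex.I * ξ)
    (by simpa using hε)
  rw [← h2, ← integral_const_mul]
  refine integral_congr_ae (Eventually.of_forall fun s => ?_)
  simp only [hk, hm]
  rw [wave_sub, neg_add, add_mul, Complex.exp_add]
  have : -((2 * Real.pi * ξ : ℝ) * Complex.I : ℂ) * s = -(2 * Real.pi * Complex.I * ξ) * s := by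
    push_cast; ring
  rw [this]
  ring

/-- Damp the kernel by e^(-εs), exchange the integrals, evaluate the inner one as a Laplace
transform, and let ε tend to 0 on both sides by dominated convergence. -/
theorem rlIntegral_fourier {α a B C x : ℝ} (h₁ : 1 < α) (hα : α < 2) {F g : ℝ → ℂ}
    (hF : HasDecay B F)
    (hg : ∀ x, g x = ∫ ξ, (2 * Real.pi * Complex.I * ξ) ^ 2 * F ξ * wave (2 * Real.pi * ξ) x)
    (hgc : Continuous g) (hgb : ∀ y, ‖g y‖ ≤ C) (h0 : ∀ y, y < a → g y = 0) :
    rlIntegral α g x = Real.Gamma (2 - α) *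
      ∫ ξ : ℝ, (2 * Real.pi * Complex.I * ξ) ^ (α : ℂ) * F ξ * wave (2 * Real.pi * ξ) x := by
  have hFc := hF.cont
  have hwc := continuous_wave_two_pi x
  have hL : Tendsto (fun ε : ℝ => ∫ s in Ioi (0 : ℝ),
      g (x - s) / ((s ^ (α - 1) : ℝ) : ℂ) * Complex.exp (-(ε : ℂ) * s)) (𝓝[>] 0)
      (𝓝 (rlIntegral α g x)) := by
    have hi := integrable_div_kernel (a := a) (x := x) hα hgc.aestronglyMeasurable
      (fun y _ => hgb y) h0
    refine tendsto_integral_filter_of_dominated_convergence _ (Eventually.of_forall fun ε => ?_) ?_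
      hi.norm (Eventually.of_forall fun s => ?_)
    · exact hi.aestronglyMeasurable.mul (by fun_prop)
    · filter_upwards [self_mem_nhdsWithin] with ε hε
      filter_upwards [ae_restrict_mem measurableSet_Ioi] with s hs
      have hε : 0 < ε := hε
      have hs : 0 < s := hs
      rw [norm_mul]
      refine mul_le_of_le_one_right (norm_nonneg _) ?_
      rw [Complex.norm_exp, Real.exp_le_one_iff]
      simp
      positivity
    · have : Continuous fun ε : ℝ =>
          g (x - s) / ((s ^ (α - 1) : ℝ) : ℂ) * Complex.exp (-(ε : ℂ) * s) := by fun_prop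
      refine (this.tendsto' 0 _ ?_).mono_left nhdsWithin_le_nhds
      simp
  have hR : Tendsto (fun ε : ℝ => ∫ ξ : ℝ,
      (2 * Real.pi * Complex.I * ξ) ^ 2 * F ξ * wave (2 * Real.pi * ξ) x *
        (Real.Gamma (2 - α) * (ε + 2 * Real.pi * Complex.I * ξ) ^ (-(2 - α : ℝ) : ℂ))) (𝓝[>] 0)
      (𝓝 (∫ ξ : ℝ, (2 * Real.pi * Complex.I * ξ) ^ 2 * F ξ * wave (2 * Real.pi * ξ) x *
        (Real.Gamma (2 - α) * (2 * Real.pi * Complex.I * ξ) ^ (-(2 - α : ℝ) : ℂ)))) := by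
    have hae : ∀ᵐ ξ : ℝ, ξ ≠ 0 := by simp [ae_iff]
    -- The exponent -(2-α) is negative and |ε + 2πiξ| ≥ 2π|ξ|, so the bound does not depend on ε.
    refine tendsto_integral_filter_of_dominated_convergence
      (fun ξ => (2 * Real.pi) ^ α * |Real.Gamma (2 - α)| * (|ξ| ^ α * ‖F ξ‖)) ?_ ?_
      ((hF.integrable_rpow_mul (by linarith) (by linarith)).const_mul _) ?_
    · exact Eventually.of_forall fun ε => by
        refine AEStronglyMeasurable.mul (by fun_prop) (Measurable.aestronglyMeasurable ?_)
        fun_prop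
    · filter_upwards [self_mem_nhdsWithin] with ε hε
      filter_upwards [hae] with ξ hξ
      have hε : 0 < ε := hε
      have hξ' : 0 < |ξ| := abs_pos.2 hξ
      have hpi := Real.pi_pos
      rw [norm_mul, norm_mul, norm_mul, norm_mul, norm_wave, norm_pow, norm_two_pi_mul,
        ← Complex.ofReal_neg, Complex.norm_cpow_real, Complex.norm_real, Real.norm_eq_abs, mul_one]
      have h1 : 2 * Real.pi * |ξ| ≤ ‖(ε + 2 * Real.pi * Complex.I * ξ : ℂ)‖ := by
        have := Complex.abs_im_le_norm (ε + 2 * Real.pi * Complex.I * ξ : ℂ)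
        simpa [abs_mul, abs_of_pos hpi] using this
      have h2 : ‖(ε + 2 * Real.pi * Complex.I * ξ : ℂ)‖ ^ (-(2 - α)) ≤
          (2 * Real.pi * |ξ|) ^ (-(2 - α)) :=
        Real.rpow_le_rpow_of_nonpos (by positivity) h1 (by linarith)
      have h3 : (2 * Real.pi * |ξ|) ^ 2 * (2 * Real.pi * |ξ|) ^ (-(2 - α))
          = (2 * Real.pi) ^ α * |ξ| ^ α := by
        rw [← Real.mul_rpow (by positivity) (by positivity), ← Real.rpow_natCast,
          ← Real.rpow_add (by positivity)]
        congr 1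
        push_cast
        ring
      calc _ ≤ (2 * Real.pi * |ξ|) ^ 2 * ‖F ξ‖ *
            (|Real.Gamma (2 - α)| * (2 * Real.pi * |ξ|) ^ (-(2 - α))) := by gcongr
        _ = ((2 * Real.pi * |ξ|) ^ 2 * (2 * Real.pi * |ξ|) ^ (-(2 - α))) *
            |Real.Gamma (2 - α)| * ‖F ξ‖ := by ring
        _ = _ := by rw [h3]; ring
    · filter_upwards [hae] with ξ hξ
      refine Tendsto.const_mul _ (Tendsto.const_mul _ ?_)
      have hw : ContinuousAt (fun z : ℂ => z ^ (-(2 - α : ℝ) : ℂ)) (2 * Real.pi * Complex.I * ξ) := by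
        refine continuousAt_cpow_const (Or.inr ?_)
        simpa [Real.pi_ne_zero] using hξ
      refine (hw.tendsto.comp ?_)
      refine ((by fun_prop : Continuous fun ε : ℝ => (ε + 2 * Real.pi * Complex.I * ξ : ℂ)).tendsto'
        0 _ (by simp)).mono_left nhdsWithin_le_nhds
  have hEq : (fun ε : ℝ => ∫ s in Ioi (0 : ℝ),
      g (x - s) / ((s ^ (α - 1) : ℝ) : ℂ) * Complex.exp (-(ε : ℂ) * s)) =ᶠ[𝓝[>] 0]
      fun ε : ℝ => ∫ ξ : ℝ,
      (2 * Real.pi * Complex.I * ξ) ^ 2 * F ξ * wave (2 * Real.pi * ξ) x *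
        (Real.Gamma (2 - α) * (ε + 2 * Real.pi * Complex.I * ξ) ^ (-(2 - α : ℝ) : ℂ)) := by
    filter_upwards [self_mem_nhdsWithin] with ε hε
    exact regularised_rlIntegral hα hε hF hg
  rw [tendsto_nhds_unique (hL.congr' hEq) hR, ← integral_const_mul]
  refine integral_congr_ae (Eventually.of_forall fun ξ => ?_)
  simp only
  rw [← rpow_add_cpow (α := α) (by linarith)]
  ring

end FGLE

namespace FGLE

open MeasureTheory Set Filter Topology

/-! ### Second-order consistency of the Grünwald operator -/

theorem leftRL_fourier {α a b B : ℝ} (h₁ : 1 < α) (hα : α < 2) {f F : ℝ → ℂ}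
    (hf : ContDiff ℝ ∞ f) (h0 : ∀ x, x ∉ Ioo a b → f x = 0) (hF : HasDecay B F)
    (hg : ∀ x, iteratedDeriv 2 f x
      = ∫ ξ, (2 * Real.pi * Complex.I * ξ) ^ 2 * F ξ * wave (2 * Real.pi * ξ) x) (x : ℝ) :
    leftRL α f x
      = ∫ ξ : ℝ, (2 * Real.pi * Complex.I * ξ) ^ (α : ℂ) * F ξ * wave (2 * Real.pi * ξ) x := by
  have hc : ∀ n, Continuous (iteratedDeriv n f) := fun n => hf.continuous_iteratedDeriv n (by
    exact_mod_cast le_top)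
  have hs : ∀ n x, x ∉ Icc a b → iteratedDeriv n f x = 0 := fun n x hx =>
    iteratedDeriv_eq_zero_of_notMem h0 n hx
  have hbd : ∀ n, ∃ C, ∀ x, ‖iteratedDeriv n f x‖ ≤ C := fun n =>
    (hc n).bounded_above_of_compact_support (HasCompactSupport.intro isCompact_Icc (hs n))
  have hd : ∀ n, Differentiable ℝ (iteratedDeriv n f) := fun n =>
    hf.differentiable_iteratedDeriv n (by exact_mod_cast WithTop.coe_lt_top _)
  have key : ∀ n, deriv (rlIntegral α (iteratedDeriv n f)) = rlIntegral α (iteratedDeriv (n + 1) f) := by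
    intro n
    ext y
    obtain ⟨C, hC⟩ := hbd (n + 1)
    have hC0 : 0 ≤ C := (norm_nonneg _).trans (hC 0)
    have hl : LipschitzWith ⟨C, hC0⟩ (iteratedDeriv n f) :=
      lipschitzWith_of_nnnorm_deriv_le (hd n) fun x => by
        rw [← iteratedDeriv_succ]; exact hC x
    -- The derivatives are known to vanish off the closed interval, so a point strictly left of a is
    -- used.
    refine (hasDerivAt_rlIntegral hα hl (a := a - 1) (fun z hz => hs n z fun h => ?_)
      (S := ∅) countable_empty (fun z _ => ?_) y).deriv
    · linarith [h.1]
    · rw [iteratedDeriv_succ]; exact (hd n z).hasDerivAt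
  obtain ⟨C, hC⟩ := hbd 2
  have e : deriv (deriv (rlIntegral α f)) = rlIntegral α (iteratedDeriv 2 f) := by
    rw [← key 1, ← key 0, iteratedDeriv_zero]
  rw [leftRL_eq hα.ne, e, rlIntegral_fourier (a := a) h₁ hα hF hg (hc 2) hC
    (fun y hy => hs 2 y fun h => by linarith [h.1]), ← mul_assoc, ← Complex.ofReal_mul,
    one_div_mul_cancel (Real.Gamma_pos_of_pos (by linarith)).ne', Complex.ofReal_one, one_mul]

/-- The left shifted Grünwald sum in terms of the Fourier transform. -/
theorem hasSum_grunwald_fourier {α B h : ℝ} (h₁ : 1 ≤ α) (hα : α ≤ 2) {f F : ℝ → ℂ}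
    (hF : HasDecay B F) (hf : ∀ x, f x = ∫ ξ, F ξ * wave (2 * Real.pi * ξ) x) (x : ℝ) :
    HasSum (fun l : ℕ => (weight α l : ℂ) * f (x - (l - 1) * h))
      (∫ ξ : ℝ, (1 - Complex.exp (-((2 * Real.pi * ξ * h : ℝ) * Complex.I))) ^ (α : ℂ)
        * shiftFactor α ((2 * Real.pi * ξ * h : ℝ) * Complex.I)
        * F ξ * wave (2 * Real.pi * ξ) x) := by
  have hnorm : ∀ (l : ℕ) (ξ : ℝ), ‖(weight α l : ℂ) * (F ξ * wave (2 * Real.pi * ξ) (x - (l - 1) * h))‖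
      = ‖weight α l‖ * ‖F ξ‖ := fun l ξ => by
    rw [norm_mul, norm_mul, norm_wave, mul_one, Complex.norm_real]
  have hi : ∀ l : ℕ, Integrable fun ξ =>
      (weight α l : ℂ) * (F ξ * wave (2 * Real.pi * ξ) (x - (l - 1) * h)) := fun l =>
    (hF.integrable.mul_bdd (c := 1) (continuous_wave_two_pi _).aestronglyMeasurable
      (Eventually.of_forall fun ξ => (norm_wave _ _).le)).const_mul _
  have hsum := hasSum_integral_of_summable_integral_norm hi (by
    simp only [hnorm, integral_const_mul]
    exact (summable_weight h₁ hα).mul_right _)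
  simp only [integral_const_mul, ← hf] at hsum
  suffices e0 : ∀ ξ : ℝ, (1 - Complex.exp (-((2 * Real.pi * ξ * h : ℝ) * Complex.I))) ^ (α : ℂ)
      * shiftFactor α ((2 * Real.pi * ξ * h : ℝ) * Complex.I) * F ξ * wave (2 * Real.pi * ξ) x
      = ∑' l : ℕ, (weight α l : ℂ) * (F ξ * wave (2 * Real.pi * ξ) (x - (l - 1) * h)) by
    simpa only [e0] using hsum
  intro ξ
  set θ : ℝ := 2 * Real.pi * ξ * h with hθ
  have hz : ‖Complex.exp (-(θ * Complex.I))‖ ≤ 1 := (norm_exp_mul_I_neg θ).le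
  have hw := ((hasSum_weight h₁ hα hz).mul_left
    (Complex.exp (θ * Complex.I) * (F ξ * wave (2 * Real.pi * ξ) x))).tsum_eq
  have e : ∀ l : ℕ, (weight α l : ℂ) * (F ξ * wave (2 * Real.pi * ξ) (x - (l - 1) * h))
      = Complex.exp (θ * Complex.I) * (F ξ * wave (2 * Real.pi * ξ) x)
        * ((weight α l : ℂ) * Complex.exp (-(θ * Complex.I)) ^ l) := by
    intro l
    -- The shift by one node contributes e^(iθ), which turns λ₁ + λ₀z + λ₋₁z² at z = e^(-iθ) into
    -- `shiftFactor`.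
    have : Complex.exp (-((2 * Real.pi * ξ : ℝ) * Complex.I) * ((l - 1) * h : ℝ))
        = Complex.exp (θ * Complex.I) * Complex.exp (-(θ * Complex.I)) ^ l := by
      rw [← Complex.exp_nat_mul, ← Complex.exp_add, hθ]
      congr 1
      push_cast
      ring
    rw [wave_sub, this]
    ring
  simp only [e]
  rw [hw, shiftFactor]
  have e1 : Complex.exp (θ * Complex.I) * Complex.exp (-(θ * Complex.I)) = 1 := by
    rw [← Complex.exp_add]; simp
  linear_combination (F ξ * wave (2 * Real.pi * ξ) x *
    (1 - Complex.exp (-(θ * Complex.I))) ^ (α : ℂ)) *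
    (-lamZero α - lamNegOne α * Complex.exp (-(θ * Complex.I))) * e1

/-- The error is a Fourier multiplier controlled by `exists_symbol_bound`. The constant depends on f
only through `A`, so along the solution it is uniform in time. -/
theorem exists_leftRL_consistency {α a b : ℝ} (h₁ : 1 < α) (hα : α < 2) (hab : a < b) :
    ∃ C : ℝ, 0 ≤ C ∧ ∀ f : ℝ → ℂ, ContDiff ℝ ∞ f → (∀ x, x ∉ Ioo a b → f x = 0) → ∀ A : ℝ,
      (∀ n ≤ 6, ∀ x ∈ Ioo a b, ‖iteratedDeriv n f x‖ ≤ A) → ∀ h : ℝ, 0 < h → ∀ x : ℝ,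
        ‖((1 / h ^ α : ℝ) : ℂ) * ∑' l : ℕ, (weight α l : ℂ) * f (x - (l - 1) * h)
          - leftRL α f x‖ ≤ C * A * h ^ 2 := by
  obtain ⟨C, hC0, hC⟩ := exists_symbol_bound h₁.le
  have hpi := Real.pi_pos
  have hba : 0 < b - a := by linarith
  refine ⟨C * (2 * Real.pi) ^ (α + 2) * (4 * (b - a) * Real.pi), by positivity,
    fun f hf h0 A hA h hh x => ?_⟩
  obtain ⟨F, hF, hr, hr2⟩ := exists_fourier_repr hab.le hf h0 hA
  rw [(hasSum_grunwald_fourier h₁.le hα.le hF hr x).tsum_eq,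
    leftRL_fourier h₁ hα hf h0 hF hr2]
  set σ : ℝ → ℂ := fun ξ => (1 - Complex.exp (-((2 * Real.pi * ξ * h : ℝ) * Complex.I))) ^ (α : ℂ)
        * shiftFactor α ((2 * Real.pi * ξ * h : ℝ) * Complex.I) with hσ
  -- Scaling: h^(-α) |2πξh|^(α+2) = h² |2πξ|^(α+2).
  have hpt : ∀ ξ : ℝ, ‖((1 / h ^ α : ℝ) : ℂ) * σ ξ - (2 * Real.pi * Complex.I * ξ) ^ (α : ℂ)‖
      ≤ C * (2 * Real.pi) ^ (α + 2) * h ^ 2 * |ξ| ^ (α + 2) := by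
    intro ξ
    have e : ((2 * Real.pi * ξ * h : ℝ) * Complex.I : ℂ) ^ (α : ℂ)
        = (2 * Real.pi * Complex.I * ξ) ^ (α : ℂ) * ((h ^ α : ℝ) : ℂ) := by
      rw [Complex.ofReal_cpow hh.le, ← mul_cpow_of_re_nonneg (by simp) (by simpa using hh)]
      congr 1
      push_cast
      ring
    have hh' : (0 : ℝ) < h ^ α := by positivity
    have e2 : ((1 / h ^ α : ℝ) : ℂ) * σ ξ - (2 * Real.pi * Complex.I * ξ) ^ (α : ℂ)
        = ((1 / h ^ α : ℝ) : ℂ) * (σ ξ - ((2 * Real.pi * ξ * h : ℝ) * Complex.I : ℂ) ^ (α : ℂ)) := by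
      have : ((h ^ α : ℝ) : ℂ) ≠ 0 := by exact_mod_cast hh'.ne'
      rw [e]
      push_cast at this ⊢
      field_simp
    rw [e2, norm_mul, Complex.norm_real, Real.norm_of_nonneg (by positivity)]
    refine (mul_le_mul_of_nonneg_left (hC _) (by positivity)).trans (le_of_eq ?_)
    rw [abs_mul, abs_mul, abs_of_pos (by positivity : 0 < 2 * Real.pi), abs_of_pos hh,
      Real.mul_rpow (by positivity) hh.le, Real.mul_rpow (by positivity) (abs_nonneg _),
      Real.rpow_add hh]
    norm_num
    field_simp
  have i0 : Integrable fun ξ => |ξ| ^ (α + 2) * ‖F ξ‖ :=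
    hF.integrable_rpow_mul (by linarith) (by linarith)
  have hFc := hF.cont
  have i1 : Integrable fun ξ : ℝ => (2 * Real.pi * Complex.I * ξ) ^ (α : ℂ) * F ξ
      * wave (2 * Real.pi * ξ) x := by
    refine ((hF.integrable_rpow_mul (p := α) (by linarith) (by linarith)).const_mul
      ((2 * Real.pi) ^ α)).mono' ?_ (Eventually.of_forall fun ξ => ?_)
    · exact (AEStronglyMeasurable.mul (Measurable.aestronglyMeasurable (by fun_prop))
        (by fun_prop)).mul (continuous_wave_two_pi x).aestronglyMeasurable
    · rw [norm_mul, norm_mul, norm_wave, Complex.norm_cpow_real, norm_two_pi_mul,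
        Real.mul_rpow (by positivity) (abs_nonneg _), mul_one, mul_assoc]
  have i2 : Integrable fun ξ : ℝ =>
      (((1 / h ^ α : ℝ) : ℂ) * σ ξ - (2 * Real.pi * Complex.I * ξ) ^ (α : ℂ)) * F ξ
      * wave (2 * Real.pi * ξ) x := by
    refine (i0.const_mul (C * (2 * Real.pi) ^ (α + 2) * h ^ 2)).mono' ?_
      (Eventually.of_forall fun ξ => ?_)
    · refine (AEStronglyMeasurable.mul (Measurable.aestronglyMeasurable ?_)
        (by fun_prop)).mul (continuous_wave_two_pi x).aestronglyMeasurable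
      unfold shiftFactor at hσ
      rw [hσ]
      fun_prop
    · have := mul_le_mul_of_nonneg_right (hpt ξ) (norm_nonneg (F ξ))
      rw [norm_mul, norm_mul, norm_wave, mul_one]
      exact this.trans_eq (mul_assoc _ _ _)
  have e3 : ((1 / h ^ α : ℝ) : ℂ) * ∫ ξ : ℝ, σ ξ * F ξ * wave (2 * Real.pi * ξ) x
      = (∫ ξ : ℝ, (((1 / h ^ α : ℝ) : ℂ) * σ ξ - (2 * Real.pi * Complex.I * ξ) ^ (α : ℂ)) * F ξ
        * wave (2 * Real.pi * ξ) x)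
        + ∫ ξ : ℝ, (2 * Real.pi * Complex.I * ξ) ^ (α : ℂ) * F ξ * wave (2 * Real.pi * ξ) x := by
    rw [← integral_const_mul, ← integral_add i2 i1]
    refine integral_congr_ae (Eventually.of_forall fun ξ => ?_)
    simp only
    ring
  show ‖((1 / h ^ α : ℝ) : ℂ) * (∫ ξ : ℝ, σ ξ * F ξ * wave (2 * Real.pi * ξ) x) - _‖ ≤ _
  rw [e3, add_sub_cancel_right]
  calc _ ≤ ∫ ξ, C * (2 * Real.pi) ^ (α + 2) * h ^ 2 * (|ξ| ^ (α + 2) * ‖F ξ‖) := by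
        refine norm_integral_le_of_norm_le (i0.const_mul _) (Eventually.of_forall fun ξ => ?_)
        have := mul_le_mul_of_nonneg_right (hpt ξ) (norm_nonneg (F ξ))
        rw [norm_mul, norm_mul, norm_wave, mul_one]
        exact this.trans_eq (mul_assoc _ _ _)
    _ ≤ C * (2 * Real.pi) ^ (α + 2) * h ^ 2 * (4 * ((b - a) * A) * Real.pi) := by
        rw [integral_const_mul]
        exact mul_le_mul_of_nonneg_left
          (hF.integral_rpow_mul_le (by linarith) (by linarith)) (by positivity)
    _ = _ := by ring

end FGLE

/-! ### Consistency of the two-sided operator on the grid. -/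

namespace FGLE

open MeasureTheory Set Filter Topology

/-- Beyond the finite range the nodes lie left of a, where f vanishes, so truncating the series
costs nothing. -/
theorem sum_range_eq_tsum_left {α : ℝ} {a b h : ℝ} (hh : 0 < h) {f : ℝ → ℂ}
    (h0 : ∀ x, x ∉ Ioo a b → f x = 0) (j : ℕ) :
    ∑ l ∈ Finset.range (j + 2), (weight α l : ℂ) * f (a + ((j : ℤ) - l + 1 : ℤ) * h)
      = ∑' l : ℕ, (weight α l : ℂ) * f (a + j * h - (l - 1) * h) := by
  rw [tsum_eq_sum (s := Finset.range (j + 2))]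
  · refine Finset.sum_congr rfl fun l _ => ?_
    congr 2
    push_cast
    ring
  · intro l hl
    rw [Finset.mem_range, not_lt] at hl
    have hl' : (j : ℝ) + 2 ≤ l := by exact_mod_cast hl
    rw [h0 _ fun hx => ?_, mul_zero]
    have := hx.1
    nlinarith

theorem sum_range_eq_tsum_right {α : ℝ} {a b h : ℝ} (hh : 0 < h) {f : ℝ → ℂ}
    (h0 : ∀ x, x ∉ Ioo a b → f x = 0) {j M : ℕ} (hj : j ≤ M) (hM : a + M * h = b) :
    ∑ l ∈ Finset.range (M - j + 2), (weight α l : ℂ) * f (a + ((j : ℤ) + l - 1 : ℤ) * h)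
      = ∑' l : ℕ, (weight α l : ℂ) * f (-(-(a + j * h) - (l - 1) * h)) := by
  rw [tsum_eq_sum (s := Finset.range (M - j + 2))]
  · refine Finset.sum_congr rfl fun l _ => ?_
    congr 2
    push_cast
    ring
  · intro l hl
    rw [Finset.mem_range, not_lt] at hl
    have hl' : (M : ℝ) + 2 ≤ l + j := by exact_mod_cast (by omega : M + 2 ≤ l + j)
    rw [h0 _ fun hx => ?_, mul_zero]
    have := hx.2
    nlinarith

theorem exists_consistency_of_lt_two {α a b : ℝ} (h₁ : 1 < α) (hα : α < 2) (hab : a < b) :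
    ∃ C : ℝ, 0 ≤ C ∧ ∀ f : ℝ → ℂ, ContDiff ℝ ∞ f → (∀ x, x ∉ Ioo a b → f x = 0) → ∀ A : ℝ,
      (∀ n ≤ 6, ∀ x ∈ Ioo a b, ‖iteratedDeriv n f x‖ ≤ A) → ∀ (M : ℕ) (h : ℝ), 0 < h →
        a + M * h = b → ∀ j ≤ M,
          ‖discreteLaplacian α h M (fun i => f (a + i * h)) j - fracLaplacian α f (a + j * h)‖
            ≤ C * A * h ^ 2 := by
  obtain ⟨C, hC0, hC⟩ := exists_leftRL_consistency h₁ hα hab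
  obtain ⟨D, hD0, hD⟩ := exists_leftRL_consistency h₁ hα (neg_lt_neg hab)
  set k : ℂ := ((1 / (2 * Real.cos (α * Real.pi / 2)) : ℝ) : ℂ) with hk
  refine ⟨‖k‖ * (C + D), by positivity, fun f hf h0 A hA M h hh hM j hj => ?_⟩
  have b1 := hC f hf h0 A hA h hh (a + j * h)
  have b2 := hD (fun x => f (-x)) (hf.comp contDiff_neg)
    (fun x hx => h0 _ fun h' => hx (by constructor <;> linarith [h'.1, h'.2])) A
    (fun n hn x hx => by
      rw [iteratedDeriv_comp_neg, norm_smul]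
      simpa using hA n hn (-x) (by constructor <;> linarith [hx.1, hx.2])) h hh (-(a + j * h))
  rw [← rightRL_eq_leftRL, ← sum_range_eq_tsum_right hh h0 hj hM] at b2
  rw [← sum_range_eq_tsum_left hh h0] at b1
  rw [discreteLaplacian, fracLaplacian, ← hk, Complex.ofReal_mul, ← hk]
  set S := ∑ l ∈ Finset.range (j + 2), (weight α l : ℂ) * f (a + ((j : ℤ) - l + 1 : ℤ) * h)
  set S' := ∑ l ∈ Finset.range (M - j + 2), (weight α l : ℂ) * f (a + ((j : ℤ) + l - 1 : ℤ) * h)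
  set p : ℂ := ((1 / h ^ α : ℝ) : ℂ)
  have e : p * k * (S + S') - k * (leftRL α f (a + j * h) + rightRL α f (a + j * h))
      = k * ((p * S - leftRL α f (a + j * h)) + (p * S' - rightRL α f (a + j * h))) := by ring
  rw [e, norm_mul, mul_assoc (‖k‖ * _), mul_assoc]
  refine mul_le_mul_of_nonneg_left ((norm_add_le _ _).trans ((add_le_add b1 b2).trans_eq ?_))
    (norm_nonneg _)
  ring

/-! ### The case `α = 2` -/

/-- A mean value form of Taylor's estimate: each integration gains one power of s, without tracking
the factor 1/(k+1). -/
theorem norm_le_of_norm_deriv_right_le_pow {E : Type*} [NormedAddCommGroup E] [NormedSpace ℝ E]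
    {φ φ' : ℝ → E} {h C : ℝ} {k : ℕ} (hC : 0 ≤ C)
    (hc : ContinuousOn φ (Icc 0 h)) (h0 : φ 0 = 0)
    (hd : ∀ s ∈ Ico 0 h, HasDerivWithinAt φ (φ' s) (Ici s) s)
    (hb : ∀ s ∈ Ico 0 h, ‖φ' s‖ ≤ C * s ^ k) {s : ℝ} (hs : s ∈ Icc 0 h) :
    ‖φ s‖ ≤ C * s ^ (k + 1) := by
  have := norm_image_sub_le_of_norm_deriv_right_le_segment (C := C * s ^ k) (a := 0) (b := s)
    (hc.mono (Icc_subset_Icc_right hs.2))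
    (fun r hr => hd r ⟨hr.1, hr.2.trans_le hs.2⟩)
    (fun r hr => (hb r ⟨hr.1, hr.2.trans_le hs.2⟩).trans (by
      have := hr.1; have := hr.2.le; gcongr)) s (right_mem_Icc.2 hs.1)
  rw [h0, sub_zero, sub_zero, mul_assoc, ← pow_succ] at this
  exact this

/-- The error of the central second difference. -/
theorem norm_central_difference_le {a b x h A : ℝ} {D : ℕ → ℝ → ℂ} (hh : 0 < h)
    (hxa : a ≤ x - h) (hxb : x + h ≤ b) (hc : ∀ n, ContinuousOn (D n) (Icc a b))
    (hd : ∀ n, ∀ y ∈ Ioo a b, HasDerivAt (D n) (D (n + 1) y) y)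
    (hA : ∀ y ∈ Ioo a b, ‖D 4 y‖ ≤ A) :
    ‖D 0 (x + h) + D 0 (x - h) - 2 * D 0 x - h ^ 2 * D 2 x‖ ≤ 2 * A * h ^ 4 := by
  have hA0 : 0 ≤ A := (norm_nonneg _).trans (hA x ⟨by linarith, by linarith⟩)
  have m1 : ∀ s ∈ Ico 0 h, x + s ∈ Ioo a b := fun s hs =>
    ⟨by linarith [hs.1], by linarith [hs.2]⟩
  have m2 : ∀ s ∈ Ico 0 h, x - s ∈ Ioo a b := fun s hs =>
    ⟨by linarith [hs.2], by linarith [hs.1]⟩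
  have c1 : ∀ n, ContinuousOn (fun s => D n (x + s)) (Icc 0 h) := fun n =>
    (hc n).comp (by fun_prop) fun s hs => ⟨by linarith [hs.1], by linarith [hs.2]⟩
  have c2 : ∀ n, ContinuousOn (fun s => D n (x - s)) (Icc 0 h) := fun n =>
    (hc n).comp (by fun_prop) fun s hs => ⟨by linarith [hs.2], by linarith [hs.1]⟩
  have d1 : ∀ n, ∀ s ∈ Ico 0 h, HasDerivAt (fun s => D n (x + s)) (D (n + 1) (x + s)) s :=
    fun n s hs => (hd n _ (m1 s hs)).comp_const_add x s
  have d2 : ∀ n, ∀ s ∈ Ico 0 h, HasDerivAt (fun s => D n (x - s)) (-D (n + 1) (x - s)) s :=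
    fun n s hs => (hd n _ (m2 s hs)).comp_const_sub x s
  -- Four integrations starting from the bound on `D 4`. Each symmetric combination vanishes at s =
  -- 0 and has the previous one as derivative.
  have s3 : ∀ s ∈ Icc 0 h, ‖D 3 (x + s) - D 3 (x - s)‖ ≤ 2 * A * s ^ (0 + 1) := fun s hs =>
    norm_le_of_norm_deriv_right_le_pow (φ := fun s => D 3 (x + s) - D 3 (x - s))
      (φ' := fun s => D 4 (x + s) - -D 4 (x - s)) (by linarith) ((c1 3).sub (c2 3)) (by simp)
      (fun s hs => ((d1 3 s hs).sub (d2 3 s hs)).hasDerivWithinAt)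
      (fun s hs => by
        have := norm_sub_le (D 4 (x + s)) (-D 4 (x - s))
        rw [norm_neg] at this
        linarith [hA _ (m1 s hs), hA _ (m2 s hs)]) hs
  have s2 : ∀ s ∈ Icc 0 h, ‖D 2 (x + s) + D 2 (x - s) - 2 * D 2 x‖ ≤ 2 * A * s ^ (1 + 1) :=
    fun s hs => norm_le_of_norm_deriv_right_le_pow
      (φ := fun s => D 2 (x + s) + D 2 (x - s) - 2 * D 2 x)
      (φ' := fun s => D 3 (x + s) + -D 3 (x - s)) (by linarith)
      (((c1 2).add (c2 2)).sub continuousOn_const) (by simp; ring)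
      (fun s hs => (((d1 2 s hs).add (d2 2 s hs)).sub_const _).hasDerivWithinAt)
      (fun s hs => by rw [← sub_eq_add_neg]; exact s3 s (Ico_subset_Icc_self hs)) hs
  have l1 : ∀ s : ℝ, HasDerivAt (fun s : ℝ => 2 * (s : ℂ) * D 2 x) (2 * D 2 x) s := fun s => by
    have := ((hasDerivAt_id s).ofReal_comp.const_mul (2 : ℂ)).mul_const (D 2 x)
    simpa using this
  have s1 : ∀ s ∈ Icc 0 h, ‖D 1 (x + s) - D 1 (x - s) - 2 * s * D 2 x‖ ≤ 2 * A * s ^ (2 + 1) :=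
    fun s hs => norm_le_of_norm_deriv_right_le_pow
      (φ := fun s : ℝ => D 1 (x + s) - D 1 (x - s) - 2 * s * D 2 x)
      (φ' := fun s => D 2 (x + s) - -D 2 (x - s) - 2 * D 2 x) (by linarith)
      (((c1 1).sub (c2 1)).sub (by fun_prop)) (by simp)
      (fun s hs => (((d1 1 s hs).sub (d2 1 s hs)).sub (l1 s)).hasDerivWithinAt)
      (fun s hs => by rw [sub_neg_eq_add]; exact s2 s (Ico_subset_Icc_self hs)) hs
  have l2 : ∀ s : ℝ, HasDerivAt (fun s : ℝ => (s : ℂ) ^ 2 * D 2 x) (2 * s * D 2 x) s := fun s => by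
    have := ((hasDerivAt_id s).ofReal_comp.pow 2).mul_const (D 2 x)
    simpa using this
  have s0 := norm_le_of_norm_deriv_right_le_pow (h := h) (k := 3) (C := 2 * A)
      (φ := fun s : ℝ => D 0 (x + s) + D 0 (x - s) - 2 * D 0 x - s ^ 2 * D 2 x)
      (φ' := fun s => D 1 (x + s) + -D 1 (x - s) - 2 * s * D 2 x) (by linarith)
      ((((c1 0).add (c2 0)).sub continuousOn_const).sub (by fun_prop)) (by simp; ring)
      (fun s hs => ((((d1 0 s hs).add (d2 0 s hs)).sub_const _).sub (l2 s)).hasDerivWithinAt)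
      (fun s hs => by rw [← sub_eq_add_neg]; exact s1 s (Ico_subset_Icc_self hs))
      (right_mem_Icc.2 hh.le)
  exact s0

theorem grunwald_two_eq_zero (n : ℕ) : grunwald 2 (n + 3) = 0 := by
  induction n with
  | zero => rw [zero_add, grunwald_three]; norm_num
  | succ n ih => rw [grunwald_succ, ih, zero_mul]

/-- At α = 2 the weights λ are 1, 0, 0 and only the central stencil 1, -2, 1 survives. -/
theorem weight_two (l : ℕ) : weight 2 l = grunwald 2 l := by
  rcases l with _ | _ | l <;> simp [weight, lamOne, lamZero, lamNegOne] <;> norm_num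

theorem sum_weight_two {n : ℕ} (hn : 3 ≤ n) (v : ℕ → ℂ) :
    ∑ l ∈ Finset.range n, (weight 2 l : ℂ) * v l = v 0 - 2 * v 1 + v 2 := by
  obtain ⟨m, rfl⟩ := Nat.exists_eq_add_of_le' hn
  rw [← Finset.sum_subset (Finset.range_mono hn)]
  · simp only [Finset.sum_range_succ, Finset.sum_range_zero, weight_two, grunwald_zero,
      grunwald_one, grunwald_two]
    norm_num
    ring
  · intro l _ hl
    obtain ⟨k, rfl⟩ := Nat.exists_eq_add_of_le' (not_lt.1 (Finset.mem_range.not.1 hl))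
    rw [weight_two, grunwald_two_eq_zero, Complex.ofReal_zero, zero_mul]

theorem discreteLaplacian_two {h : ℝ} {j M : ℕ} (hj : 1 ≤ j) (hj' : j < M) (v : ℤ → ℂ) :
    discreteLaplacian 2 h M v j = -(v (j + 1) + v (j - 1) - 2 * v j) / h ^ 2 := by
  have h1 := sum_weight_two (n := j + 2) (by omega) fun l => v ((j : ℤ) - l + 1)
  have h2 := sum_weight_two (n := M - j + 2) (by omega) fun l => v ((j : ℤ) + l - 1)
  rw [discreteLaplacian, h1, h2]
  have e : (2 : ℝ) * Real.pi / 2 = Real.pi := by ring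
  have e2 : h ^ (2 : ℝ) = h ^ 2 := by exact_mod_cast Real.rpow_natCast h 2
  rw [e, Real.cos_pi, e2]
  push_cast
  rw [show (j : ℤ) - 0 + 1 = j + 1 by ring, show (j : ℤ) - 1 + 1 = j by ring,
    show (j : ℤ) - 2 + 1 = j - 1 by ring, show (j : ℤ) + 0 - 1 = j - 1 by ring,
    show (j : ℤ) + 1 - 1 = j by ring, show (j : ℤ) + 2 - 1 = j + 1 by ring]
  ring

theorem fracLaplacian_two (f : ℝ → ℂ) (x : ℝ) : fracLaplacian 2 f x = -iteratedDeriv 2 f x := by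
  have e : (2 : ℝ) * Real.pi / 2 = Real.pi := by ring
  rw [fracLaplacian, leftRL, rightRL, if_pos rfl, if_pos rfl, e, Real.cos_pi]
  push_cast
  ring

theorem iteratedDerivWithin_Icc_eq {a b : ℝ} (hab : a < b) {f : ℝ → ℂ}
    (hf : ContDiffOn ℝ ∞ f (Icc a b)) (n : ℕ) {x : ℝ} (hx : x ∈ Ioo a b) :
    iteratedDerivWithin n f (Icc a b) x = iteratedDeriv n f x :=
  iteratedDerivWithin_eq_iteratedDeriv (uniqueDiffOn_Icc hab)
    ((hf.contDiffAt (Icc_mem_nhds hx.1 hx.2)).of_le (by exact_mod_cast le_top))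
    (Ioo_subset_Icc_self hx)

/-- The stencil of an interior node stays in [a,b], so derivatives within the closed interval
suffice and no flatness at the ends is required. -/
theorem consistency_two {a b : ℝ} (hab : a < b) {f : ℝ → ℂ} (hf : ContDiffOn ℝ ∞ f (Icc a b))
    {A : ℝ} (hA : ∀ x ∈ Ioo a b, ‖iteratedDeriv 4 f x‖ ≤ A) {M : ℕ} {h : ℝ} (hh : 0 < h)
    (hM : a + M * h = b) {j : ℕ} (hj : 1 ≤ j) (hj' : j < M) :
    ‖discreteLaplacian 2 h M (fun i => f (a + i * h)) j - fracLaplacian 2 f (a + j * h)‖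
      ≤ 2 * A * h ^ 2 := by
  have hj1 : (1 : ℝ) ≤ j := by exact_mod_cast hj
  have hj2 : (j : ℝ) + 1 ≤ M := by exact_mod_cast hj'
  set D : ℕ → ℝ → ℂ := fun n => iteratedDerivWithin n f (Icc a b) with hD
  have hDs : ∀ n, ContDiffOn ℝ ∞ (D n) (Icc a b) := by
    intro n
    induction n with
    | zero => simpa [hD] using hf
    | succ n ih =>
      refine (contDiffOn_derivWithin hab ih).congr fun y hy => ?_
      simp only [hD, iteratedDerivWithin_succ]
  have hx : a + j * h ∈ Ioo a b := ⟨by nlinarith, by nlinarith⟩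
  have key := norm_central_difference_le (a := a) (b := b) (x := a + j * h) (h := h) (A := A)
    (D := D) hh (by nlinarith) (by nlinarith) (fun n => (hDs n).continuousOn)
    (fun n y hy => by
      have := hasDerivAt_of_mem_Ioo (hDs n) hy
      simpa only [hD, iteratedDerivWithin_succ] using this)
    (fun y hy => by rw [hD]; simp only; rw [iteratedDerivWithin_Icc_eq hab hf 4 hy]; exact hA y hy)
  rw [discreteLaplacian_two hj hj', fracLaplacian_two, ← iteratedDerivWithin_Icc_eq hab hf 2 hx]
  have e0 : D 0 = f := by ext y; simp [hD]
  rw [e0] at key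
  have hh' : (h : ℂ) ≠ 0 := by exact_mod_cast hh.ne'
  have e1 : -(f (a + ((j + 1 : ℤ) : ℝ) * h) + f (a + ((j - 1 : ℤ) : ℝ) * h)
      - 2 * f (a + ((j : ℤ) : ℝ) * h)) / h ^ 2 - -D 2 (a + j * h)
      = -((f (a + j * h + h) + f (a + j * h - h) - 2 * f (a + j * h) - h ^ 2 * D 2 (a + j * h))
        / h ^ 2) := by
    have i1 : a + ((j + 1 : ℤ) : ℝ) * h = a + j * h + h := by push_cast; ring
    have i2 : a + ((j - 1 : ℤ) : ℝ) * h = a + j * h - h := by push_cast; ring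
    rw [i1, i2, Int.cast_natCast]
    field_simp
    ring
  rw [e1, norm_neg, norm_div, norm_pow, Complex.norm_real, Real.norm_of_nonneg hh.le,
    div_le_iff₀ (by positivity)]
  exact key.trans_eq (by ring)

/-- Second-order consistency of the difference operator for functions whose fractional Laplacian is
smooth up to the boundary. -/
theorem exists_consistency {α a b : ℝ} (h₁ : 1 < α) (hα : α ≤ 2) (hab : a < b) :
    ∃ C : ℝ, 0 ≤ C ∧ ∀ f F : ℝ → ℂ, IsSmoothSupported a b f → ContDiffOn ℝ ∞ F (Icc a b) →
      (∀ x ∈ Ioo a b, fracLaplacian α f x = F x) → ∀ A : ℝ,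
      (∀ n ≤ 6, ∀ x ∈ Ioo a b, ‖iteratedDeriv n f x‖ ≤ A) → ∀ (M : ℕ) (h : ℝ), 0 < h →
        a + M * h = b → ∀ j ∈ Finset.Ico 1 M,
          ‖discreteLaplacian α h M (fun i => f (a + i * h)) j - F (a + j * h)‖ ≤ C * A * h ^ 2 := by
  have hx : ∀ (M : ℕ) (h : ℝ), 0 < h → a + M * h = b → ∀ j ∈ Finset.Ico 1 M,
      a + j * h ∈ Ioo a b := fun M h hh hM j hj => by
    rw [Finset.mem_Ico] at hj
    have hj1 : (1 : ℝ) ≤ j := by exact_mod_cast hj.1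
    have hj2 : (j : ℝ) + 1 ≤ M := by exact_mod_cast hj.2
    exact ⟨by nlinarith, by nlinarith⟩
  rcases hα.lt_or_eq with hlt | rfl
  · obtain ⟨C, hC0, hC⟩ := exists_consistency_of_lt_two h₁ hlt hab
    refine ⟨C, hC0, fun f F hf hF hfF A hA M h hh hM j hj => ?_⟩
    rw [← hfF _ (hx M h hh hM j hj)]
    exact hC f (hf.contDiff_of_fracLaplacian h₁ hlt hab hF hfF) hf.exterior A hA M h hh hM j
      (Finset.mem_Ico.1 hj).2.le
  · refine ⟨2, by norm_num, fun f F hf hF hfF A hA M h hh hM j hj => ?_⟩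
    rw [← hfF _ (hx M h hh hM j hj)]
    rw [Finset.mem_Ico] at hj
    exact consistency_two hab hf.smooth (hA 4 (by norm_num)) hh hM hj.1 hj.2

end FGLE

namespace FGLE

open Set Filter Topology

/-! ### The cubic term and the trapezoidal rule -/

/-- The cubic nonlinearity `|z|² z`. -/
noncomputable def cubic (z : ℂ) : ℂ := (‖z‖ ^ 2 : ℝ) * z

theorem cubic_eq (z : ℂ) : cubic z = z ^ 2 * (starRingEnd ℂ) z := by
  rw [cubic, Complex.ofReal_pow, ← Complex.mul_conj']
  ring

/-- Write the arguments as m ± d. Terms odd in d cancel in the average, and what remains is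
quadratic in d. -/
theorem norm_cubic_average_sub_le {p q : ℂ} {K : ℝ} (hp : ‖p‖ ≤ K) (hq : ‖q‖ ≤ K) :
    ‖(cubic p + cubic q) / 2 - cubic ((p + q) / 2)‖ ≤ K * ‖p - q‖ ^ 2 := by
  set m := (p + q) / 2 with hm
  set d := (p - q) / 2 with hd
  have e : (cubic p + cubic q) / 2 - cubic m
      = d ^ 2 * (starRingEnd ℂ) m + 2 * m * d * (starRingEnd ℂ) d := by
    have hp : p = m + d := by rw [hm, hd]; ring
    have hq : q = m - d := by rw [hm, hd]; ring
    rw [hp, hq, cubic_eq, cubic_eq, cubic_eq, map_add, map_sub]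
    ring
  have hmK : ‖m‖ ≤ K := by
    rw [hm, norm_div, Complex.norm_ofNat, div_le_iff₀ two_pos]
    linarith [norm_add_le p q]
  have hdn : ‖p - q‖ = 2 * ‖d‖ := by
    rw [hd, norm_div, Complex.norm_ofNat]; ring
  rw [e, hdn]
  refine (norm_add_le _ _).trans ?_
  rw [norm_mul, norm_mul, norm_mul, norm_mul, norm_pow, RCLike.norm_conj, RCLike.norm_conj,
    Complex.norm_ofNat]
  nlinarith [mul_le_mul_of_nonneg_left hmK (sq_nonneg ‖d‖), sq_nonneg ‖d‖, norm_nonneg m]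

/-- One-sided Lipschitz estimate for the cubic term: the part which is quadratic in `V` has a
favourable sign, so no bound on `V` is needed. -/
theorem re_cubic_sub_mul_conj_ge {κ ζ : ℝ} (hκ : 0 < κ) (U V : ℂ) :
    -((‖(κ + ζ * Complex.I : ℂ)‖ + ‖(κ + ζ * Complex.I : ℂ)‖ ^ 2 / (4 * κ)) * ‖U‖ ^ 2 * ‖U - V‖ ^ 2)
      ≤ ((κ + ζ * Complex.I) * (cubic U - cubic V) * (starRingEnd ℂ) (U - V)).re := by
  set k : ℂ := κ + ζ * Complex.I with hk
  set E := U - V with hE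
  have e : k * (cubic U - cubic V) * (starRingEnd ℂ) E
      = ((‖V‖ ^ 2 * ‖E‖ ^ 2 : ℝ) : ℂ) * k
        + ((‖U‖ ^ 2 - ‖V‖ ^ 2 : ℝ) : ℂ) * (k * U * (starRingEnd ℂ) E) := by
    have h1 : cubic U - cubic V = ((‖V‖ ^ 2 : ℝ) : ℂ) * E + ((‖U‖ ^ 2 - ‖V‖ ^ 2 : ℝ) : ℂ) * U := by
      rw [cubic, cubic, hE]; push_cast; ring
    have h2 : E * (starRingEnd ℂ) E = ((‖E‖ ^ 2 : ℝ) : ℂ) := by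
      rw [Complex.mul_conj']; push_cast; rfl
    rw [h1, Complex.ofReal_mul, ← h2]
    ring
  have hkre : k.re = κ := by simp [hk]
  have h1 := abs_le.1 (Complex.abs_re_le_norm (k * U * (starRingEnd ℂ) E))
  have hn : ‖k * U * (starRingEnd ℂ) E‖ = ‖k‖ * ‖U‖ * ‖E‖ := by
    rw [norm_mul, norm_mul, RCLike.norm_conj]
  rw [hn] at h1
  rw [e, Complex.add_re, Complex.re_ofReal_mul, Complex.re_ofReal_mul, hkre]
  set r := (k * U * (starRingEnd ℂ) E).re
  have h2 : |‖U‖ - ‖V‖| ≤ ‖E‖ := abs_norm_sub_norm_le U V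
  have h3 : |(‖U‖ ^ 2 - ‖V‖ ^ 2) * r| ≤ ‖E‖ * (‖U‖ + ‖V‖) * (‖k‖ * ‖U‖ * ‖E‖) := by
    rw [abs_mul, show ‖U‖ ^ 2 - ‖V‖ ^ 2 = (‖U‖ - ‖V‖) * (‖U‖ + ‖V‖) by ring, abs_mul,
      abs_of_nonneg (by positivity : 0 ≤ ‖U‖ + ‖V‖)]
    have h4 : |r| ≤ ‖k‖ * ‖U‖ * ‖E‖ := abs_le.2 h1
    gcongr
  have h5 := (abs_le.1 h3).1
  -- Young's inequality, weighted so that the part in `V` is exactly the κ‖V‖²‖E‖² offered by the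
  -- first term of `e`.
  have h6 : ‖k‖ * ‖U‖ * ‖V‖ ≤ κ * ‖V‖ ^ 2 + ‖k‖ ^ 2 / (4 * κ) * ‖U‖ ^ 2 := by
    have h7 : 0 ≤ (2 * κ * ‖V‖ - ‖k‖ * ‖U‖) ^ 2 / (4 * κ) := by positivity
    have h8 : (2 * κ * ‖V‖ - ‖k‖ * ‖U‖) ^ 2 / (4 * κ)
        = κ * ‖V‖ ^ 2 + ‖k‖ ^ 2 / (4 * κ) * ‖U‖ ^ 2 - ‖k‖ * ‖U‖ * ‖V‖ := by
      field_simp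
      ring
    linarith
  have h9 := mul_le_mul_of_nonneg_right h6 (sq_nonneg ‖E‖)
  linarith [h9, h5]

theorem re_sub_mul_conj_average (p q : ℂ) :
    ((p - q) * (starRingEnd ℂ) ((p + q) / 2)).re = (‖p‖ ^ 2 - ‖q‖ ^ 2) / 2 := by
  have n : ∀ w : ℂ, ‖w‖ ^ 2 = w.re ^ 2 + w.im ^ 2 := fun w => by
    rw [Complex.sq_norm, Complex.normSq_apply]; ring
  rw [n, n]
  simp only [Complex.mul_re, Complex.conj_re, Complex.conj_im, Complex.div_ofNat_re,
    Complex.div_ofNat_im, Complex.add_re, Complex.add_im, Complex.sub_re, Complex.sub_im]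
  ring

theorem norm_average_sq_le (p q : ℂ) : ‖(p + q) / 2‖ ^ 2 ≤ (‖p‖ ^ 2 + ‖q‖ ^ 2) / 2 := by
  have h : ‖(p + q) / 2‖ ≤ (‖p‖ + ‖q‖) / 2 := by
    rw [norm_div, Complex.norm_ofNat]; linarith [norm_add_le p q]
  have h2 := pow_le_pow_left₀ (norm_nonneg _) h 2
  nlinarith [sq_nonneg (‖p‖ - ‖q‖)]

/-- The error of the trapezoidal rule, in integrated form. -/
theorem norm_trapezoid_le {T t τ A : ℝ} {D : ℕ → ℝ → ℂ} (ht : 0 ≤ t) (hτ : 0 < τ) (htT : t + τ ≤ T)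
    (hd : ∀ n, ∀ s ∈ Icc 0 T, HasDerivWithinAt (D n) (D (n + 1) s) (Icc 0 T) s)
    (hA : ∀ s ∈ Icc 0 T, ‖D 3 s‖ ≤ A) :
    ‖D 0 (t + τ) - D 0 t - τ / 2 * (D 1 t + D 1 (t + τ))‖ ≤ A * τ ^ 3 := by
  have hA0 : 0 ≤ A := (norm_nonneg _).trans (hA t ⟨ht, by linarith⟩)
  have c1 : ∀ n, ContinuousOn (fun s => D n (t + s)) (Icc 0 τ) := fun n =>
    (show ContinuousOn (D n) (Icc 0 T) from fun s hs => (hd n s hs).continuousWithinAt).comp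
      (by fun_prop) fun s hs => ⟨by linarith [hs.1], by linarith [hs.2]⟩
  have d1 : ∀ n, ∀ s ∈ Ico 0 τ, HasDerivWithinAt (fun s => D n (t + s)) (D (n + 1) (t + s))
      (Ici s) s := by
    intro n s hs
    have hm : t + s ∈ Icc 0 T := ⟨by linarith [hs.1], by linarith [hs.2]⟩
    have h1 : HasDerivWithinAt (D n) (D (n + 1) (t + s)) (Ici (t + s)) (t + s) :=
      (hd n _ hm).mono_of_mem_nhdsWithin
        (mem_of_superset (Icc_mem_nhdsGE (show t + s < T by linarith [hs.2]))
          (Icc_subset_Icc_left hm.1))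
    have h2 := h1.scomp s (((hasDerivAt_id s).const_add t).hasDerivWithinAt (s := Ici s))
      (fun r hr => by simpa using hr)
    rw [one_smul] at h2
    exact h2
  have l1 : ∀ s : ℝ, HasDerivAt (fun s : ℝ => (s : ℂ) / 2) (1 / 2) s := fun s => by
    simpa using (hasDerivAt_id s).ofReal_comp.div_const (2 : ℂ)
  have s1 : ∀ s ∈ Icc 0 τ, ‖(D 1 (t + s) - D 1 t) / 2 - s / 2 * D 2 (t + s)‖ ≤ A * s ^ (1 + 1) :=
    fun s hs => norm_le_of_norm_deriv_right_le_pow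
      (φ := fun s : ℝ => (D 1 (t + s) - D 1 t) / 2 - s / 2 * D 2 (t + s))
      (φ' := fun s : ℝ => D 2 (t + s) / 2 - (1 / 2 * D 2 (t + s) + s / 2 * D 3 (t + s))) hA0
      ((((c1 1).sub continuousOn_const).div_const _).sub
        (ContinuousOn.mul (by fun_prop) (c1 2))) (by simp)
      (fun s hs => (((d1 1 s hs).sub_const _).div_const _).sub
        ((l1 s).hasDerivWithinAt.mul (d1 2 s hs)))
      (fun s hs => by
        have e : D 2 (t + s) / 2 - (1 / 2 * D 2 (t + s) + s / 2 * D 3 (t + s))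
          = -(s / 2 * D 3 (t + s)) := by ring
        rw [e, norm_neg, norm_mul, norm_div, Complex.norm_ofNat, Complex.norm_real,
          Real.norm_of_nonneg hs.1, pow_one]
        have := hA (t + s) ⟨by linarith [hs.1], by linarith [hs.2]⟩
        have h0 := hs.1
        nlinarith [norm_nonneg (D 3 (t + s))]) hs
  have s0 := norm_le_of_norm_deriv_right_le_pow (h := τ) (k := 2) (C := A)
      (φ := fun s : ℝ => D 0 (t + s) - D 0 t - s / 2 * (D 1 t + D 1 (t + s)))
      (φ' := fun s : ℝ => D 1 (t + s) - (1 / 2 * (D 1 t + D 1 (t + s)) + s / 2 * D 2 (t + s))) hA0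
      (((c1 0).sub continuousOn_const).sub
        (ContinuousOn.mul (by fun_prop) (continuousOn_const.add (c1 1)))) (by simp)
      (fun s hs => ((d1 0 s hs).sub_const _).sub
        ((l1 s).hasDerivWithinAt.mul ((d1 1 s hs).const_add _)))
      (fun s hs => by
        have e : D 1 (t + s) - (1 / 2 * (D 1 t + D 1 (t + s)) + s / 2 * D 2 (t + s))
          = (D 1 (t + s) - D 1 t) / 2 - s / 2 * D 2 (t + s) := by ring
        rw [e]
        exact s1 s (Ico_subset_Icc_self hs))
      (right_mem_Icc.2 hτ.le)
  exact s0

theorem norm_increment_le {T t τ A : ℝ} {f f' : ℝ → ℂ} (ht : 0 ≤ t) (hτ : 0 < τ) (htT : t + τ ≤ T)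
    (hd : ∀ s ∈ Icc 0 T, HasDerivWithinAt f (f' s) (Icc 0 T) s)
    (hA : ∀ s ∈ Icc 0 T, ‖f' s‖ ≤ A) : ‖f (t + τ) - f t‖ ≤ A * τ := by
  have := (convex_Icc (0 : ℝ) T).norm_image_sub_le_of_norm_hasDerivWithin_le hd hA
    (x := t) (y := t + τ) ⟨ht, by linarith⟩ ⟨by linarith, htT⟩
  simpa [abs_of_pos hτ] using this

/-- A discrete Gronwall inequality for the implicit midpoint energy balance. -/
theorem discrete_gronwall {S : ℕ → ℝ} {L τ g : ℝ} {N : ℕ} (hS : S 0 = 0) (hL : 0 ≤ L) (hτ : 0 < τ)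
    (hLτ : τ * L ≤ 1 / 2) (hg : 0 ≤ g)
    (h : ∀ n < N, S (n + 1) - S n ≤ τ * L * (S (n + 1) + S n) + τ * g) {n : ℕ} (hn : n ≤ N) :
    S n ≤ Real.exp (4 * L * (n * τ)) * (2 * (n * τ) * g) := by
  induction n with
  | zero => simp [hS]
  | succ n ih =>
    have ih := ih (by omega)
    have h1 := h n (by omega)
    set x := τ * L with hx
    have hx0 : 0 ≤ x := by positivity
    set G := Real.exp (4 * L * (n * τ)) * (2 * (n * τ) * g) with hG
    have hG0 : 0 ≤ G := by positivity
    have hτg : 0 ≤ τ * g := by positivity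
    -- For x ≤ 1/2 one has (1+x)/(1-x) ≤ 1 + 4x and 1/(1-x) ≤ 2.
    have h2 : S (n + 1) ≤ (1 + 4 * x) * G + 2 * (τ * g) := by
      have h3 : (1 - x) * S (n + 1) ≤ (1 + x) * G + τ * g := by nlinarith
      have h4 : (1 + x) * G + τ * g ≤ (1 - x) * ((1 + 4 * x) * G + 2 * (τ * g)) := by
        have : 0 ≤ x * (1 - 2 * x) * G := mul_nonneg (mul_nonneg hx0 (by linarith)) hG0
        nlinarith
      exact le_of_mul_le_mul_left (h3.trans h4) (by linarith)
    have h5 : 1 + 4 * x ≤ Real.exp (4 * x) := by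
      have := Real.add_one_le_exp (4 * x); linarith
    have h6 : 1 ≤ Real.exp (4 * L * ((n + 1 : ℕ) * τ)) := Real.one_le_exp (by positivity)
    have h7 : Real.exp (4 * x) * Real.exp (4 * L * (n * τ)) = Real.exp (4 * L * ((n + 1 : ℕ) * τ)) := by
      rw [← Real.exp_add, hx]; congr 1; push_cast; ring
    calc S (n + 1) ≤ (1 + 4 * x) * G + 2 * (τ * g) := h2
      _ ≤ Real.exp (4 * x) * G + Real.exp (4 * L * ((n + 1 : ℕ) * τ)) * (2 * (τ * g)) := by
        apply add_le_add (mul_le_mul_of_nonneg_right h5 hG0)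
        exact le_mul_of_one_le_left (by positivity) h6
      _ = _ := by
        rw [hG, ← mul_assoc, h7]; push_cast; ring

end FGLE

namespace FGLE

open Set Filter Topology

/-! ### Partial derivatives on the space-time cylinder -/

/-- The partial derivative in the direction `e` on the rectangle `[a, b] × [0, T]`. -/
noncomputable def partialDeriv (a b T : ℝ) (e : ℝ × ℝ) (G : ℝ × ℝ → ℂ) (p : ℝ × ℝ) : ℂ :=
  fderivWithin ℝ G (Icc a b ×ˢ Icc 0 T) p e

section PartialDeriv

variable {a b T : ℝ} {G : ℝ × ℝ → ℂ}

theorem uniqueDiffOn_cylinder (hab : a < b) (hT : 0 < T) :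
    UniqueDiffOn ℝ (Icc a b ×ˢ Icc 0 T) := (uniqueDiffOn_Icc hab).prod (uniqueDiffOn_Icc hT)

theorem contDiffOn_partialDeriv (hab : a < b) (hT : 0 < T)
    (hG : ContDiffOn ℝ ∞ G (Icc a b ×ˢ Icc 0 T)) (e : ℝ × ℝ) :
    ContDiffOn ℝ ∞ (partialDeriv a b T e G) (Icc a b ×ˢ Icc 0 T) :=
  (hG.fderivWithin (uniqueDiffOn_cylinder hab hT) (by simp)).clm_apply contDiffOn_const

theorem contDiffOn_iterate_partialDeriv (hab : a < b) (hT : 0 < T)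
    (hG : ContDiffOn ℝ ∞ G (Icc a b ×ˢ Icc 0 T)) (e : ℝ × ℝ) (n : ℕ) :
    ContDiffOn ℝ ∞ ((partialDeriv a b T e)^[n] G) (Icc a b ×ˢ Icc 0 T) := by
  induction n with
  | zero => exact hG
  | succ n ih =>
    rw [Function.iterate_succ_apply']
    exact contDiffOn_partialDeriv hab hT ih e

theorem hasDerivWithinAt_fst (hG : ContDiffOn ℝ ∞ G (Icc a b ×ˢ Icc 0 T)) {x t : ℝ}
    (hx : x ∈ Icc a b) (ht : t ∈ Icc 0 T) :
    HasDerivWithinAt (fun y => G (y, t)) (partialDeriv a b T (1, 0) G (x, t)) (Icc a b) x :=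
  ((hG.differentiableOn (by simp) (x, t) ⟨hx, ht⟩).hasFDerivWithinAt).comp_hasDerivWithinAt x
    ((hasDerivWithinAt_id x _).prodMk (hasDerivWithinAt_const x _ t)) fun _ hy => mk_mem_prod hy ht

theorem hasDerivWithinAt_snd (hG : ContDiffOn ℝ ∞ G (Icc a b ×ˢ Icc 0 T)) {x t : ℝ}
    (hx : x ∈ Icc a b) (ht : t ∈ Icc 0 T) :
    HasDerivWithinAt (fun s => G (x, s)) (partialDeriv a b T (0, 1) G (x, t)) (Icc 0 T) t :=
  ((hG.differentiableOn (by simp) (x, t) ⟨hx, ht⟩).hasFDerivWithinAt).comp_hasDerivWithinAt t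
    ((hasDerivWithinAt_const t _ x).prodMk (hasDerivWithinAt_id t _)) fun _ hs => mk_mem_prod hx hs

theorem contDiffOn_slice (hG : ContDiffOn ℝ ∞ G (Icc a b ×ˢ Icc 0 T)) {t : ℝ}
    (ht : t ∈ Icc 0 T) : ContDiffOn ℝ ∞ (fun y => G (y, t)) (Icc a b) :=
  hG.comp (contDiff_id.prodMk contDiff_const).contDiffOn fun _ hy => mk_mem_prod hy ht

theorem iteratedDeriv_slice (hab : a < b) (hT : 0 < T)
    (hG : ContDiffOn ℝ ∞ G (Icc a b ×ˢ Icc 0 T)) {t : ℝ} (ht : t ∈ Icc 0 T) (n : ℕ) {x : ℝ}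
    (hx : x ∈ Ioo a b) :
    iteratedDeriv n (fun y => G (y, t)) x = (partialDeriv a b T (1, 0))^[n] G (x, t) := by
  induction n generalizing x with
  | zero => simp
  | succ n ih =>
    rw [iteratedDeriv_succ, Function.iterate_succ_apply']
    have h : iteratedDeriv n (fun y => G (y, t)) =ᶠ[𝓝 x]
        fun y => (partialDeriv a b T (1, 0))^[n] G (y, t) := by
      filter_upwards [Ioo_mem_nhds hx.1 hx.2] with y hy using ih hy
    rw [h.deriv_eq]
    exact ((hasDerivWithinAt_fst (contDiffOn_iterate_partialDeriv hab hT hG (1, 0) n)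
      (Ioo_subset_Icc_self hx) ht).hasDerivAt (Icc_mem_nhds hx.1 hx.2)).deriv

theorem exists_bound_cylinder (hG : ContDiffOn ℝ ∞ G (Icc a b ×ˢ Icc 0 T)) :
    ∃ C, 0 ≤ C ∧ ∀ p ∈ Icc a b ×ˢ Icc 0 T, ‖G p‖ ≤ C := by
  obtain ⟨C, hC⟩ := (isCompact_Icc.prod isCompact_Icc).exists_bound_of_continuousOn hG.continuousOn
  exact ⟨max C 0, le_max_right _ _, fun x hx => (hC x hx).trans (le_max_left _ _)⟩

theorem exists_bound_iterate_partialDeriv (hab : a < b) (hT : 0 < T)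
    (hG : ContDiffOn ℝ ∞ G (Icc a b ×ˢ Icc 0 T)) (e : ℝ × ℝ) (m : ℕ) :
    ∃ A, 0 ≤ A ∧ ∀ n ≤ m, ∀ p ∈ Icc a b ×ˢ Icc 0 T, ‖(partialDeriv a b T e)^[n] G p‖ ≤ A := by
  choose A hA0 hA using fun n =>
    exists_bound_cylinder (contDiffOn_iterate_partialDeriv hab hT hG e n)
  refine ⟨∑ n ∈ Finset.range (m + 1), A n, Finset.sum_nonneg fun n _ => hA0 n, fun n hn p hp =>
    (hA n p hp).trans ?_⟩
  exact Finset.single_le_sum (f := A) (fun n _ => hA0 n) (Finset.mem_range.2 (by omega))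

end PartialDeriv

theorem discreteLaplacian_linear (α h : ℝ) (M : ℕ) (c d : ℂ) (v w : ℤ → ℂ) (j : ℕ) :
    discreteLaplacian α h M (fun i => c * v i + d * w i) j
      = c * discreteLaplacian α h M v j + d * discreteLaplacian α h M w j := by
  have e : ∀ (s : Finset ℕ) (φ : ℕ → ℤ), ∑ l ∈ s, (weight α l : ℂ) * (c * v (φ l) + d * w (φ l))
      = c * ∑ l ∈ s, (weight α l : ℂ) * v (φ l) + d * ∑ l ∈ s, (weight α l : ℂ) * w (φ l) := by
    intro s φ
    rw [Finset.mul_sum, Finset.mul_sum, ← Finset.sum_add_distrib]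
    exact Finset.sum_congr rfl fun l _ => by ring
  simp only [discreteLaplacian, e]
  ring

/-! ### Consistency error of the exact solution -/

namespace IsSmoothSolution

variable {α ν η κ ζ γ a b T : ℝ} {u₀ : ℝ → ℂ} {u : ℝ → ℝ → ℂ}

theorem isSmoothSupported (hu : IsSmoothSolution α ν η κ ζ γ a b T u₀ u) {t : ℝ}
    (ht : t ∈ Icc 0 T) : IsSmoothSupported a b (fun x => u x t) :=
  ⟨contDiffOn_slice hu.smooth ht, fun x hx => hu.exterior x hx t ht⟩

/-- The value of the fractional Laplacian of the solution that the equation prescribes. -/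
noncomputable def prescribed (ν η κ ζ γ a b T : ℝ) (u : ℝ → ℝ → ℂ) (p : ℝ × ℝ) : ℂ :=
  -(partialDeriv a b T (0, 1) (fun p => u p.1 p.2) p
    + (κ + ζ * Complex.I) * cubic (u p.1 p.2) - γ * u p.1 p.2) / (ν + η * Complex.I)

theorem ne_zero_of_pos (hν : 0 < ν) : (ν + η * Complex.I : ℂ) ≠ 0 := by
  intro h
  have := congrArg Complex.re h
  simp at this
  linarith

theorem contDiffOn_prescribed (hab : a < b) (hT : 0 < T)
    (hu : IsSmoothSolution α ν η κ ζ γ a b T u₀ u) :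
    ContDiffOn ℝ ∞ (prescribed ν η κ ζ γ a b T u) (Icc a b ×ˢ Icc 0 T) := by
  have h1 := contDiffOn_partialDeriv hab hT hu.smooth (0, 1)
  have h2 : ContDiffOn ℝ ∞ (fun p : ℝ × ℝ => cubic (u p.1 p.2)) (Icc a b ×ˢ Icc 0 T) :=
    (Complex.ofRealCLM.contDiff.comp_contDiffOn (hu.smooth.norm_sq ℝ)).mul hu.smooth
  exact (((h1.add (contDiffOn_const.mul h2)).sub (contDiffOn_const.mul hu.smooth)).neg).div_const _

theorem fracLaplacian_eq (hν : 0 < ν) (hT : 0 < T)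
    (hu : IsSmoothSolution α ν η κ ζ γ a b T u₀ u) {x t : ℝ} (hx : x ∈ Ioo a b) (ht : t ∈ Ioc 0 T) :
    fracLaplacian α (fun y => u y t) x = prescribed ν η κ ζ γ a b T u (x, t) := by
  have h := hu.equation x hx t ht
  have ht' : t ∈ Icc 0 T := Ioc_subset_Icc_self ht
  have hd := (hasDerivWithinAt_snd hu.smooth (Ioo_subset_Icc_self hx) ht').derivWithin
    (uniqueDiffOn_Icc hT t ht')
  simp only at hd
  rw [hd] at h
  rw [prescribed, eq_div_iff (ne_zero_of_pos hν), cubic]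
  simp only
  linear_combination h

/-- Consistency of the difference operator along the solution, uniformly up to `t = 0`. -/
theorem exists_space_consistency (h₁ : 1 < α) (hα : α ≤ 2) (hν : 0 < ν) (hab : a < b) (hT : 0 < T)
    (hu : IsSmoothSolution α ν η κ ζ γ a b T u₀ u) :
    ∃ C : ℝ, 0 ≤ C ∧ ∀ (M : ℕ) (h : ℝ), 0 < h → a + M * h = b → ∀ j ∈ Finset.Ico 1 M,
      ∀ t ∈ Icc 0 T, ‖discreteLaplacian α h M (fun i => u (a + i * h) t) j
        - prescribed ν η κ ζ γ a b T u (a + j * h, t)‖ ≤ C * h ^ 2 := by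
  obtain ⟨C, hC0, hC⟩ := exists_consistency h₁ hα hab
  obtain ⟨A, hA0, hA⟩ := exists_bound_iterate_partialDeriv hab hT hu.smooth (1, 0) 6
  have hP := contDiffOn_prescribed hab hT hu
  refine ⟨C * A, by positivity, fun M h hh hM j hj => ?_⟩
  have hpos : ∀ t ∈ Ioc 0 T, ‖discreteLaplacian α h M (fun i => u (a + i * h) t) j
        - prescribed ν η κ ζ γ a b T u (a + j * h, t)‖ ≤ C * A * h ^ 2 := fun t ht => by
    have ht' : t ∈ Icc 0 T := Ioc_subset_Icc_self ht
    refine hC (fun x => u x t) (fun x => prescribed ν η κ ζ γ a b T u (x, t))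
      (hu.isSmoothSupported ht') (contDiffOn_slice hP ht') (fun x hx => hu.fracLaplacian_eq hν hT hx ht)
      A (fun n hn x hx => ?_) M h hh hM j hj
    have := iteratedDeriv_slice hab hT hu.smooth ht' n hx
    simp only at this
    rw [this]
    exact hA n hn _ ⟨Ioo_subset_Icc_self hx, ht'⟩
  have hcu : ∀ x, ContinuousOn (fun t => u x t) (Icc 0 T) := fun x => by
    by_cases hx : x ∈ Ioo a b
    · exact fun t ht => (hasDerivWithinAt_snd hu.smooth (Ioo_subset_Icc_self hx) ht).continuousWithinAt
    · exact continuousOn_const.congr fun t ht => hu.exterior x hx t ht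
  have hx : a + j * h ∈ Icc a b := by
    rw [Finset.mem_Ico] at hj
    have hj2 : (j : ℝ) ≤ M := by exact_mod_cast hj.2.le
    exact ⟨by have : 0 ≤ j * h := by positivity
              linarith, by nlinarith⟩
  have hcont : ContinuousOn (fun t => ‖discreteLaplacian α h M (fun i => u (a + i * h) t) j
        - prescribed ν η κ ζ γ a b T u (a + j * h, t)‖) (Icc 0 T) := by
    refine (ContinuousOn.sub ?_ ?_).norm
    · unfold discreteLaplacian
      refine continuousOn_const.mul (ContinuousOn.add ?_ ?_) <;>
        exact continuousOn_finsetSum _ fun l _ => continuousOn_const.mul (hcu _)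
    · exact fun t ht => (hasDerivWithinAt_snd hP hx ht).continuousWithinAt
  intro t ht
  -- The equation is not available at t = 0, so the bound is carried there by continuity in time.
  rcases ht.1.eq_or_lt with rfl | h0
  · have hT' : Tendsto _ (𝓝[Ioc 0 T] (0 : ℝ)) _ := (hcont 0 ht).mono Ioc_subset_Icc_self
    have : (𝓝[Ioc 0 T] (0 : ℝ)).NeBot := by
      rw [← mem_closure_iff_nhdsWithin_neBot, closure_Ioc hT.ne]; exact ht
    exact le_of_tendsto hT' (by filter_upwards [self_mem_nhdsWithin] with s hs using hpos s hs)
  · exact hpos t ⟨h0, ht.2⟩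

/-- The residual of the exact solution in the implicit midpoint scheme. -/
theorem exists_residual_bound (h₁ : 1 < α) (hα : α ≤ 2) (hν : 0 < ν) (hab : a < b) (hT : 0 < T)
    (hu : IsSmoothSolution α ν η κ ζ γ a b T u₀ u) :
    ∃ C : ℝ, 0 ≤ C ∧ ∀ (M : ℕ) (h : ℝ), 0 < h → a + M * h = b → ∀ j ∈ Finset.Ico 1 M,
      ∀ t τ : ℝ, 0 ≤ t → 0 < τ → t + τ ≤ T →
        ‖(u (a + j * h) (t + τ) - u (a + j * h) t) / τ
          + (ν + η * Complex.I) * discreteLaplacian α h M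
              (fun i => (u (a + i * h) (t + τ) + u (a + i * h) t) / 2) j
          + (κ + ζ * Complex.I) * cubic ((u (a + j * h) (t + τ) + u (a + j * h) t) / 2)
          - γ * ((u (a + j * h) (t + τ) + u (a + j * h) t) / 2)‖ ≤ C * (τ ^ 2 + h ^ 2) := by
  obtain ⟨C, hC0, hC⟩ := hu.exists_space_consistency h₁ hα hν hab hT
  obtain ⟨A, hA0, hA⟩ := exists_bound_iterate_partialDeriv hab hT hu.smooth (0, 1) 3
  set c := ‖(ν + η * Complex.I : ℂ)‖ with hc
  set k := ‖(κ + ζ * Complex.I : ℂ)‖ with hk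
  refine ⟨A + c * C + k * A ^ 3, by positivity, fun M h hh hM j hj t τ ht hτ htT => ?_⟩
  have hx : a + j * h ∈ Icc a b := by
    rw [Finset.mem_Ico] at hj
    have hj2 : (j : ℝ) ≤ M := by exact_mod_cast hj.2.le
    exact ⟨by have : 0 ≤ j * h := by positivity
              linarith, by nlinarith⟩
  have ht1 : t ∈ Icc 0 T := ⟨ht, by linarith⟩
  have ht2 : t + τ ∈ Icc 0 T := ⟨by linarith, htT⟩
  have b1 := hC M h hh hM j hj t ht1
  have b2 := hC M h hh hM j hj (t + τ) ht2
  set x := a + j * h with hxdef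
  set D : ℕ → ℝ → ℂ := fun n s => (partialDeriv a b T (0, 1))^[n] (fun p => u p.1 p.2) (x, s) with hD
  have hd : ∀ n, ∀ s ∈ Icc 0 T, HasDerivWithinAt (D n) (D (n + 1) s) (Icc 0 T) s := by
    intro n s hs
    have := hasDerivWithinAt_snd (contDiffOn_iterate_partialDeriv hab hT hu.smooth (0, 1) n) hx hs
    simp only [hD, Function.iterate_succ_apply']
    exact this
  have b3 := norm_trapezoid_le ht hτ htT hd (fun s hs => hA 3 le_rfl _ ⟨hx, hs⟩)
  have b4 := norm_increment_le ht hτ htT (hd 0) (fun s hs => hA 1 (by norm_num) _ ⟨hx, hs⟩)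
  have b5 := norm_cubic_average_sub_le (p := u x (t + τ)) (q := u x t) (K := A)
    (hA 0 (by norm_num) (x, t + τ) (mk_mem_prod hx ht2)) (hA 0 (by norm_num) (x, t) (mk_mem_prod hx ht1))
  have hlin : discreteLaplacian α h M (fun i => (u (a + i * h) (t + τ) + u (a + i * h) t) / 2) j
      = (discreteLaplacian α h M (fun i => u (a + i * h) (t + τ)) j
        + discreteLaplacian α h M (fun i => u (a + i * h) t) j) / 2 := by
    have := discreteLaplacian_linear α h M (1 / 2) (1 / 2) (fun i => u (a + i * h) (t + τ))
      (fun i => u (a + i * h) t) j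
    rw [add_div, div_eq_inv_mul, div_eq_inv_mul, ← one_div, ← this]
    congr 1
    ext i
    ring
  rw [hlin]
  have hP : ∀ s, (ν + η * Complex.I) * prescribed ν η κ ζ γ a b T u (x, s)
      = -(D 1 s + (κ + ζ * Complex.I) * cubic (u x s) - γ * u x s) := fun s => by
    rw [prescribed, mul_div_cancel₀ _ (ne_zero_of_pos hν)]
    rfl
  have hτ' : (τ : ℂ) ≠ 0 := by exact_mod_cast hτ.ne'
  set Δ1 := discreteLaplacian α h M (fun i => u (a + i * h) (t + τ)) j
  set Δ0 := discreteLaplacian α h M (fun i => u (a + i * h) t) j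
  set P1 := prescribed ν η κ ζ γ a b T u (x, t + τ)
  set P0 := prescribed ν η κ ζ γ a b T u (x, t)
  have h0 : D 0 (t + τ) = u x (t + τ) := rfl
  have h0' : D 0 t = u x t := rfl
  rw [h0, h0'] at b3 b4
  -- Subtracting the mean of the equation at the two time levels leaves the trapezoidal error, the
  -- two spatial errors and the defect of the cubic term; the linear γ term cancels.
  have e : (u x (t + τ) - u x t) / τ + (ν + η * Complex.I) * ((Δ1 + Δ0) / 2)
      + (κ + ζ * Complex.I) * cubic ((u x (t + τ) + u x t) / 2) - γ * ((u x (t + τ) + u x t) / 2)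
      = (u x (t + τ) - u x t - τ / 2 * (D 1 t + D 1 (t + τ))) / τ
        + (ν + η * Complex.I) * (((Δ1 - P1) + (Δ0 - P0)) / 2)
        - (κ + ζ * Complex.I) * ((cubic (u x (t + τ)) + cubic (u x t)) / 2
          - cubic ((u x (t + τ) + u x t) / 2)) := by
    have e1 : τ / 2 * (D 1 t + D 1 (t + τ)) / τ = (D 1 t + D 1 (t + τ)) / 2 := by
      field_simp
    rw [sub_div _ (τ / 2 * (D 1 t + D 1 (t + τ)) : ℂ), e1]
    linear_combination (1 / 2 : ℂ) * hP t + (1 / 2 : ℂ) * hP (t + τ)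
  rw [e]
  have n1 : ‖(u x (t + τ) - u x t - τ / 2 * (D 1 t + D 1 (t + τ))) / τ‖ ≤ A * τ ^ 2 := by
    rw [norm_div, Complex.norm_real, Real.norm_of_nonneg hτ.le, div_le_iff₀ hτ]
    exact b3.trans_eq (by ring)
  have n2 : ‖(ν + η * Complex.I) * (((Δ1 - P1) + (Δ0 - P0)) / 2)‖ ≤ c * (C * h ^ 2) := by
    rw [norm_mul]
    refine mul_le_mul_of_nonneg_left ?_ (norm_nonneg _)
    rw [norm_div, Complex.norm_ofNat, div_le_iff₀ two_pos]
    linarith [norm_add_le (Δ1 - P1) (Δ0 - P0)]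
  have n3 : ‖(κ + ζ * Complex.I) * ((cubic (u x (t + τ)) + cubic (u x t)) / 2
          - cubic ((u x (t + τ) + u x t) / 2))‖ ≤ k * (A ^ 3 * τ ^ 2) := by
    rw [norm_mul]
    refine mul_le_mul_of_nonneg_left (b5.trans ?_) (norm_nonneg _)
    calc A * ‖u x (t + τ) - u x t‖ ^ 2 ≤ A * (A * τ) ^ 2 := by gcongr
      _ = _ := by ring
  refine (norm_sub_le _ _).trans ((add_le_add ((norm_add_le _ _).trans (add_le_add n1 n2)) n3).trans ?_)
  have p1 : 0 ≤ A * h ^ 2 := by positivity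
  have p2 : 0 ≤ c * C * τ ^ 2 := by positivity
  have p3 : 0 ≤ k * A ^ 3 * h ^ 2 := by positivity
  nlinarith

end IsSmoothSolution

end FGLE

namespace FGLE

open Set

/-! ### Energy estimate -/

/-- The energy balance for the difference of two solutions of perturbed midpoint steps. -/
theorem midpoint_energy_step {α ν η κ ζ γ h τ K ρ : ℝ} (h₁ : 1 < α) (hα : α ≤ 2) (hν : 0 < ν)
    (hκ : 0 < κ) (hh : 0 < h) (hτ : 0 < τ) {M : ℕ} {U U' V V' : ℤ → ℂ}
    (hz : ∀ j : ℤ, ¬ (1 ≤ j ∧ j ≤ (M : ℤ) - 1) → U j = V j)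
    (hz' : ∀ j : ℤ, ¬ (1 ≤ j ∧ j ≤ (M : ℤ) - 1) → U' j = V' j)
    (hK : ∀ j, ‖(U' j + U j) / 2‖ ≤ K)
    (hU : ∀ j ∈ Finset.Ico 1 M, ‖(U' j - U j) / τ
          + (ν + η * Complex.I) * discreteLaplacian α h M (fun i => (U' i + U i) / 2) j
          + (κ + ζ * Complex.I) * cubic ((U' j + U j) / 2) - γ * ((U' j + U j) / 2)‖ ≤ ρ)
    (hV : ∀ j ∈ Finset.Ico 1 M, (V' j - V j) / τ
          + (ν + η * Complex.I) * discreteLaplacian α h M (fun i => (V' i + V i) / 2) j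
          + (κ + ζ * Complex.I) * cubic ((V' j + V j) / 2) - γ * ((V' j + V j) / 2) = 0) :
    (h * ∑ j ∈ Finset.Ico 1 M, ‖U' j - V' j‖ ^ 2) - h * ∑ j ∈ Finset.Ico 1 M, ‖U j - V j‖ ^ 2
      ≤ τ * ((‖(κ + ζ * Complex.I : ℂ)‖ + ‖(κ + ζ * Complex.I : ℂ)‖ ^ 2 / (4 * κ)) * K ^ 2
          + |γ| + 1 / 2) * ((h * ∑ j ∈ Finset.Ico 1 M, ‖U' j - V' j‖ ^ 2)
            + h * ∑ j ∈ Finset.Ico 1 M, ‖U j - V j‖ ^ 2) + τ * (h * M * ρ ^ 2) := by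
  set c := ‖(κ + ζ * Complex.I : ℂ)‖ + ‖(κ + ζ * Complex.I : ℂ)‖ ^ 2 / (4 * κ) with hc
  have hc0 : 0 ≤ c := by positivity
  -- The summands come from the cubic term, the linear term, and Young's inequality for the
  -- residual.
  set L := c * K ^ 2 + |γ| + 1 / 2 with hL
  have hL0 : 0 ≤ L := by positivity
  set E : ℤ → ℂ := fun j => ((U' j - V' j) + (U j - V j)) / 2 with hE
  obtain ⟨q, hq0, hq⟩ := discreteLaplacian_nonneg h₁ hα hh M E fun j hj => by
    simp [hE, hz j hj, hz' j hj]
  have hlin : ∀ j, discreteLaplacian α h M E j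
      = discreteLaplacian α h M (fun i => (U' i + U i) / 2) j
        - discreteLaplacian α h M (fun i => (V' i + V i) / 2) j := fun j => by
    have := discreteLaplacian_linear α h M 1 (-1) (fun i => (U' i + U i) / 2)
      (fun i => (V' i + V i) / 2) j
    rw [one_mul, neg_one_mul, ← sub_eq_add_neg] at this
    rw [← this]
    congr 1
    ext i
    simp only [hE]
    ring
  have hpt : ∀ j ∈ Finset.Ico 1 M, (‖U' j - V' j‖ ^ 2 - ‖U j - V j‖ ^ 2) / 2 / τ
      + ((ν + η * Complex.I) * (discreteLaplacian α h M E j * (starRingEnd ℂ) (E j))).re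
      ≤ L * ((‖U' j - V' j‖ ^ 2 + ‖U j - V j‖ ^ 2) / 2) + ρ ^ 2 / 2 := by
    intro j hj
    have r1 := hU j hj
    set R := (U' j - U j) / τ
          + (ν + η * Complex.I) * discreteLaplacian α h M (fun i => (U' i + U i) / 2) j
          + (κ + ζ * Complex.I) * cubic ((U' j + U j) / 2) - γ * ((U' j + U j) / 2) with hR
    set Z := starRingEnd ℂ (E j) with hZ
    have hEj : E j = (U' j + U j) / 2 - (V' j + V j) / 2 := by simp only [hE]; ring
    have e : ((1 / τ : ℝ) : ℂ) * (((U' j - V' j) - (U j - V j)) * Z)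
        + (ν + η * Complex.I) * (discreteLaplacian α h M E j * Z)
        + (κ + ζ * Complex.I) * (cubic ((U' j + U j) / 2) - cubic ((V' j + V j) / 2)) * Z
        = R * Z + (γ : ℂ) * (E j * Z) := by
      rw [hlin, hR, hEj]
      push_cast
      linear_combination (-Z) * hV j hj
    have e' := congrArg Complex.re e
    have h2 : E j * Z = ((‖E j‖ ^ 2 : ℝ) : ℂ) := by
      rw [hZ, Complex.mul_conj']; push_cast; rfl
    have t1 : (((U' j - V' j) - (U j - V j)) * Z).re = (‖U' j - V' j‖ ^ 2 - ‖U j - V j‖ ^ 2) / 2 :=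
      re_sub_mul_conj_average _ _
    have t2 := re_cubic_sub_mul_conj_ge (ζ := ζ) hκ ((U' j + U j) / 2) ((V' j + V j) / 2)
    rw [← hEj, ← hZ, ← hc] at t2
    have t3 : (R * Z).re ≤ ρ ^ 2 / 2 + ‖E j‖ ^ 2 / 2 := by
      refine (Complex.re_le_norm _).trans ?_
      rw [norm_mul, hZ, RCLike.norm_conj]
      have := mul_le_mul_of_nonneg_right r1 (norm_nonneg (E j))
      nlinarith [sq_nonneg (ρ - ‖E j‖)]
    rw [Complex.add_re, Complex.add_re, Complex.add_re, Complex.re_ofReal_mul, t1, h2,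
      ← Complex.ofReal_mul, Complex.ofReal_re] at e'
    have t4 : c * ‖(U' j + U j) / 2‖ ^ 2 * ‖E j‖ ^ 2 ≤ c * K ^ 2 * ‖E j‖ ^ 2 := by
      have := hK j
      gcongr
    have t5 : γ * ‖E j‖ ^ 2 ≤ |γ| * ‖E j‖ ^ 2 :=
      mul_le_mul_of_nonneg_right (le_abs_self γ) (sq_nonneg _)
    have t6 : ‖E j‖ ^ 2 ≤ (‖U' j - V' j‖ ^ 2 + ‖U j - V j‖ ^ 2) / 2 := norm_average_sq_le _ _
    have t7 := mul_le_mul_of_nonneg_left t6 hL0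
    have t8 : L * ‖E j‖ ^ 2 = c * K ^ 2 * ‖E j‖ ^ 2 + |γ| * ‖E j‖ ^ 2 + ‖E j‖ ^ 2 / 2 := by
      rw [hL]; ring
    have t9 : (‖U' j - V' j‖ ^ 2 - ‖U j - V j‖ ^ 2) / 2 / τ
        = 1 / τ * ((‖U' j - V' j‖ ^ 2 - ‖U j - V j‖ ^ 2) / 2) := by ring
    rw [t9]
    linarith
  have hsum := Finset.sum_le_sum hpt
  -- Because the quadratic form is real, only the real part ν of its coefficient survives.
  have hqs : ∑ j ∈ Finset.Ico 1 M,
      ((ν + η * Complex.I) * (discreteLaplacian α h M E j * (starRingEnd ℂ) (E j))).re = ν * q := by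
    rw [← Complex.re_sum, ← Finset.mul_sum, hq]
    simp
  rw [Finset.sum_add_distrib, hqs, Finset.sum_add_distrib, ← Finset.mul_sum, ← Finset.sum_div,
    ← Finset.sum_div, ← Finset.sum_div, Finset.sum_sub_distrib, Finset.sum_add_distrib,
    Finset.sum_const, Nat.card_Ico, nsmul_eq_mul] at hsum
  set S' := ∑ j ∈ Finset.Ico 1 M, ‖U' j - V' j‖ ^ 2
  set S := ∑ j ∈ Finset.Ico 1 M, ‖U j - V j‖ ^ 2
  have hνq : 0 ≤ ν * q := by positivity
  have hMle : ((M - 1 : ℕ) : ℝ) * (ρ ^ 2 / 2) ≤ M * (ρ ^ 2 / 2) := by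
    have : ((M - 1 : ℕ) : ℝ) ≤ M := by exact_mod_cast Nat.sub_le M 1
    gcongr
  have h3 : (S' - S) / 2 / τ ≤ L * ((S' + S) / 2) + M * (ρ ^ 2 / 2) := by linarith
  rw [div_le_iff₀ hτ] at h3
  have h4 := mul_le_mul_of_nonneg_left h3 (by positivity : 0 ≤ 2 * h)
  linarith

end FGLE

/-! ### The convergence theorem. -/

theorem mainTheorem2 (α ν η κ ζ γ a b T : ℝ) (hα₁ : 1 < α) (hα₂ : α ≤ 2) (hν : 0 < ν) (hκ : 0 < κ)
    (hab : a < b) (hT : 0 < T) (u₀ : ℝ → ℂ) (u : ℝ → ℝ → ℂ)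
    (hu : FGLE.IsSmoothSolution α ν η κ ζ γ a b T u₀ u) :
    ∃ τ₀ : ℝ, 0 < τ₀ ∧ ∃ C : ℝ, 0 < C ∧
      ∀ M N : ℕ, 0 < M → 0 < N → ∀ h τ : ℝ, h = (b - a) / M → τ = T / N → τ ≤ τ₀ →
        ∀ v : ℕ → ℤ → ℂ, FGLE.IsSchemeSolution α ν η κ ζ γ a b T u₀ M N v →
          ∀ n ≤ N,
            FGLE.gridNorm h M (fun j => u (a + j * h) (n * τ) - v n j) ≤ C * (τ ^ 2 + h ^ 2) := by
  obtain ⟨C, hC0, hC⟩ := hu.exists_residual_bound hα₁ hα₂ hν hab hT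
  obtain ⟨K, hK0, hK⟩ := FGLE.exists_bound_cylinder hu.smooth
  set L := (‖(κ + ζ * Complex.I : ℂ)‖ + ‖(κ + ζ * Complex.I : ℂ)‖ ^ 2 / (4 * κ)) * K ^ 2
          + |γ| + 1 / 2 with hL
  have hL0 : 0 < L := by positivity
  have hba : 0 < b - a := by linarith
  -- The Gronwall factor at the final time, with forcing (b-a)ρ².
  set Q := Real.exp (4 * L * T) * (2 * T * (b - a)) with hQ
  -- The threshold gives τL ≤ 1/2, as the Gronwall lemma demands; the added 1 only makes the
  -- constant positive.
  refine ⟨1 / (2 * L), by positivity, Real.sqrt Q * C + 1, by positivity, ?_⟩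
  intro M N hM hN h τ hh hτ hτ₀ v hv n hn
  have hM' : (0 : ℝ) < M := by exact_mod_cast hM
  have hN' : (0 : ℝ) < N := by exact_mod_cast hN
  have hh0 : 0 < h := by rw [hh]; positivity
  have hτ0 : 0 < τ := by rw [hτ]; positivity
  have hMh : M * h = b - a := by rw [hh]; field_simp
  have hMb : a + M * h = b := by linarith
  have hNτ : N * τ = T := by rw [hτ]; field_simp
  have hKu : ∀ x, ∀ t ∈ Set.Icc 0 T, ‖u x t‖ ≤ K := fun x t ht => by
    by_cases hx : x ∈ Set.Ioo a b
    · exact hK (x, t) ⟨Set.Ioo_subset_Icc_self hx, ht⟩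
    · rw [hu.exterior x hx t ht, norm_zero]; exact hK0
  have htn : ∀ n ≤ N, (n : ℝ) * τ ∈ Set.Icc 0 T := fun n hn => by
    have : (n : ℝ) ≤ N := by exact_mod_cast hn
    exact ⟨by positivity, by rw [← hNτ]; gcongr⟩
  have hout : ∀ n ≤ N, ∀ j : ℤ, ¬ (1 ≤ j ∧ j ≤ (M : ℤ) - 1) → u (a + j * h) (n * τ) = v n j := by
    intro n hn j hj
    rw [hv.boundary n hn j hj]
    refine hu.exterior _ (fun hx => hj ?_) _ (htn n hn)
    have h1 : (0 : ℝ) < j := by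
      by_contra hcon
      have := hx.1
      nlinarith
    have h2 : (j : ℝ) < M := by
      by_contra hcon
      have := hx.2
      nlinarith
    have h1' : 0 < j := by exact_mod_cast h1
    have h2' : j < M := by exact_mod_cast h2
    omega
  set ρ := C * (τ ^ 2 + h ^ 2) with hρ
  have hρ0 : 0 ≤ ρ := by positivity
  set S : ℕ → ℝ := fun n => h * ∑ j ∈ Finset.Ico 1 M, ‖u (a + (j : ℤ) * h) (n * τ) - v n j‖ ^ 2
    with hS
  have hstep : ∀ n < N, S (n + 1) - S n ≤ τ * L * (S (n + 1) + S n) + τ * ((b - a) * ρ ^ 2) := by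
    intro n hn
    have t1 := htn n hn.le
    have t2 := htn (n + 1) hn
    have e2 : ((n + 1 : ℕ) : ℝ) * τ = n * τ + τ := by push_cast; ring
    have := FGLE.midpoint_energy_step (α := α) (ν := ν) (η := η) (κ := κ) (ζ := ζ) (γ := γ)
      (K := K) (ρ := ρ) (M := M) (U := fun j => u (a + j * h) (n * τ))
      (U' := fun j => u (a + j * h) ((n + 1 : ℕ) * τ)) (V := v n) (V' := v (n + 1))
      hα₁ hα₂ hν hκ hh0 hτ0 (hout n hn.le) (hout (n + 1) hn)
      (fun j => by
        rw [norm_div, Complex.norm_ofNat, div_le_iff₀ two_pos]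
        refine (norm_add_le _ _).trans ?_
        linarith [hKu (a + j * h) _ t1, hKu (a + j * h) _ t2])
      (fun j hj => by
        have := hC M h hh0 hMb j hj (n * τ) τ t1.1 hτ0 (by rw [← e2]; exact t2.2)
        rw [e2]
        simpa only [Int.cast_natCast] using this)
      (fun j hj => by
        have := hv.scheme n hn j hj
        rw [← hτ, ← hh] at this
        rw [FGLE.cubic, ← mul_assoc]
        exact this)
    rw [mul_comm h (M : ℝ), hMh] at this
    exact this
  have hS0 : S 0 = 0 := by
    have : ∀ j : ℕ, u (a + (j : ℤ) * h) ((0 : ℕ) * τ) - v 0 j = 0 := fun j => by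
      rw [hv.initial, Nat.cast_zero, zero_mul, hu.initial, hh, sub_self]
    simp only [hS, this]
    simp
  have hτL : τ * L ≤ 1 / 2 := by
    rw [le_div_iff₀ (by positivity)] at hτ₀
    linarith
  have hfin := FGLE.discrete_gronwall hS0 hL0.le hτ0 hτL (by positivity) hstep hn
  have hSn : S n ≤ Q * ρ ^ 2 := by
    refine hfin.trans ?_
    rw [hQ, mul_assoc (Real.exp _)]
    have h1 := (htn n hn).2
    have h0 := (htn n hn).1
    have h2 : 2 * (n * τ) * ((b - a) * ρ ^ 2) ≤ 2 * T * (b - a) * ρ ^ 2 := by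
      rw [mul_assoc (2 * T)]
      gcongr
    exact mul_le_mul (Real.exp_le_exp.2 (by gcongr)) h2 (by positivity) (by positivity)
  have hgrid : FGLE.gridNorm h M (fun j => u (a + j * h) (n * τ) - v n j) = Real.sqrt (S n) := rfl
  rw [hgrid]
  refine (Real.sqrt_le_sqrt hSn).trans ?_
  rw [Real.sqrt_mul (by positivity), Real.sqrt_sq hρ0, hρ, ← mul_assoc, add_mul]
  have : 0 ≤ τ ^ 2 + h ^ 2 := by positivity
  linarith
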